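/- Let $\mathbb K$ be $\mathbb R$ or $\mathbb C$, let $\psi_{\mathbb K}$ be a nontrivial unitary character of $\mathbb K$ and let $\chi_{\mathbb K^\times}\colon\mathbb K^\times\to\mathbb C^\times$ be a continuous character. Let $G_{4,2}=\mathrm{GL}_4(\mathbb K)\times\mathrm{GL}_2(\mathbb K)$, with elements written as block diagonal matrices of size six in blocks of size two, and equip $G_{4,2}$ with the bi-invariant pseudo-Riemannian metric $\langle X,Y\rangle_x=\operatorname{Re}\operatorname{tr}(x^{-1}X\,x^{-1}Y)$. Let $$S_{4,2}=\left\{\begin{bmatrix}a&b&0\\0&a&0\\0&0&a\end{bmatrix}: a\in\mathrm{GL}_2(\mathbb K),\ b\in\mathfrak{gl}_2(\mathbb K)\right\},\qquad \chi_S\left(\begin{bmatrix}1&b&0\\0&1&0\\0&0&1\end{bmatrix}\begin{bmatrix}a&0&0\\0&a&0\\0&0&a\end{bmatrix}\right)=\chi_{\mathbb K^\times}(\det a)\,\psi_{\mathbb K}(\operatorname{tr} b),$$ let $H_{4,2}=S_{4,2}\times S_{4,2}$ act on $G_{4,2}$ by $(g_1,g_2)x=g_1xg_2^{\mathsf T}$,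 and let $\chi_{4,2}=\chi_S\otimes\chi_S$. Definitions. Let a Lie group $H$ with a character $\chi$ act smoothly on a pseudo-Riemannian manifold $M$ (submanifolds are smooth, embedded and locally closed). (i) A submanifold $Z\subset M$ is metrically proper if for every $z\in Z$ the tangent space $T_z(Z)$ is contained in a proper nondegenerate subspace of $T_z(M)$. (ii) A local $H$ slice of an $H$-stable submanifold $Z$ is a submanifold $\mathfrak Z$ of $Z$ for which the action map $H\times\mathfrak Z\to Z$ is a submersion. (iii) An $H$-stable submanifold $Z\subset M$ is unipotently $\chi$-incompatible if for every $z_0\in Z$ there are a local $H$ slice $\mathfrak Z\ni z_0$ of $Z$ and a smooth map $\phi\colon\mathfrak Z\to H$ such that for all $z\in\mathfrak Z$: $\phi(z)z=z$; the linear map of $T_z(M)/T_z(Z)$ induced by the action of $\phi(z)$ is unipotent; and $\chi(\phi(z))\ne1$. (iv) An $H$-stable locally closed subset $Z\subset M$ has the $U_\chi M$ property if there is a finite filtration $Z=Z_0\supset Z_1\supset\cdots\supset Z_k\supset Z_{k+1}=\emptyset$ by $H$-stable closed subsets of $Z$ such that each $Z_i\setminus Z_{i+1}$ is a submanifold of $M$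 which is either unipotently $\chi$-incompatible or metrically proper in $M$. Proposition. The set $$Z_4=\left\{\begin{bmatrix}a_{11}&a_{12}&0\\a_{21}&a_{22}&0\\0&0&y\end{bmatrix}\in G_{4,2}:\ y^{-1}a_{22}\text{ is nilpotent and nonzero}\right\}$$ is an $H_{4,2}$-stable submanifold of $G_{4,2}$, and it has the $U_{\chi_{4,2}}M$ property for the action of $H_{4,2}$. -/

import Mathlib

open scoped ContDiff Topology Matrix

attribute [local instance] Matrix.normedAddCommGroup Matrix.normedSpace

namespace UChiM

/-! ### Submanifolds of an open subset of a vector space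

All manifolds `M` considered below are open subsets of a finite dimensional real vector space `E`.
Hence every tangent space `T_z(M)` is `E`, and a submanifold of `M` is a submanifold of `E` which is
contained in `M`. -/

section Submanifold

variable {E : Type*} [NormedAddCommGroup E] [NormedSpace ℝ E]

/-- `Z` is a (locally closed, embedded, smooth) submanifold of `E`, of pure codimension `d` for some
`d`: near each of its points, `Z` is the zero set of a smooth submersion to `ℝ^d`. -/
def IsSubmanifold (Z : Set E) : Prop :=
  ∃ d : ℕ, ∀ z ∈ Z, ∃ (U : Set E) (f : E → (Fin d → ℝ)),
    IsOpen U ∧ z ∈ U ∧ ContDiffOn ℝ ∞ f U ∧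
      (∀ x ∈ U, Function.Surjective (fderiv ℝ f x)) ∧ Z ∩ U = {x | x ∈ U ∧ f x = 0}

/-- `γ` is a smooth curve, defined near `0`, which lies in `Z` and starts at `z`. -/
def IsSmoothCurveIn (Z : Set E) (z : E) (γ : ℝ → E) : Prop :=
  γ 0 = z ∧ ∀ᶠ t in 𝓝 (0 : ℝ), γ t ∈ Z ∧ ContDiffAt ℝ ∞ γ t

/-- The tangent space `T_z(Z)`: the space of initial velocities of the smooth curves in `Z` which
start at `z`. (If `Z` is a submanifold, these velocities already form a linear subspace; the span
is taken so that the notion is a subspace for every set `Z`.) -/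
def tangentSpace (Z : Set E) (z : E) : Submodule ℝ E :=
  Submodule.span ℝ {v | ∃ γ : ℝ → E, IsSmoothCurveIn Z z γ ∧ HasDerivAt γ v 0}

/-- For a pseudo Riemannian metric `g` (a family of bilinear forms on the tangent spaces), a
submanifold `Z` is metrically proper if each tangent space of `Z` is contained in a proper
nondegenerate subspace of the ambient tangent space. -/
def IsMetricallyProper (g : E → LinearMap.BilinForm ℝ E) (Z : Set E) : Prop :=
  IsSubmanifold Z ∧ ∀ z ∈ Z, ∃ W : Submodule ℝ E,
    tangentSpace Z z ≤ W ∧ W ≠ ⊤ ∧ ((g z).restrict W).Nondegenerate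

end Submanifold

/-! ### Actions of Lie groups

`H` is a Lie group which is realised, via an injective map `ι`, as an embedded submanifold of a
finite dimensional real vector space `F` (for example a closed group of matrices). A map to `H` is
smooth exactly when its composition with `ι` is. -/

section Action

variable {E F H : Type*} [NormedAddCommGroup E] [NormedSpace ℝ E] [NormedAddCommGroup F]
  [NormedSpace ℝ F] [Group H] [MulAction H E]

/-- `Z` is stable under the action of `H`. -/
def IsStable (H : Type*) [Group H] [MulAction H E] (Z : Set E) : Prop :=
  ∀ (h : H), ∀ z ∈ Z, h • z ∈ Z

/-- `S` is a local `H` slice of `Z`: a submanifold of `Z` such that the action map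
`H × S → Z` is a submersion. The last condition says that the differential of the action map is
onto at every `(h, z)`: each tangent vector `v` of `Z` at `h • z` is the initial velocity of the
image of a smooth curve `t ↦ (c t, γ t)` in `H × S` which starts at `(h, z)`. -/
def IsLocalSlice (ι : H → F) (Z S : Set E) : Prop :=
  IsSubmanifold S ∧ S ⊆ Z ∧ ∀ (h : H), ∀ z ∈ S, ∀ v ∈ tangentSpace Z (h • z),
    ∃ (c : ℝ → H) (γ : ℝ → E), c 0 = h ∧ (∀ᶠ t in 𝓝 (0 : ℝ), ContDiffAt ℝ ∞ (fun t => ι (c t)) t) ∧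
      IsSmoothCurveIn S z γ ∧ HasDerivAt (fun t => c t • γ t) v 0

/-- The map `T_z(M) / T_z(Z) → T_z(M) / T_z(Z)` induced by the action of `h` is well defined and
unipotent. It is used when `h` fixes `z`. -/
def ActsUnipotentlyOnNormal (h : H) (Z : Set E) (z : E) : Prop :=
  ∃ hT : tangentSpace Z z ≤
      (tangentSpace Z z).comap (fderiv ℝ (fun x : E => h • x) z : E →ₗ[ℝ] E),
    IsNilpotent ((tangentSpace Z z).mapQ (tangentSpace Z z)
      (fderiv ℝ (fun x : E => h • x) z : E →ₗ[ℝ] E) hT - 1)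

/-- An `H` stable submanifold `Z` is unipotently `χ`-incompatible if through every point of `Z`
there is a local `H` slice `S` of `Z` and a smooth map `φ : S → H` such that, for all `z ∈ S`, the
element `φ z` fixes `z`, acts unipotently on `T_z(M) / T_z(Z)`, and satisfies `χ (φ z) ≠ 1`. -/
def IsUnipotentlyIncompatible (ι : H → F) (χ : H →* ℂˣ) (Z : Set E) : Prop :=
  IsSubmanifold Z ∧ IsStable H Z ∧ ∀ z₀ ∈ Z, ∃ (S : Set E) (φ : E → H),
    z₀ ∈ S ∧ IsLocalSlice ι Z S ∧ ContDiffOn ℝ ∞ (fun z => ι (φ z)) S ∧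
      ∀ z ∈ S, φ z • z = z ∧ ActsUnipotentlyOnNormal (φ z) Z z ∧ χ (φ z) ≠ 1

/-- The `U_χ M` property of an `H` stable locally closed set `Z`: there is a finite filtration
`Z = Z_0 ⊇ Z_1 ⊇ ⋯ ⊇ Z_k ⊇ Z_{k+1} = ∅` by `H` stable subsets which are closed in `Z`, such that
each `Z_i \ Z_{i+1}` is a submanifold which is unipotently `χ`-incompatible or metrically
proper. -/
def HasUChiMProperty (ι : H → F) (χ : H →* ℂˣ) (g : E → LinearMap.BilinForm ℝ E)
    (Z : Set E) : Prop :=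
  IsStable H Z ∧ IsLocallyClosed Z ∧ ∃ (k : ℕ) (A : ℕ → Set E),
    A 0 = Z ∧ A (k + 1) = ∅ ∧
    (∀ i ≤ k, A (i + 1) ⊆ A i) ∧
    (∀ i ≤ k, IsStable H (A i) ∧ ∃ C : Set E, IsClosed C ∧ A i = Z ∩ C) ∧
    ∀ i ≤ k, IsUnipotentlyIncompatible ι χ (A i \ A (i + 1)) ∨
      IsMetricallyProper g (A i \ A (i + 1))

end Action

/-! ### The groups `GL₄ × GL₂`, `S₄,₂`, `H₄,₂` and the set `Z₄`

Matrices of size four are written in blocks of size two, so their rows and columns are indexed by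
`Fin 2 ⊕ Fin 2`. -/

section Groups

variable (K : Type*) [RCLike K]

/-- `𝔤𝔩₂(K)`. -/
abbrev Mat2 : Type _ := Matrix (Fin 2) (Fin 2) K

/-- `𝔤𝔩₄(K)`, in blocks of size two. -/
abbrev Mat4 : Type _ := Matrix (Fin 2 ⊕ Fin 2) (Fin 2 ⊕ Fin 2) K

/-- `𝔤𝔩₄(K) × 𝔤𝔩₂(K)`. -/
abbrev gl42 : Type _ := Mat4 K × Mat2 K

/-- The manifold `G₄,₂ = GL₄(K) × GL₂(K)`, an open subset of `𝔤𝔩₄(K) × 𝔤𝔩₂(K)`. -/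
def G42 : Set (gl42 K) := {x | IsUnit x.1 ∧ IsUnit x.2}

/-- The bi-invariant metric on `G₄,₂` which at the identity is the real trace form
`(X, Y) ↦ Re tr (X Y)`, the trace being that of block diagonal matrices of size six. -/
noncomputable def traceMetric (x : gl42 K) : LinearMap.BilinForm ℝ (gl42 K) :=
  LinearMap.mk₂ ℝ
    (fun X Y => RCLike.re ((x.1⁻¹ * X.1 * (x.1⁻¹ * Y.1)).trace +
      (x.2⁻¹ * X.2 * (x.2⁻¹ * Y.2)).trace))
    (by intro X X' Y; simp [mul_add, add_mul]; ring)
    (by intro r X Y; simp [RCLike.smul_re, mul_add])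
    (by intro X Y Y'; simp [mul_add]; ring)
    (by intro r X Y; simp [RCLike.smul_re, mul_add])

/-- The group `S₄,₂` of all `([[a, b], [0, a]], a)` in `GL₄(K) × GL₂(K)`. -/
def S42 : Subgroup (GL (Fin 2 ⊕ Fin 2) K × GL (Fin 2) K) where
  carrier := {s | ∃ b : Mat2 K, (s.1 : Mat4 K) = Matrix.fromBlocks (s.2 : Mat2 K) b 0 (s.2 : Mat2 K)}
  one_mem' := ⟨0, by simp⟩
  mul_mem' := by
    rintro s t ⟨b, hb⟩ ⟨c, hc⟩
    refine ⟨(s.2 : Mat2 K) * c + b * (t.2 : Mat2 K), ?_⟩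
    simp [hb, hc, Matrix.fromBlocks_multiply]
  inv_mem' := by
    rintro s ⟨b, hb⟩
    refine ⟨-(((s.2⁻¹ : GL (Fin 2) K) : Mat2 K) * b * ((s.2⁻¹ : GL (Fin 2) K) : Mat2 K)), ?_⟩
    have h1 : ((s.2 : Mat2 K)) * ((s.2⁻¹ : GL (Fin 2) K) : Mat2 K) = 1 := Units.mul_inv s.2
    have h : (s.1 : Mat4 K) * Matrix.fromBlocks ((s.2⁻¹ : GL (Fin 2) K) : Mat2 K)
        (-(((s.2⁻¹ : GL (Fin 2) K) : Mat2 K) * b * ((s.2⁻¹ : GL (Fin 2) K) : Mat2 K))) 0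
        ((s.2⁻¹ : GL (Fin 2) K) : Mat2 K) = 1 := by
      rw [hb, Matrix.fromBlocks_multiply, ← Matrix.fromBlocks_one]
      congr 1
      · simp
      · rw [mul_neg, ← mul_assoc, ← mul_assoc, h1, one_mul, neg_add_cancel]
      · simp
      · simp
    exact Units.inv_eq_of_mul_eq_one_right h

/-- `H₄,₂ = S₄,₂ × S₄,₂`. -/
abbrev H42 : Type _ := S42 K × S42 K

variable {K}

/-- The action `(g₁, g₂) x = g₁ x g₂ᵀ` of `H₄,₂`. -/
instance : MulAction (H42 K) (gl42 K) where
  smul h x := (((h.1 : GL (Fin 2 ⊕ Fin 2) K × GL (Fin 2) K).1 : Mat4 K) * x.1 *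
      ((h.2 : GL (Fin 2 ⊕ Fin 2) K × GL (Fin 2) K).1 : Mat4 K)ᵀ,
    ((h.1 : GL (Fin 2 ⊕ Fin 2) K × GL (Fin 2) K).2 : Mat2 K) * x.2 *
      ((h.2 : GL (Fin 2 ⊕ Fin 2) K × GL (Fin 2) K).2 : Mat2 K)ᵀ)
  one_smul x := by
    change (_, _) = x
    simp
  mul_smul g h x := by
    refine Prod.ext ?_ ?_
    · change ((((g.1 * h.1 : S42 K) : GL (Fin 2 ⊕ Fin 2) K × GL (Fin 2) K).1 : Mat4 K) * x.1 *
        ((((g.2 * h.2 : S42 K) : GL (Fin 2 ⊕ Fin 2) K × GL (Fin 2) K).1 : Mat4 K))ᵀ) =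
        _ * (_ * x.1 * _) * _
      simp [Matrix.transpose_mul, mul_assoc]
    · change ((((g.1 * h.1 : S42 K) : GL (Fin 2 ⊕ Fin 2) K × GL (Fin 2) K).2 : Mat2 K) * x.2 *
        ((((g.2 * h.2 : S42 K) : GL (Fin 2 ⊕ Fin 2) K × GL (Fin 2) K).2 : Mat2 K))ᵀ) =
        _ * (_ * x.2 * _) * _
      simp [Matrix.transpose_mul, mul_assoc]

/-- The realisation of `H₄,₂` as a group of matrices. -/
def H42.toMatrices (h : H42 K) : gl42 K × gl42 K :=
  (((h.1 : GL (Fin 2 ⊕ Fin 2) K × GL (Fin 2) K).1,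
      (h.1 : GL (Fin 2 ⊕ Fin 2) K × GL (Fin 2) K).2),
    ((h.2 : GL (Fin 2 ⊕ Fin 2) K × GL (Fin 2) K).1,
      (h.2 : GL (Fin 2 ⊕ Fin 2) K × GL (Fin 2) K).2))

/-- The `K`-valued function `tr (b a⁻¹)` on `S₄,₂`; its argument is
`[[a, b], [0, a]] = [[1, b a⁻¹], [0, 1]] * [[a, 0], [0, a]]`. -/
def trPart (s : S42 K) : K :=
  (((s : GL (Fin 2 ⊕ Fin 2) K × GL (Fin 2) K).1 : Mat4 K).toBlocks₁₂ *
    (((s : GL (Fin 2 ⊕ Fin 2) K × GL (Fin 2) K).2⁻¹ : GL (Fin 2) K) : Mat2 K)).trace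

theorem trPart_one : trPart (1 : S42 K) = 0 := by
  have : (1 : Mat4 K).toBlocks₁₂ = 0 := by
    rw [← Matrix.fromBlocks_one, Matrix.toBlocks_fromBlocks₁₂]
  simp [trPart, this]

theorem trPart_mul (s t : S42 K) : trPart (s * t) = trPart s + trPart t := by
  obtain ⟨⟨s1, s2⟩, b, hb⟩ := s
  obtain ⟨⟨t1, t2⟩, c, hc⟩ := t
  simp only at hb hc
  have h2 : (t2 : Mat2 K) * ((t2⁻¹ : GL (Fin 2) K) : Mat2 K) = 1 := Units.mul_inv t2
  have h1 : ((s2⁻¹ : GL (Fin 2) K) : Mat2 K) * (s2 : Mat2 K) = 1 := Units.inv_mul s2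
  have e : ((((s1 * t1 : GL (Fin 2 ⊕ Fin 2) K)) : Mat4 K).toBlocks₁₂ *
      (((s2 * t2)⁻¹ : GL (Fin 2) K) : Mat2 K)) =
      (s2 : Mat2 K) * (c * ((t2⁻¹ : GL (Fin 2) K) : Mat2 K)) * ((s2⁻¹ : GL (Fin 2) K) : Mat2 K) +
        b * ((s2⁻¹ : GL (Fin 2) K) : Mat2 K) := by
    rw [mul_inv_rev, Units.val_mul, Units.val_mul, hb, hc, Matrix.fromBlocks_multiply,
      Matrix.toBlocks_fromBlocks₁₂, add_mul]
    congr 1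
    · simp only [mul_assoc]
    · rw [mul_assoc, ← mul_assoc (t2 : Mat2 K), h2, one_mul]
  change (((((s1 * t1 : GL (Fin 2 ⊕ Fin 2) K)) : Mat4 K).toBlocks₁₂ *
      (((s2 * t2)⁻¹ : GL (Fin 2) K) : Mat2 K))).trace =
    (((s1 : Mat4 K).toBlocks₁₂ * ((s2⁻¹ : GL (Fin 2) K) : Mat2 K))).trace +
    (((t1 : Mat4 K).toBlocks₁₂ * ((t2⁻¹ : GL (Fin 2) K) : Mat2 K))).trace
  rw [e, hb, hc, Matrix.toBlocks_fromBlocks₁₂, Matrix.toBlocks_fromBlocks₁₂, Matrix.trace_add,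
    Matrix.trace_mul_comm, ← mul_assoc, h1, one_mul, add_comm]

/-- The character
`[[1, b], [0, 1]] * [[a, 0], [0, a]] ↦ χ_K (det a) ψ (tr b)` of `S₄,₂`. -/
noncomputable def chiS42 (ψ : AddChar K Circle) (χK : Kˣ →* ℂˣ) : S42 K →* ℂˣ where
  toFun s := χK (Matrix.GeneralLinearGroup.det (s : GL (Fin 2 ⊕ Fin 2) K × GL (Fin 2) K).2) *
    Circle.toUnits (ψ (trPart s))
  map_one' := by simp [trPart_one]
  map_mul' s t := by
    simp only [trPart_mul, AddChar.map_add_eq_mul, map_mul, Subgroup.coe_mul, Prod.snd_mul]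
    exact mul_mul_mul_comm _ _ _ _

/-- The character `χ₄,₂` of `H₄,₂`: `(g₁, g₂) ↦ χ_S (g₁) χ_S (g₂)`. -/
noncomputable def chi42 (ψ : AddChar K Circle) (χK : Kˣ →* ℂˣ) : H42 K →* ℂˣ :=
  (chiS42 ψ χK).coprod (chiS42 ψ χK)

variable (K)

/-- `Z₄`: the set of all `([[a₁₁, a₁₂], [a₂₁, a₂₂]], y)` in `G₄,₂` such that `y⁻¹ a₂₂` is nilpotent
and nonzero. -/
def Z4 : Set (gl42 K) :=
  {x | x ∈ G42 K ∧ IsNilpotent (x.2⁻¹ * x.1.toBlocks₂₂) ∧ x.2⁻¹ * x.1.toBlocks₂₂ ≠ 0}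

end Groups

end UChiM

/-! Divide the blocks of `x` on the left by `y` and write `C, A, B, N` for the results. In these
coordinates `H₄,₂` acts by simultaneous conjugation together with the moves `C ↦ C + bB + Ae + bNe`,
`A ↦ A + bN`, `B ↦ B + Ne`, with `N` fixed (`exists_blk_smul`). On `Z₄` one has `N² = 0` and `N ≠
0`, hence `NXN = tr(XN) N` for every `X`. The filtration is `Z₄ ⊇ {tr AN = tr NB} ⊇ {tr AN = tr NB =
0} ⊇ {cubic = 0} ∪ {AN = NB} ⊇ {AN = NB} ⊇ ∅`, where `cubic = NCN + ANB - BNA`.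

On the first stratum the moves `b = c AN`, `e = -c NB` fix the point, and the character takes the
value `ψ(c (tr AN - tr NB))`, which is not `1` for a suitable `c`. On the third stratum `AN = pN`
and `NB = sN`, where `p, s ≠ 0` because `x` is invertible. There an element with diagonal part `1 +
βN` and suitable `b, e` fixes the point (`stabilizer_identities`). Its character is `ψ` of `β (p -
s) κ / (ps)`, where `cubic = κN`, and neither `p - s` nor `κ` vanishes on that stratum. These
stabilizing elements are unipotent, and the slice is the whole stratum
(`isUnipotentlyIncompatible_of_stabilizer`).

On the other three strata a defining function (`tr AN - tr NB`, an entry of `cubic`, an entry of `AN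
- NB`) has a gradient whose complex square norm is `2 (tr AN)²`, `4 (ps)²`, `4 p²` respectively,
after normalising `y = 1`, `N = E₁₂`. A suitable scalar multiple of the gradient is a nonisotropic
normal vector `v`, and `v^⊥` is a proper nondegenerate subspace containing the tangent space. The
action is linear and isometric, so such checks are needed only at normalised points. -/

namespace UChiM

/-! ### Submanifolds as zero sets of submersions, and their tangent vectors. -/

section General

variable {E : Type*} [NormedAddCommGroup E] [NormedSpace ℝ E]
  {F : Type*} [NormedAddCommGroup F] [NormedSpace ℝ F]

/-- Near `z`, the set `Z` is the zero set of an `F`-valued smooth map, submersive at `z`. -/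
def IsCutOutAt (F : Type*) [NormedAddCommGroup F] [NormedSpace ℝ F] (Z : Set E) (z : E) : Prop :=
  ∃ (U : Set E) (f : E → F), IsOpen U ∧ z ∈ U ∧ ContDiffOn ℝ ∞ f U ∧
    Function.Surjective (fderiv ℝ f z) ∧ ∀ x ∈ U, x ∈ Z ↔ f x = 0

theorem exists_continuous_rightInverse [FiniteDimensional ℝ F] (L : E →L[ℝ] F)
    (hL : Function.Surjective L) : ∃ R : F →L[ℝ] E, L ∘L R = ContinuousLinearMap.id ℝ F := by
  obtain ⟨R, hR⟩ := (L : E →ₗ[ℝ] F).exists_rightInverse_of_surjective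
    (LinearMap.range_eq_top.2 hL)
  refine ⟨LinearMap.toContinuousLinearMap R, ?_⟩
  ext x
  exact LinearMap.congr_fun hR x

/-- Composing with a fixed right inverse `R` of the differential at `z` turns surjectivity into a
consequence of being a unit, which is an open condition. -/
theorem surjective_fderiv_eventually [FiniteDimensional ℝ F] {U : Set E} {f : E → F} {z : E}
    (hU : IsOpen U) (hz : z ∈ U) (hf : ContDiffOn ℝ ∞ f U)
    (hs : Function.Surjective (fderiv ℝ f z)) :
    ∃ V ⊆ U, IsOpen V ∧ z ∈ V ∧ ∀ x ∈ V, Function.Surjective (fderiv ℝ f x) := by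
  obtain ⟨R, hR⟩ := exists_continuous_rightInverse _ hs
  have : CompleteSpace F := FiniteDimensional.complete ℝ F
  have hc : ContinuousOn (fun x => fderiv ℝ f x ∘L R) U :=
    (hf.continuousOn_fderiv_of_isOpen hU (by simp)).clm_comp continuousOn_const
  refine ⟨U ∩ (fun x => fderiv ℝ f x ∘L R) ⁻¹' {u | IsUnit u}, Set.inter_subset_left,
    hc.isOpen_inter_preimage hU Units.isOpen, ⟨hz, ?_⟩, ?_⟩
  · simp only [Set.mem_preimage, Set.mem_ofPred_eq, hR]
    exact isUnit_one
  · rintro x ⟨-, hx⟩ y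
    obtain ⟨u, hu⟩ := hx
    refine ⟨R ((↑u⁻¹ : F →L[ℝ] F) y), ?_⟩
    have h1 : (u : F →L[ℝ] F) * (↑u⁻¹ : F →L[ℝ] F) = 1 := Units.mul_inv u
    have h2 := congrArg (fun T : F →L[ℝ] F => T y) h1
    rw [hu] at h2
    exact h2

theorem isSubmanifold_of_isCutOutAt [FiniteDimensional ℝ F] {Z : Set E}
    (h : ∀ z ∈ Z, IsCutOutAt F Z z) : IsSubmanifold Z := by
  have e : F ≃L[ℝ] (Fin (Module.finrank ℝ F) → ℝ) :=
    ContinuousLinearEquiv.ofFinrankEq (by simp)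
  refine ⟨Module.finrank ℝ F, fun z hz => ?_⟩
  obtain ⟨U, f, hU, hzU, hf, hs, hiff⟩ := h z hz
  obtain ⟨V, hVU, hV, hzV, hVs⟩ := surjective_fderiv_eventually hU hzU hf hs
  refine ⟨V, e ∘ f, hV, hzV, e.contDiff.comp_contDiffOn (hf.mono hVU), fun x hx => ?_, ?_⟩
  · rw [e.comp_fderiv]
    exact e.surjective.comp (hVs x hx)
  · ext x
    simp only [Set.mem_inter_iff, Set.mem_ofPred_eq, Function.comp_apply,
      EmbeddingLike.map_eq_zero_iff]
    constructor
    · rintro ⟨h1, h2⟩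
      exact ⟨h2, (hiff x (hVU h2)).1 h1⟩
    · rintro ⟨h1, h2⟩
      exact ⟨(hiff x (hVU h1)).2 h2, h1⟩

/-- Reduces the local equations to one normalised point in each orbit. -/
theorem IsCutOutAt.of_image {Z : Set E} {z : E} (L : E ≃L[ℝ] E) (hL : ∀ x, L x ∈ Z ↔ x ∈ Z)
    (h : IsCutOutAt F Z (L z)) : IsCutOutAt F Z z := by
  obtain ⟨U, f, hU, hzU, hf, hs, hiff⟩ := h
  refine ⟨L ⁻¹' U, f ∘ L, hU.preimage L.continuous, hzU,
    hf.comp L.contDiff.contDiffOn fun x hx => hx, ?_, fun x hx => ?_⟩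
  · rw [L.comp_right_fderiv]
    exact hs.comp L.surjective
  · rw [← hL x]
    exact hiff _ hx

theorem IsSubmanifold.of_relatively_open {Z Z' : Set E} (hZ : IsSubmanifold Z)
    (h : ∀ z ∈ Z', ∃ V, IsOpen V ∧ z ∈ V ∧ ∀ x ∈ V, x ∈ Z' ↔ x ∈ Z) : IsSubmanifold Z' := by
  obtain ⟨d, hd⟩ := hZ
  refine ⟨d, fun z hz => ?_⟩
  obtain ⟨V, hV, hzV, hVZ⟩ := h z hz
  obtain ⟨U, f, hU, hzU, hf, hs, hiff⟩ := hd z ((hVZ z hzV).1 hz)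
  refine ⟨U ∩ V, f, hU.inter hV, ⟨hzU, hzV⟩, hf.mono Set.inter_subset_left,
    fun x hx => hs x hx.1, ?_⟩
  ext x
  have := Set.ext_iff.1 hiff x
  simp only [Set.mem_inter_iff, Set.mem_ofPred_eq] at this ⊢
  have := hVZ x
  tauto

theorem tangentSpace_mono {Z Z' : Set E} (h : Z ⊆ Z') (z : E) :
    tangentSpace Z z ≤ tangentSpace Z' z := by
  refine Submodule.span_mono ?_
  rintro v ⟨γ, ⟨h0, h1⟩, h2⟩
  exact ⟨γ, ⟨h0, h1.mono fun t ht => ⟨h ht.1, ht.2⟩⟩, h2⟩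

theorem fderiv_eq_zero_of_mem_tangentSpace {Z : Set E} {z : E} {f : E → F}
    (hf : DifferentiableAt ℝ f z) (h : ∀ x ∈ Z, f x = 0) {v : E} (hv : v ∈ tangentSpace Z z) :
    fderiv ℝ f z v = 0 := by
  suffices tangentSpace Z z ≤ LinearMap.ker (fderiv ℝ f z : E →ₗ[ℝ] F) from this hv
  refine Submodule.span_le.2 ?_
  rintro w ⟨γ, ⟨h0, h1⟩, h2⟩
  subst h0
  have h3 : HasDerivAt (f ∘ γ) (fderiv ℝ f (γ 0) w) 0 := hf.hasFDerivAt.comp_hasDerivAt 0 h2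
  have h4 : HasDerivAt (f ∘ γ) 0 0 :=
    (hasDerivAt_const (0 : ℝ) (0 : F)).congr_of_eventuallyEq (h1.mono fun t ht => h _ ht.1)
  exact h3.unique h4

theorem map_mem_tangentSpace {Z Z' : Set E} (L : E →L[ℝ] E) (hL : ∀ x ∈ Z, L x ∈ Z') {z v : E}
    (hv : v ∈ tangentSpace Z z) : L v ∈ tangentSpace Z' (L z) := by
  suffices tangentSpace Z z ≤ (tangentSpace Z' (L z)).comap (L : E →ₗ[ℝ] E) from this hv
  refine Submodule.span_le.2 ?_
  rintro w ⟨γ, ⟨h0, h1⟩, h2⟩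
  refine Submodule.subset_span ⟨L ∘ γ, ⟨by simp [h0], h1.mono fun t ht =>
    ⟨hL _ ht.1, L.contDiff.contDiffAt.comp t ht.2⟩⟩, L.hasFDerivAt.comp_hasDerivAt 0 h2⟩

/-- A tangent vector of a submanifold is the velocity of a smooth curve in it. -/
theorem IsSubmanifold.exists_curve {Z : Set E} (hZ : IsSubmanifold Z) {z : E}
    (hz : z ∈ Z) {v : E} (hv : v ∈ tangentSpace Z z) :
    ∃ γ : ℝ → E, IsSmoothCurveIn Z z γ ∧ HasDerivAt γ v 0 := by
  obtain ⟨d, hd⟩ := hZ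
  obtain ⟨U, f, hU, hzU, hf, hs, hiff⟩ := hd z hz
  have hmem : ∀ x ∈ U, x ∈ Z ↔ f x = 0 := fun x hx => by
    have := Set.ext_iff.1 hiff x
    simpa [hx] using this
  have hfz : f z = 0 := (hmem z hzU).1 hz
  -- The curve is sought as `z + t v + R w(t)`, with `w` found by the inverse function theorem. The
  -- differential of `(t, w) ↦ (t, f (z + t v + R w))` at `0` is the identity, because `f'(z) v = 0`
  -- and `f'(z) R = 1`.
  obtain ⟨R, hR⟩ := exists_continuous_rightInverse _ (hs z hzU)
  have hv0 : fderiv ℝ f z v = 0 := by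
    suffices tangentSpace Z z ≤ LinearMap.ker (fderiv ℝ f z : E →ₗ[ℝ] (Fin d → ℝ)) from this hv
    refine Submodule.span_le.2 ?_
    rintro w ⟨γ, ⟨h0, h1⟩, h2⟩
    subst h0
    have hd : DifferentiableAt ℝ f (γ 0) :=
      (hf.contDiffAt (hU.mem_nhds hzU)).differentiableAt (by simp)
    have h3 : HasDerivAt (f ∘ γ) (fderiv ℝ f (γ 0) w) 0 := hd.hasFDerivAt.comp_hasDerivAt 0 h2
    have h4 : HasDerivAt (f ∘ γ) 0 0 := by
      refine (hasDerivAt_const (0 : ℝ) (0 : Fin d → ℝ)).congr_of_eventuallyEq ?_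
      filter_upwards [h1, h2.continuousAt.preimage_mem_nhds (hU.mem_nhds hzU)] with t ht ht'
      exact (hmem _ ht').1 ht.1
    exact h3.unique h4
  -- the map `(t, w) ↦ (t, f (z + t v + R w))`
  let A : ℝ × (Fin d → ℝ) →L[ℝ] E :=
    (ContinuousLinearMap.toSpanSingleton ℝ v).coprod R
  let a : ℝ × (Fin d → ℝ) → E := fun u => z + A u
  have ha : ContDiff ℝ ∞ a := contDiff_const.add A.contDiff
  have ha' : ∀ u, HasFDerivAt a A u := fun u => A.hasFDerivAt.const_add z
  have ha0 : a 0 = z := by simp [a]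
  let Φ : ℝ × (Fin d → ℝ) → ℝ × (Fin d → ℝ) := fun u => (u.1, f (a u))
  have hUa : IsOpen (a ⁻¹' U) := hU.preimage ha.continuous
  have h0U : (0 : ℝ × (Fin d → ℝ)) ∈ a ⁻¹' U := by simpa [ha0] using hzU
  have hΦ : ContDiffOn ℝ ∞ Φ (a ⁻¹' U) :=
    contDiff_fst.contDiffOn.prodMk (hf.comp ha.contDiffOn fun x hx => hx)
  have hΦ' : ∀ u ∈ a ⁻¹' U,
      HasFDerivAt Φ ((ContinuousLinearMap.fst ℝ ℝ (Fin d → ℝ)).prod (fderiv ℝ f (a u) ∘L A)) u := by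
    intro u hu
    have hd : DifferentiableAt ℝ f (a u) :=
      (hf.contDiffAt (hU.mem_nhds hu)).differentiableAt (by simp)
    exact hasFDerivAt_fst.prodMk (hd.hasFDerivAt.comp u (ha' u))
  have hderiv0 : (ContinuousLinearMap.fst ℝ ℝ (Fin d → ℝ)).prod (fderiv ℝ f (a 0) ∘L A) =
      ((ContinuousLinearEquiv.refl ℝ (ℝ × (Fin d → ℝ)) : (ℝ × (Fin d → ℝ)) ≃L[ℝ] (ℝ × (Fin d → ℝ))) :
        (ℝ × (Fin d → ℝ)) →L[ℝ] (ℝ × (Fin d → ℝ))) := by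
    have hRw : ∀ w, fderiv ℝ f z (R w) = w := fun w => by
      simpa using congrArg (fun T => T w) hR
    refine ContinuousLinearMap.ext fun u => Prod.ext rfl ?_
    simp [A, ha0, hv0, hRw]
  have hΦat : ContDiffAt ℝ ∞ Φ 0 := hΦ.contDiffAt (hUa.mem_nhds h0U)
  have hΦ0 := hΦ' 0 h0U
  rw [hderiv0] at hΦ0
  let P := hΦat.toOpenPartialHomeomorph Φ hΦ0 (by simp)
  have hPcoe : (P : ℝ × (Fin d → ℝ) → ℝ × (Fin d → ℝ)) = Φ := rfl
  have h0P : (0 : ℝ × (Fin d → ℝ)) ∈ P.source := hΦat.mem_toOpenPartialHomeomorph_source hΦ0 (by simp)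
  have hΦ00 : Φ 0 = 0 := by simp [Φ, ha0, hfz]
  have hsymm0 : P.symm 0 = 0 := by
    have := P.left_inv h0P
    rwa [hPcoe, hΦ00] at this
  have h0T : (0 : ℝ × (Fin d → ℝ)) ∈ P.target := by
    have := P.map_source h0P
    rwa [hPcoe, hΦ00] at this
  -- points near `0` at which the differential of `Φ` is invertible
  have hcont : ContinuousOn (fderiv ℝ Φ) (a ⁻¹' U) :=
    hΦ.continuousOn_fderiv_of_isOpen hUa (by simp)
  have hW : IsOpen (a ⁻¹' U ∩ fderiv ℝ Φ ⁻¹' Set.range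
      ((↑) : ((ℝ × (Fin d → ℝ)) ≃L[ℝ] (ℝ × (Fin d → ℝ))) → (ℝ × (Fin d → ℝ)) →L[ℝ] (ℝ × (Fin d → ℝ)))) :=
    hcont.isOpen_inter_preimage hUa (ContinuousLinearEquiv.isOpen)
  set W := a ⁻¹' U ∩ fderiv ℝ Φ ⁻¹' Set.range
      ((↑) : ((ℝ × (Fin d → ℝ)) ≃L[ℝ] (ℝ × (Fin d → ℝ))) → (ℝ × (Fin d → ℝ)) →L[ℝ] (ℝ × (Fin d → ℝ))) with hWdef
  have h0W : (0 : ℝ × (Fin d → ℝ)) ∈ W := ⟨h0U, ⟨ContinuousLinearEquiv.refl ℝ _, hΦ0.fderiv.symm⟩⟩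
  -- Smoothness of the curve is demanded at all `t` near `0`, so the differential must be invertible
  -- on a neighbourhood and not only at the origin.
  have hsm : ∀ u ∈ P.target, P.symm u ∈ W → ContDiffAt ℝ ∞ P.symm u := by
    rintro u hu ⟨hu1, e, he⟩
    refine P.contDiffAt_symm (f₀' := e) hu ?_ (hΦ.contDiffAt (hUa.mem_nhds hu1))
    rw [he]
    exact ((hΦ.contDiffAt (hUa.mem_nhds hu1)).differentiableAt (by simp)).hasFDerivAt
  let ℓ : ℝ → ℝ × (Fin d → ℝ) := fun t => (t, 0)
  have hℓ : ContDiff ℝ ∞ ℓ := contDiff_id.prodMk contDiff_const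
  have hℓ0 : ℓ 0 = 0 := rfl
  have hev : ∀ᶠ t in 𝓝 (0 : ℝ), ℓ t ∈ P.target ∧ P.symm (ℓ t) ∈ W := by
    have h1 : ∀ᶠ u in 𝓝 (0 : ℝ × (Fin d → ℝ)), u ∈ P.target ∧ P.symm u ∈ W := by
      refine Filter.Eventually.and (P.open_target.mem_nhds h0T) ?_
      have := P.symm.continuousAt h0T
      refine this.preimage_mem_nhds ?_
      rw [hsymm0]
      exact hW.mem_nhds h0W
    have h2 : Filter.Tendsto ℓ (𝓝 0) (𝓝 0) := by
      rw [← hℓ0]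
      exact hℓ.continuous.continuousAt
    exact h2.eventually h1
  refine ⟨fun t => a (P.symm (ℓ t)), ⟨by simp [hℓ0, hsymm0, ha0], ?_⟩, ?_⟩
  · filter_upwards [hev] with t ht
    refine ⟨(hmem _ ht.2.1).2 ?_, ha.contDiffAt.comp t ((hsm _ ht.1 ht.2).comp t hℓ.contDiffAt)⟩
    have := P.right_inv ht.1
    exact congrArg Prod.snd this
  · have h1 : HasFDerivAt P.symm
        ((ContinuousLinearEquiv.refl ℝ (ℝ × (Fin d → ℝ))).symm : (ℝ × (Fin d → ℝ)) →L[ℝ] (ℝ × (Fin d → ℝ))) (ℓ 0) := by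
      refine P.hasFDerivAt_symm h0T ?_
      change HasFDerivAt P _ (P.symm 0)
      rw [hsymm0]
      exact hΦ0
    have h2 : HasDerivAt ℓ (1, 0) 0 := (hasDerivAt_id _).prodMk (hasDerivAt_const _ _)
    have h3 := (ha' (P.symm (ℓ 0))).comp_hasDerivAt 0 (h1.comp_hasDerivAt 0 h2)
    convert! h3 using 1
    simp [A]

end General

/-! ### Algebra of a nonzero nilpotent two by two matrix. -/

section TwoByTwo

variable {K : Type*} [RCLike K]

/-- The polarised Cayley–Hamilton identity for two by two matrices. -/
theorem mul_add_mul_eq (X Y : Mat2 K) :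
    X * Y + Y * X = Y.trace • X + X.trace • Y + ((X * Y).trace - X.trace * Y.trace) • 1 := by
  ext i j
  fin_cases i <;> fin_cases j <;>
    simp [Matrix.mul_apply, Matrix.trace_fin_two, Fin.sum_univ_two] <;> ring

theorem mul_self_eq (N : Mat2 K) : N * N = N.trace • N - N.det • 1 := by
  ext i j
  fin_cases i <;> fin_cases j <;>
    simp [Matrix.mul_apply, Matrix.trace_fin_two, Matrix.det_fin_two, Fin.sum_univ_two] <;> ring

theorem isNilpotent_iff (N : Mat2 K) : IsNilpotent N ↔ N.trace = 0 ∧ N.det = 0 := by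
  constructor
  · intro h
    refine ⟨(Matrix.isNilpotent_trace_of_isNilpotent h).eq_zero, ?_⟩
    obtain ⟨k, hk⟩ := h
    exact eq_zero_of_pow_eq_zero (n := k) (by rw [← Matrix.det_pow, hk, Matrix.det_zero])
  · rintro ⟨h1, h2⟩
    exact ⟨2, by rw [pow_two, mul_self_eq, h1, h2]; simp⟩

theorem trace_eq_zero_of_sq {N : Mat2 K} (h : N * N = 0) : N.trace = 0 :=
  ((isNilpotent_iff N).1 ⟨2, by rw [pow_two, h]⟩).1

theorem sq_eq_zero_of_isNilpotent {N : Mat2 K} (h : IsNilpotent N) : N * N = 0 := by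
  obtain ⟨h1, h2⟩ := (isNilpotent_iff N).1 h
  rw [mul_self_eq, h1, h2]; simp

/-- Multiply the polarised Cayley–Hamilton identity for `X`, `N` by `N` on the left; the terms with
`N²` or `tr N` drop out. -/
theorem mul_mul_self_of_sq {N : Mat2 K} (h : N * N = 0) (X : Mat2 K) :
    N * (X * N) = (X * N).trace • N := by
  have h1 := congrArg (fun M => N * M) (mul_add_mul_eq X N)
  simp only [mul_add, ← mul_assoc N N, h, trace_eq_zero_of_sq h, zero_mul, Matrix.mul_smul] at h1
  simpa using h1

theorem trace_mul_conjTranspose_ne_zero {N : Mat2 K} (h : N ≠ 0) : (N * Nᴴ).trace ≠ 0 := by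
  open scoped ComplexOrder in
  exact fun h0 => h (Matrix.trace_mul_conjTranspose_self_eq_zero_iff.1 h0)

/-- Serves as a partition of the identity attached to `N`. It replaces a choice of basis adapted to
`N`, so the formulas built from it depend smoothly on `N`. -/
theorem mul_conjTranspose_add {N : Mat2 K} (h : N * N = 0) :
    N * Nᴴ + Nᴴ * N = (N * Nᴴ).trace • 1 := by
  rw [mul_add_mul_eq, Matrix.trace_conjTranspose, trace_eq_zero_of_sq h]
  simp

/-- A matrix killed on both sides by a nonzero nilpotent matrix is a multiple of it. -/
theorem exists_eq_smul {N M : Mat2 K} (h : N * N = 0) (hN : N ≠ 0) (h1 : N * M = 0)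
    (h2 : M * N = 0) : ∃ c : K, M = c • N := by
  set ν := (N * Nᴴ).trace with hν
  have hν0 : ν ≠ 0 := trace_mul_conjTranspose_ne_zero hN
  have e := mul_conjTranspose_add h
  -- The partition of the identity puts a factor `N` on either side of `M`. Doing both gives `ν² M =
  -- N (Nᴴ M Nᴴ) N`, a multiple of `N`.
  have e1 : ν • M = N * (Nᴴ * M) := by
    have := congrArg (fun T => T * M) e
    simp only [add_mul, mul_assoc, h1, mul_zero, add_zero, Matrix.smul_mul, one_mul] at this
    exact this.symm
  have e2 : ν • M = M * Nᴴ * N := by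
    have := congrArg (fun T => M * T) e
    simp only [mul_add, ← mul_assoc, h2, zero_mul, zero_add, Matrix.mul_smul, mul_one] at this
    exact this.symm
  have e3 : ν • ν • M = ((Nᴴ * M * Nᴴ) * N).trace • N := by
    rw [e2, ← Matrix.smul_mul, ← Matrix.smul_mul, e1, ← mul_mul_self_of_sq h]
    simp only [mul_assoc]
  refine ⟨ν⁻¹ * (ν⁻¹ * ((Nᴴ * M * Nᴴ) * N).trace), ?_⟩
  rw [mul_smul, mul_smul, ← e3, smul_smul ν⁻¹ ν, inv_mul_cancel₀ hν0, one_smul, smul_smul,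
    inv_mul_cancel₀ hν0, one_smul]

/-- `AN` is killed by `N` on both sides, as `NAN = tr(AN) N = 0`, so it is a multiple of `N`;
Cayley–Hamilton then gives `NA`. -/
theorem exists_mul_right_eq_smul {N A : Mat2 K} (h : N * N = 0) (hN : N ≠ 0)
    (hA : (A * N).trace = 0) :
    ∃ p : K, A * N = p • N ∧ N * A = (A.trace - p) • N := by
  obtain ⟨p, hp⟩ := exists_eq_smul (M := A * N) h hN
    (by rw [mul_mul_self_of_sq h, hA, zero_smul]) (by rw [mul_assoc, h, mul_zero])
  refine ⟨p, hp, ?_⟩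
  have := mul_add_mul_eq A N
  rw [hA, trace_eq_zero_of_sq h, hp] at this
  rw [sub_smul, eq_sub_iff_add_eq']
  simpa using this

theorem exists_mul_left_eq_smul {N B : Mat2 K} (h : N * N = 0) (hN : N ≠ 0)
    (hB : (N * B).trace = 0) :
    ∃ s : K, N * B = s • N ∧ B * N = (B.trace - s) • N := by
  rw [Matrix.trace_mul_comm] at hB
  obtain ⟨p, hp, hp'⟩ := exists_mul_right_eq_smul h hN hB
  exact ⟨B.trace - p, hp', by rw [hp, sub_sub_cancel]⟩

/-- The obstruction `N C N + A N B - B N A`. -/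
def cubic (C A B N : Mat2 K) : Mat2 K := N * C * N + A * N * B - B * N * A

/-- The obstruction is thus a single scalar, the one that reappears in the character value in
`stabilizer_identities`. -/
theorem cubic_eq_smul {C A B N : Mat2 K} (h : N * N = 0) {p s : K}
    (hp : A * N = p • N) (hp' : N * A = (A.trace - p) • N)
    (hs : N * B = s • N) (hs' : B * N = (B.trace - s) • N) :
    cubic C A B N =
      ((N * C).trace + p * s - (A.trace - p) * (B.trace - s)) • N := by
  rw [cubic, mul_assoc N, mul_mul_self_of_sq h, Matrix.trace_mul_comm C, hp, hs', Matrix.smul_mul,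
    Matrix.smul_mul, hs, hp']
  module

/-- Under the trace conditions `NCN` and `BNA` both acquire the same three multiples of `N`, while
`ANB` is unchanged. -/
theorem cubic_move {C A B N b e : Mat2 K} (h : N * N = 0) (hN : N ≠ 0)
    (hA : (A * N).trace = 0) (hB : (N * B).trace = 0) :
    cubic (C + b * B + A * e + b * N * e) (A + b * N) (B + N * e) N = cubic C A B N := by
  obtain ⟨p, hp, hp'⟩ := exists_mul_right_eq_smul h hN hA
  obtain ⟨s, hs, hs'⟩ := exists_mul_left_eq_smul h hN hB
  have hb := mul_mul_self_of_sq h b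
  have he := mul_mul_self_of_sq h e
  have e1 : N * (b * B) * N = (B.trace - s) • (b * N).trace • N := by
    rw [← hb, mul_assoc, mul_assoc, hs', Matrix.mul_smul, Matrix.mul_smul]
  have e2 : N * (A * e) * N = (A.trace - p) • (e * N).trace • N := by
    rw [← he, ← mul_assoc, hp', Matrix.smul_mul, Matrix.smul_mul, mul_assoc]
  have e3 : N * (b * N * e) * N = (e * N).trace • (b * N).trace • N := by
    rw [← mul_assoc, hb, Matrix.smul_mul, Matrix.smul_mul, mul_assoc, he, smul_comm]
  have e4 : (A + b * N) * N * (B + N * e) = A * N * B := by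
    rw [add_mul, mul_assoc b, h, mul_zero, add_zero, mul_add, ← mul_assoc, mul_assoc A N N, h,
      mul_zero, zero_mul, add_zero]
  have e5 : (B + N * e) * N * (A + b * N) = B * N * A + (B.trace - s) • (b * N).trace • N +
      (A.trace - p) • (e * N).trace • N + (e * N).trace • (b * N).trace • N := by
    have f1 : B * N * (b * N) = (B.trace - s) • (b * N).trace • N := by
      rw [mul_assoc, hb, Matrix.mul_smul, hs', smul_comm]
    have f2 : N * e * N * A = (A.trace - p) • (e * N).trace • N := by
      rw [mul_assoc N e, he, Matrix.smul_mul, hp', smul_comm]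
    have f3 : N * e * N * (b * N) = (e * N).trace • (b * N).trace • N := by
      rw [mul_assoc N e, he, Matrix.smul_mul, hb]
    rw [add_mul, add_mul, mul_add, mul_add, f1, f2, f3]
    abel
  rw [cubic, cubic, e4, e5, mul_add, mul_add, mul_add, add_mul, add_mul, add_mul, e1, e2, e3]
  abel

/-- Conjugation by an invertible matrix. -/
def conj (g : GL (Fin 2) K) : Mat2 K →+* Mat2 K where
  toFun X := ((g⁻¹ : GL (Fin 2) K) : Mat2 K) * X * (g : Mat2 K)
  map_one' := by rw [mul_one]; exact Units.inv_mul g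
  map_zero' := by simp
  map_add' X Y := by rw [mul_add, add_mul]
  map_mul' X Y := by
    have : (g : Mat2 K) * ((g⁻¹ : GL (Fin 2) K) : Mat2 K) = 1 := Units.mul_inv g
    calc _ = ((g⁻¹ : GL (Fin 2) K) : Mat2 K) * X * 1 * Y * (g : Mat2 K) := by
          simp only [mul_one, mul_assoc]
      _ = _ := by rw [← this]; simp only [mul_assoc]

theorem conj_injective (g : GL (Fin 2) K) : Function.Injective (conj g) := by
  intro X Y h
  have h' : ((g⁻¹ : GL (Fin 2) K) : Mat2 K) * X * (g : Mat2 K) =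
    ((g⁻¹ : GL (Fin 2) K) : Mat2 K) * Y * (g : Mat2 K) := h
  exact (Units.mul_right_inj g⁻¹).1 ((Units.mul_left_inj g).1 h')

theorem trace_conj (g : GL (Fin 2) K) (X : Mat2 K) : (conj g X).trace = X.trace := by
  change (((g⁻¹ : GL (Fin 2) K) : Mat2 K) * X * (g : Mat2 K)).trace = _
  rw [Matrix.trace_mul_comm, ← mul_assoc]
  have : (g : Mat2 K) * ((g⁻¹ : GL (Fin 2) K) : Mat2 K) = 1 := Units.mul_inv g
  rw [this, one_mul]

theorem cubic_conj (g : GL (Fin 2) K) (C A B N : Mat2 K) :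
    cubic (conj g C) (conj g A) (conj g B) (conj g N) = conj g (cubic C A B N) := by
  simp only [cubic, map_mul, map_add, map_sub]

theorem exists_conj_eq {N : Mat2 K} (h : IsNilpotent N) (hN : N ≠ 0) :
    ∃ g : GL (Fin 2) K, conj g N = !![0, 1; 0, 0] := by
  obtain ⟨h1, h2⟩ := (isNilpotent_iff N).1 h
  rw [Matrix.trace_fin_two] at h1
  rw [Matrix.det_fin_two] at h2
  suffices ∃ g : Mat2 K, IsUnit g.det ∧ N * g = g * !![0, 1; 0, 0] by
    obtain ⟨g, hg, hNg⟩ := this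
    refine ⟨Matrix.GeneralLinearGroup.mk'' g hg, ?_⟩
    have e : ((Matrix.GeneralLinearGroup.mk'' g hg)⁻¹ : GL (Fin 2) K).val * g = 1 :=
      Units.inv_mul (Matrix.GeneralLinearGroup.mk'' g hg)
    change ((Matrix.GeneralLinearGroup.mk'' g hg)⁻¹ : GL (Fin 2) K).val * N * g = _
    rw [mul_assoc, hNg, ← mul_assoc, e, one_mul]
  have h3 : N 1 1 = -N 0 0 := by linear_combination h1
  by_cases hk : N 0 1 = 0
  · have h00 : N 0 0 = 0 := by
      rw [hk, h3] at h2
      have : N 0 0 * N 0 0 = 0 := by linear_combination -h2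
      exact mul_self_eq_zero.1 this
    have hl : N 1 0 ≠ 0 := by
      intro hl
      apply hN
      ext i j
      fin_cases i <;> fin_cases j <;> simp [h00, hk, hl, h3]
    -- The columns of `g` are `Nv` and `v`, for a basis vector `v` outside the kernel of `N`: the
    -- first one here, the second one in the other case.
    refine ⟨!![0, 1; N 1 0, 0], by simpa [Matrix.det_fin_two] using hl, ?_⟩
    ext i j
    fin_cases i <;> fin_cases j <;> simp [Matrix.mul_apply, Fin.sum_univ_two, h00, hk, h3]
  · refine ⟨!![N 0 1, 0; N 1 1, 1], by simpa [Matrix.det_fin_two] using hk, ?_⟩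
    ext i j
    fin_cases i <;> fin_cases j <;> simp [Matrix.mul_apply, Fin.sum_univ_two]
    · rw [h3]; ring
    · linear_combination N 1 1 * h1 - h2

end TwoByTwo

/-! ### The blocks of `y⁻¹x`, the action on them, and the invariant conditions. -/

section Blocks

variable {K : Type*} [RCLike K]

/-- The blocks of `(x, y)`, divided by `y` on the left. -/
noncomputable def blk₁₁ (z : gl42 K) : Mat2 K := z.2⁻¹ * z.1.toBlocks₁₁

/-- A block of `(x, y)`, divided by `y` on the left. -/
noncomputable def blk₁₂ (z : gl42 K) : Mat2 K := z.2⁻¹ * z.1.toBlocks₁₂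

/-- A block of `(x, y)`, divided by `y` on the left. -/
noncomputable def blk₂₁ (z : gl42 K) : Mat2 K := z.2⁻¹ * z.1.toBlocks₂₁

/-- A block of `(x, y)`, divided by `y` on the left. -/
noncomputable def blk₂₂ (z : gl42 K) : Mat2 K := z.2⁻¹ * z.1.toBlocks₂₂

theorem fst_eq_fromBlocks {z : gl42 K} (hz : IsUnit z.2) :
    z.1 = Matrix.fromBlocks (z.2 * blk₁₁ z) (z.2 * blk₁₂ z) (z.2 * blk₂₁ z) (z.2 * blk₂₂ z) := by
  have h : z.2 * z.2⁻¹ = 1 := Matrix.mul_nonsing_inv _ ((Matrix.isUnit_iff_isUnit_det _).1 hz)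
  simp only [blk₁₁, blk₁₂, blk₂₁, blk₂₂, ← mul_assoc, h, one_mul, Matrix.fromBlocks_toBlocks]

theorem smul_fst (h : H42 K) (z : gl42 K) :
    (h • z).1 = ((h.1 : GL (Fin 2 ⊕ Fin 2) K × GL (Fin 2) K).1 : Mat4 K) * z.1 *
      ((h.2 : GL (Fin 2 ⊕ Fin 2) K × GL (Fin 2) K).1 : Mat4 K)ᵀ := rfl

theorem smul_snd (h : H42 K) (z : gl42 K) :
    (h • z).2 = ((h.1 : GL (Fin 2 ⊕ Fin 2) K × GL (Fin 2) K).2 : Mat2 K) * z.2 *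
      ((h.2 : GL (Fin 2 ⊕ Fin 2) K × GL (Fin 2) K).2 : Mat2 K)ᵀ := rfl

/-- The transpose of an invertible matrix. -/
def unitTranspose {n : Type*} [Fintype n] [DecidableEq n] (c : GL n K) : GL n K where
  val := (c : Matrix n n K)ᵀ
  inv := ((c⁻¹ : GL n K) : Matrix n n K)ᵀ
  val_inv := by rw [← Matrix.transpose_mul, Units.inv_mul, Matrix.transpose_one]
  inv_val := by rw [← Matrix.transpose_mul, Units.mul_inv, Matrix.transpose_one]

theorem smul_mem_G42 (h : H42 K) {z : gl42 K} (hz : z ∈ G42 K) : h • z ∈ G42 K :=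
  ⟨((Units.isUnit _).mul hz.1).mul (Units.isUnit (unitTranspose _)),
    ((Units.isUnit _).mul hz.2).mul (Units.isUnit (unitTranspose _))⟩

/-- The diagonal part `a` of the first factor cancels in `y⁻¹x`. The transposed diagonal part of the
second remains as a conjugation, and the off-diagonal parts become the moves `b` and `e`. -/
theorem exists_blk_smul (h : H42 K) {z : gl42 K} (hz : IsUnit z.2) :
    ∃ (g : GL (Fin 2) K) (b e : Mat2 K),
      blk₁₁ (h • z) = conj g (blk₁₁ z + b * blk₂₁ z + blk₁₂ z * e + b * blk₂₂ z * e) ∧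
      blk₁₂ (h • z) = conj g (blk₁₂ z + b * blk₂₂ z) ∧
      blk₂₁ (h • z) = conj g (blk₂₁ z + blk₂₂ z * e) ∧
      blk₂₂ (h • z) = conj g (blk₂₂ z) := by
  obtain ⟨u, hu⟩ := hz
  have hfst := fst_eq_fromBlocks ⟨u, hu⟩
  have hx := smul_fst h z
  have hy := smul_snd h z
  obtain ⟨b, hb⟩ := h.1.2
  obtain ⟨d, hd⟩ := h.2.2
  generalize h • z = w at hx hy ⊢
  generalize (h.1 : GL (Fin 2 ⊕ Fin 2) K × GL (Fin 2) K) = sa at hx hy hb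
  generalize (h.2 : GL (Fin 2 ⊕ Fin 2) K × GL (Fin 2) K) = tc at hx hy hd
  obtain ⟨s, a⟩ := sa
  obtain ⟨t, c⟩ := tc
  simp only at hb hd hx hy
  rw [hfst, hb, hd, ← hu, Matrix.fromBlocks_transpose, Matrix.fromBlocks_multiply,
    Matrix.fromBlocks_multiply] at hx
  have hyi : w.2⁻¹ =
      (((unitTranspose c)⁻¹ : GL (Fin 2) K) : Mat2 K) * ((u⁻¹ : GL (Fin 2) K) : Mat2 K) *
        ((a⁻¹ : GL (Fin 2) K) : Mat2 K) := by
    rw [hy, ← hu]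
    change ((a : Mat2 K) * (u : Mat2 K) * (unitTranspose c : Mat2 K))⁻¹ = _
    rw [← Units.val_mul, ← Units.val_mul, ← Matrix.coe_units_inv, mul_inv_rev, mul_inv_rev,
      Units.val_mul, Units.val_mul, mul_assoc]
  have ct : (c : Mat2 K)ᵀ = (unitTranspose c : Mat2 K) := rfl
  set g := unitTranspose c
  have ha : ∀ X : Mat2 K, ((a⁻¹ : GL (Fin 2) K) : Mat2 K) * ((a : Mat2 K) * X) = X := fun X =>
    Units.inv_mul_cancel_left a X
  have hu' : ∀ X : Mat2 K, ((u⁻¹ : GL (Fin 2) K) : Mat2 K) * ((u : Mat2 K) * X) = X := fun X =>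
    Units.inv_mul_cancel_left u X
  have hg : ((g⁻¹ : GL (Fin 2) K) : Mat2 K) * (g : Mat2 K) = 1 := Units.inv_mul g
  refine ⟨g, ((u⁻¹ : GL (Fin 2) K) : Mat2 K) * ((a⁻¹ : GL (Fin 2) K) : Mat2 K) * b * (u : Mat2 K),
    dᵀ * ((g⁻¹ : GL (Fin 2) K) : Mat2 K), ?_, ?_, ?_, ?_⟩ <;>
  simp only [blk₁₁, blk₁₂, blk₂₁, blk₂₂, hyi, hx, Matrix.toBlocks_fromBlocks₁₁,
    Matrix.toBlocks_fromBlocks₁₂, Matrix.toBlocks_fromBlocks₂₁, Matrix.toBlocks_fromBlocks₂₂] <;>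
  simp only [conj, RingHom.coe_mk, MonoidHom.coe_mk, OneHom.coe_mk, ct, ← hu,
    Matrix.transpose_zero, zero_mul, mul_zero, zero_add, add_zero, mul_add, add_mul, mul_assoc,
    ha, hu', hg, mul_one] <;>
  abel

/-- The set of all points of `G₄,₂` whose blocks satisfy `P`. -/
def blockLocus (P : Mat2 K → Mat2 K → Mat2 K → Mat2 K → Prop) : Set (gl42 K) :=
  {z | z ∈ G42 K ∧ P (blk₁₁ z) (blk₁₂ z) (blk₂₁ z) (blk₂₂ z)}

/-- Invariance under the transformations of the blocks that are induced by `H₄,₂`. -/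
structure IsBlockInvariant (P : Mat2 K → Mat2 K → Mat2 K → Mat2 K → Prop) : Prop where
  conj : ∀ (g : GL (Fin 2) K) (C A B N : Mat2 K), P C A B N →
    P (conj g C) (conj g A) (conj g B) (conj g N)
  move : ∀ b e C A B N : Mat2 K, P C A B N →
    P (C + b * B + A * e + b * N * e) (A + b * N) (B + N * e) N

theorem IsBlockInvariant.isStable {P : Mat2 K → Mat2 K → Mat2 K → Mat2 K → Prop}
    (hP : IsBlockInvariant P) : IsStable (H42 K) (blockLocus P) := by
  intro h z hz
  refine ⟨smul_mem_G42 h hz.1, ?_⟩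
  obtain ⟨g, b, e, h1, h2, h3, h4⟩ := exists_blk_smul h hz.1.2
  rw [h1, h2, h3, h4]
  exact hP.conj g _ _ _ _ (hP.move b e _ _ _ _ hz.2)

theorem IsStable.smul_mem_iff {Z : Set (gl42 K)} (hZ : IsStable (H42 K) Z) (h : H42 K)
    (z : gl42 K) : h • z ∈ Z ↔ z ∈ Z :=
  ⟨fun hz => by simpa using hZ h⁻¹ _ hz, hZ h z⟩

/-- `N` is nilpotent and nonzero. -/
def NilCond (_ _ _ N : Mat2 K) : Prop := IsNilpotent N ∧ N ≠ 0

/-- The condition `tr (A N) = tr (N B)`. -/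
def TraceEqCond (C A B N : Mat2 K) : Prop := NilCond C A B N ∧ (A * N).trace = (N * B).trace

/-- The condition `tr (A N) = tr (N B) = 0`. -/
def TraceZeroCond (C A B N : Mat2 K) : Prop :=
  NilCond C A B N ∧ (A * N).trace = 0 ∧ (N * B).trace = 0

/-- The condition that moreover `N C N + A N B - B N A` vanishes. -/
def CubicCond (C A B N : Mat2 K) : Prop := TraceZeroCond C A B N ∧ cubic C A B N = 0

/-- The condition `A N = N B`. -/
def CommCond (C A B N : Mat2 K) : Prop := NilCond C A B N ∧ A * N = N * B

theorem NilCond.sq {C A B N : Mat2 K} (h : NilCond C A B N) : N * N = 0 :=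
  sq_eq_zero_of_isNilpotent h.1

theorem isBlockInvariant_nilCond : IsBlockInvariant (NilCond (K := K)) where
  conj g _ _ _ N h := ⟨h.1.map (UChiM.conj g), fun h0 => h.2 (conj_injective g (by rw [h0, map_zero]))⟩
  move _ _ _ _ _ _ h := h

theorem isBlockInvariant_traceEqCond : IsBlockInvariant (TraceEqCond (K := K)) where
  conj g C A B N h := by
    refine ⟨isBlockInvariant_nilCond.conj g C A B N h.1, ?_⟩
    rw [← map_mul, ← map_mul, trace_conj, trace_conj, h.2]
  move b e C A B N h := by
    refine ⟨h.1, ?_⟩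
    rw [add_mul, mul_add, mul_assoc, h.1.sq, ← mul_assoc, h.1.sq]
    simpa using h.2

theorem isBlockInvariant_traceZeroCond : IsBlockInvariant (TraceZeroCond (K := K)) where
  conj g C A B N h := by
    refine ⟨isBlockInvariant_nilCond.conj g C A B N h.1, ?_⟩
    rw [← map_mul, ← map_mul, trace_conj, trace_conj]
    exact h.2
  move b e C A B N h := by
    refine ⟨h.1, ?_⟩
    rw [add_mul, mul_add, mul_assoc, h.1.sq, ← mul_assoc, h.1.sq]
    simpa using h.2

theorem isBlockInvariant_cubicCond : IsBlockInvariant (CubicCond (K := K)) where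
  conj g C A B N h := by
    refine ⟨isBlockInvariant_traceZeroCond.conj g C A B N h.1, ?_⟩
    rw [cubic_conj, h.2, map_zero]
  move b e C A B N h := by
    refine ⟨isBlockInvariant_traceZeroCond.move b e C A B N h.1, ?_⟩
    rw [cubic_move h.1.1.sq h.1.1.2 h.1.2.1 h.1.2.2, h.2]

theorem isBlockInvariant_commCond : IsBlockInvariant (CommCond (K := K)) where
  conj g C A B N h := by
    refine ⟨isBlockInvariant_nilCond.conj g C A B N h.1, ?_⟩
    rw [← map_mul, h.2, map_mul]
  move b e C A B N h := by
    refine ⟨h.1, ?_⟩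
    rw [add_mul, mul_add, mul_assoc, h.1.sq, ← mul_assoc, h.1.sq]
    simpa using h.2

/-- From `AN = NB` follow `NAN = N²B = 0` and `NBN = AN² = 0`, and `NXN = tr(XN) N`. -/
theorem CommCond.traceZeroCond {C A B N : Mat2 K} (h : CommCond C A B N) :
    TraceZeroCond C A B N := by
  have key : ∀ X : Mat2 K, N * X * N = 0 → (X * N).trace = 0 := by
    intro X hX
    rw [mul_assoc, mul_mul_self_of_sq h.1.sq] at hX
    exact (smul_eq_zero.1 hX).resolve_right h.1.2
  refine ⟨h.1, key A ?_, ?_⟩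
  · rw [mul_assoc, h.2, ← mul_assoc, h.1.sq, zero_mul]
  · rw [Matrix.trace_mul_comm]
    exact key B (by rw [← h.2, mul_assoc, h.1.sq, mul_zero])

theorem Z4_eq : Z4 K = blockLocus NilCond := rfl

/-- Every `H₄,₂` orbit in `Z₄` meets the set where `y = 1` and `x₂₂ = E₁₂`. -/
theorem exists_smul_normalized {z : gl42 K} (hz : z ∈ Z4 K) :
    ∃ h : H42 K, (h • z).2 = 1 ∧ (h • z).1.toBlocks₂₂ = !![0, 1; 0, 0] := by
  obtain ⟨u, hu⟩ := hz.1.2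
  obtain ⟨g, hg⟩ := exists_conj_eq hz.2.1 hz.2.2
  let diag : GL (Fin 2) K → S42 K := fun a =>
    ⟨⟨⟨Matrix.fromBlocks a 0 0 a, Matrix.fromBlocks (a⁻¹ : GL (Fin 2) K) 0 0 (a⁻¹ : GL (Fin 2) K),
      by rw [Matrix.fromBlocks_multiply]; simp [← Matrix.fromBlocks_one],
      by rw [Matrix.fromBlocks_multiply]; simp [← Matrix.fromBlocks_one]⟩, a⟩, 0, rfl⟩
  have hgt : ((unitTranspose g : GL (Fin 2) K) : Mat2 K)ᵀ = g := rfl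
  -- This sends `y = u` to `g⁻¹u⁻¹ · u · g = 1` and `x₂₂ = uN` to `g⁻¹Ng`.
  refine ⟨(diag (g⁻¹ * u⁻¹), diag (unitTranspose g)), ?_, ?_⟩
  · rw [smul_snd, ← hu]
    change ((g⁻¹ * u⁻¹ : GL (Fin 2) K) : Mat2 K) * u * ((unitTranspose g : GL (Fin 2) K) : Mat2 K)ᵀ = 1
    rw [hgt, ← Units.val_mul, ← Units.val_mul]
    simp
  · rw [smul_fst, fst_eq_fromBlocks hz.1.2]
    change (Matrix.fromBlocks ((g⁻¹ * u⁻¹ : GL (Fin 2) K) : Mat2 K) 0 0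
      ((g⁻¹ * u⁻¹ : GL (Fin 2) K) : Mat2 K) * _ *
      (Matrix.fromBlocks ((unitTranspose g : GL (Fin 2) K) : Mat2 K) 0 0
      ((unitTranspose g : GL (Fin 2) K) : Mat2 K))ᵀ).toBlocks₂₂ = _
    rw [Matrix.fromBlocks_transpose, Matrix.fromBlocks_multiply, Matrix.fromBlocks_multiply,
      Matrix.toBlocks_fromBlocks₂₂, hgt, ← hg]
    simp only [conj, blk₂₂, RingHom.coe_mk, MonoidHom.coe_mk, OneHom.coe_mk, ← hu, zero_mul,
      zero_add, Matrix.transpose_zero, mul_zero, Units.val_mul, mul_assoc,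
      Units.inv_mul_cancel_left]

end Blocks

/-! ### Smoothness of matrix operations and of the blocks. -/

section Smooth

variable {K : Type*} [RCLike K] {V : Type*} [NormedAddCommGroup V] [NormedSpace ℝ V] {s : Set V}
  {l m n : Type*} [Fintype l] [Fintype m] [Fintype n]

theorem contDiffOn_matrix {f : V → Matrix m n K} :
    ContDiffOn ℝ ∞ f s ↔ ∀ i j, ContDiffOn ℝ ∞ (fun x => f x i j) s := by
  refine Iff.trans (contDiffOn_pi (Φ := f)) ?_
  exact forall_congr' fun i => contDiffOn_pi (Φ := fun x => f x i)

theorem contDiffOn_entry {f : V → Matrix m n K} (hf : ContDiffOn ℝ ∞ f s) (i : m) (j : n) :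
    ContDiffOn ℝ ∞ (fun x => f x i j) s := contDiffOn_matrix.1 hf i j

@[fun_prop]
theorem contDiffOn_matrix_mul {f : V → Matrix l m K} {g : V → Matrix m n K}
    (hf : ContDiffOn ℝ ∞ f s) (hg : ContDiffOn ℝ ∞ g s) :
    ContDiffOn ℝ ∞ (fun x => f x * g x) s := by
  refine contDiffOn_matrix.2 fun i j => ?_
  simp only [Matrix.mul_apply]
  exact ContDiffOn.sum fun k _ => (contDiffOn_entry hf i k).mul (contDiffOn_entry hg k j)

@[fun_prop]
theorem contDiffOn_matrix_smul {f : V → K} {g : V → Matrix m n K}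
    (hf : ContDiffOn ℝ ∞ f s) (hg : ContDiffOn ℝ ∞ g s) :
    ContDiffOn ℝ ∞ (fun x => f x • g x) s := by
  refine contDiffOn_matrix.2 fun i j => ?_
  simp only [Matrix.smul_apply, smul_eq_mul]
  exact hf.mul (contDiffOn_entry hg i j)

@[fun_prop]
theorem contDiffOn_matrix_transpose {f : V → Matrix m n K} (hf : ContDiffOn ℝ ∞ f s) :
    ContDiffOn ℝ ∞ (fun x => (f x)ᵀ) s :=
  contDiffOn_matrix.2 fun i j => contDiffOn_entry hf j i

@[fun_prop]
theorem contDiffOn_matrix_conjTranspose {f : V → Matrix m n K} (hf : ContDiffOn ℝ ∞ f s) :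
    ContDiffOn ℝ ∞ (fun x => (f x)ᴴ) s :=
  contDiffOn_matrix.2 fun i j =>
    (RCLike.conjCLE (K := K)).contDiff.comp_contDiffOn (contDiffOn_entry hf j i)

@[fun_prop]
theorem contDiffOn_matrix_trace {f : V → Matrix n n K} (hf : ContDiffOn ℝ ∞ f s) :
    ContDiffOn ℝ ∞ (fun x => (f x).trace) s := by
  simp only [Matrix.trace, Matrix.diag_apply]
  exact ContDiffOn.sum fun k _ => contDiffOn_entry hf k k

@[fun_prop]
theorem contDiffOn_matrix_det {f : V → Mat2 K} (hf : ContDiffOn ℝ ∞ f s) :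
    ContDiffOn ℝ ∞ (fun x => (f x).det) s := by
  simp only [Matrix.det_fin_two]
  exact ((contDiffOn_entry hf 0 0).mul (contDiffOn_entry hf 1 1)).sub
    ((contDiffOn_entry hf 0 1).mul (contDiffOn_entry hf 1 0))

@[fun_prop]
theorem contDiffOn_matrix_adjugate {f : V → Mat2 K} (hf : ContDiffOn ℝ ∞ f s) :
    ContDiffOn ℝ ∞ (fun x => (f x).adjugate) s := by
  refine contDiffOn_matrix.2 fun i j => ?_
  simp only [Matrix.adjugate_fin_two]
  fin_cases i <;> fin_cases j
  · exact contDiffOn_entry hf 1 1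
  · exact (contDiffOn_entry hf 0 1).neg
  · exact (contDiffOn_entry hf 1 0).neg
  · exact contDiffOn_entry hf 0 0

theorem contDiffOn_matrix_inv {f : V → Mat2 K} (hf : ContDiffOn ℝ ∞ f s)
    (h : ∀ x ∈ s, IsUnit (f x)) : ContDiffOn ℝ ∞ (fun x => (f x)⁻¹) s := by
  simp only [Matrix.inv_def, Ring.inverse_eq_inv']
  refine contDiffOn_matrix_smul ((contDiffOn_matrix_det hf).inv fun x hx => ?_)
    (contDiffOn_matrix_adjugate hf)
  exact ((Matrix.isUnit_iff_isUnit_det _).1 (h x hx)).ne_zero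

@[fun_prop]
theorem contDiffOn_fromBlocks {p : Type*} [Fintype p] {f : V → Matrix l m K} {g : V → Matrix l p K}
    {f' : V → Matrix n m K} {g' : V → Matrix n p K}
    (hf : ContDiffOn ℝ ∞ f s) (hg : ContDiffOn ℝ ∞ g s)
    (hf' : ContDiffOn ℝ ∞ f' s) (hg' : ContDiffOn ℝ ∞ g' s) :
    ContDiffOn ℝ ∞ (fun x => Matrix.fromBlocks (f x) (g x) (f' x) (g' x)) s := by
  refine contDiffOn_matrix.2 ?_
  rintro (i | i) (j | j)
  · exact contDiffOn_entry hf i j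
  · exact contDiffOn_entry hg i j
  · exact contDiffOn_entry hf' i j
  · exact contDiffOn_entry hg' i j

theorem contDiffOn_snd_gl42 {s : Set (gl42 K)} : ContDiffOn ℝ ∞ (fun z : gl42 K => z.2) s :=
  contDiff_snd.contDiffOn

theorem contDiffOn_fst_entry {s : Set (gl42 K)} (i j : Fin 2 ⊕ Fin 2) :
    ContDiffOn ℝ ∞ (fun z : gl42 K => z.1 i j) s :=
  contDiffOn_entry contDiff_fst.contDiffOn i j

theorem contDiffOn_blk₁₁ {s : Set (gl42 K)} (h : ∀ z ∈ s, IsUnit z.2) :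
    ContDiffOn ℝ ∞ (fun z => blk₁₁ z) s :=
  contDiffOn_matrix_mul (contDiffOn_matrix_inv contDiffOn_snd_gl42 h)
    (contDiffOn_matrix.2 fun _ _ => contDiffOn_fst_entry _ _)

theorem contDiffOn_blk₁₂ {s : Set (gl42 K)} (h : ∀ z ∈ s, IsUnit z.2) :
    ContDiffOn ℝ ∞ (fun z => blk₁₂ z) s :=
  contDiffOn_matrix_mul (contDiffOn_matrix_inv contDiffOn_snd_gl42 h)
    (contDiffOn_matrix.2 fun _ _ => contDiffOn_fst_entry _ _)

theorem contDiffOn_blk₂₁ {s : Set (gl42 K)} (h : ∀ z ∈ s, IsUnit z.2) :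
    ContDiffOn ℝ ∞ (fun z => blk₂₁ z) s :=
  contDiffOn_matrix_mul (contDiffOn_matrix_inv contDiffOn_snd_gl42 h)
    (contDiffOn_matrix.2 fun _ _ => contDiffOn_fst_entry _ _)

theorem contDiffOn_blk₂₂ {s : Set (gl42 K)} (h : ∀ z ∈ s, IsUnit z.2) :
    ContDiffOn ℝ ∞ (fun z => blk₂₂ z) s :=
  contDiffOn_matrix_mul (contDiffOn_matrix_inv contDiffOn_snd_gl42 h)
    (contDiffOn_matrix.2 fun _ _ => contDiffOn_fst_entry _ _)

variable (K) in
theorem isOpen_G42 : IsOpen (G42 K) := by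
  have h1 : IsOpen {z : gl42 K | z.1.det ≠ 0} :=
    isOpen_ne.preimage (continuous_fst.matrix_det)
  have h2 : IsOpen {z : gl42 K | z.2.det ≠ 0} :=
    isOpen_ne.preimage (continuous_snd.matrix_det)
  convert! h1.inter h2 using 1
  ext z
  simp [G42, Matrix.isUnit_iff_isUnit_det]

/-- A smooth scalar or matrix valued function of the blocks of `z`. -/
theorem contDiffOn_cubic {s : Set (gl42 K)} (h : ∀ z ∈ s, IsUnit z.2) :
    ContDiffOn ℝ ∞ (fun z => cubic (blk₁₁ z) (blk₁₂ z) (blk₂₁ z) (blk₂₂ z)) s := by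
  have := contDiffOn_blk₁₁ h
  have := contDiffOn_blk₁₂ h
  have := contDiffOn_blk₂₁ h
  have := contDiffOn_blk₂₂ h
  simp only [cubic]
  fun_prop

end Smooth

/-! ### Differentials along lines, and submersions built one component at a time. -/

section Derivatives

variable {E F F' : Type*} [NormedAddCommGroup E] [NormedSpace ℝ E] [NormedAddCommGroup F]
  [NormedSpace ℝ F] [NormedAddCommGroup F'] [NormedSpace ℝ F']

theorem fderiv_eq_of_line {f : E → F} {z v : E} {c : F} (hf : DifferentiableAt ℝ f z)
    (h : ∀ t : ℝ, f (z + t • v) = f z + t • c) : fderiv ℝ f z v = c := by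
  rw [← hf.lineDeriv_eq_fderiv, lineDeriv, funext h]
  simpa using (((hasDerivAt_id (0 : ℝ)).smul_const c).const_add (f z)).deriv

/-- A triangular criterion: it suffices that `dg` be onto when restricted to the kernel of `df`. -/
theorem surjective_fderiv_prodMk {f : E → F} {g : E → F'} {z : E} (hf : DifferentiableAt ℝ f z)
    (hg : DifferentiableAt ℝ g z) (hs : Function.Surjective (fderiv ℝ f z))
    (h : ∀ c, ∃ v, fderiv ℝ f z v = 0 ∧ fderiv ℝ g z v = c) :
    Function.Surjective (fderiv ℝ (fun x => (f x, g x)) z) := by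
  rintro ⟨a, b⟩
  obtain ⟨v, hv⟩ := hs a
  obtain ⟨w, hw, hw'⟩ := h (b - fderiv ℝ g z v)
  refine ⟨v + w, ?_⟩
  rw [hf.fderiv_prodMk hg]
  simp [hv, hw, hw']

theorem fderiv_prodMk_apply {f : E → F} {g : E → F'} {z v : E} {a : F} {b : F'}
    (hf : DifferentiableAt ℝ f z) (hg : DifferentiableAt ℝ g z)
    (ha : fderiv ℝ f z v = a) (hb : fderiv ℝ g z v = b) :
    fderiv ℝ (fun x => (f x, g x)) z v = (a, b) := by
  rw [hf.fderiv_prodMk hg]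
  simp [ha, hb]

end Derivatives

/-! ### The loci of the filtration are submanifolds. -/

section Loci

variable {K : Type*} [RCLike K]

/-- A variation of `x` with fixed `y`. -/
def variation (C A B N : Mat2 K) : gl42 K := (Matrix.fromBlocks C A B N, 0)

theorem blk₁₁_line {z : gl42 K} (hz : z.2 = 1) (C A B N : Mat2 K) (t : ℝ) :
    blk₁₁ (z + t • variation C A B N) = z.1.toBlocks₁₁ + t • C := by
  simp only [blk₁₁, variation, Prod.snd_add, Prod.smul_mk, smul_zero, hz, add_zero, inv_one,
    one_mul, Prod.fst_add]
  rfl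

theorem blk₁₂_line {z : gl42 K} (hz : z.2 = 1) (C A B N : Mat2 K) (t : ℝ) :
    blk₁₂ (z + t • variation C A B N) = z.1.toBlocks₁₂ + t • A := by
  simp only [blk₁₂, variation, Prod.snd_add, Prod.smul_mk, smul_zero, hz, add_zero, inv_one,
    one_mul, Prod.fst_add]
  rfl

theorem blk₂₁_line {z : gl42 K} (hz : z.2 = 1) (C A B N : Mat2 K) (t : ℝ) :
    blk₂₁ (z + t • variation C A B N) = z.1.toBlocks₂₁ + t • B := by
  simp only [blk₂₁, variation, Prod.snd_add, Prod.smul_mk, smul_zero, hz, add_zero, inv_one,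
    one_mul, Prod.fst_add]
  rfl

theorem blk₂₂_line {z : gl42 K} (hz : z.2 = 1) (C A B N : Mat2 K) (t : ℝ) :
    blk₂₂ (z + t • variation C A B N) = z.1.toBlocks₂₂ + t • N := by
  simp only [blk₂₂, variation, Prod.snd_add, Prod.smul_mk, smul_zero, hz, add_zero, inv_one,
    one_mul, Prod.fst_add]
  rfl

theorem blk_of_snd_eq_one {z : gl42 K} (hz : z.2 = 1) : blk₁₁ z = z.1.toBlocks₁₁ ∧
    blk₁₂ z = z.1.toBlocks₁₂ ∧ blk₂₁ z = z.1.toBlocks₂₁ ∧ blk₂₂ z = z.1.toBlocks₂₂ := by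
  simp [blk₁₁, blk₁₂, blk₂₁, blk₂₂, hz]

/-- A function of the blocks of `z`. -/
noncomputable def blockFun {T : Type*} (f : Mat2 K → Mat2 K → Mat2 K → Mat2 K → T) (z : gl42 K) : T :=
  f (blk₁₁ z) (blk₁₂ z) (blk₂₁ z) (blk₂₂ z)

theorem fderiv_blockFun {F : Type*} [NormedAddCommGroup F] [NormedSpace ℝ F]
    {f : Mat2 K → Mat2 K → Mat2 K → Mat2 K → F} {z : gl42 K} (hz : z.2 = 1)
    (hf : DifferentiableAt ℝ (blockFun f) z) {C A B N : Mat2 K} {c : F}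
    (h : ∀ t : ℝ, f (z.1.toBlocks₁₁ + t • C) (z.1.toBlocks₁₂ + t • A) (z.1.toBlocks₂₁ + t • B)
      (z.1.toBlocks₂₂ + t • N) = f z.1.toBlocks₁₁ z.1.toBlocks₁₂ z.1.toBlocks₂₁ z.1.toBlocks₂₂
        + t • c) :
    fderiv ℝ (blockFun f) z (variation C A B N) = c := by
  refine fderiv_eq_of_line hf fun t => ?_
  obtain ⟨h1, h2, h3, h4⟩ := blk_of_snd_eq_one hz
  rw [blockFun, blk₁₁_line hz, blk₁₂_line hz, blk₂₁_line hz, blk₂₂_line hz, h t, blockFun, h1, h2,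
    h3, h4]

/-- The action of an element of `H₄,₂`, as a real linear automorphism of `𝔤𝔩₄ × 𝔤𝔩₂`. -/
def actEquiv (h : H42 K) : gl42 K ≃L[ℝ] gl42 K where
  toFun x := h • x
  invFun x := h⁻¹ • x
  map_add' x y := Prod.ext
    (by simp only [smul_fst, Prod.fst_add, mul_add, add_mul])
    (by simp only [smul_snd, Prod.snd_add, mul_add, add_mul])
  map_smul' r x := Prod.ext
    (by simp only [smul_fst, Prod.smul_fst, Matrix.mul_smul, Matrix.smul_mul, RingHom.id_apply])
    (by simp only [smul_snd, Prod.smul_snd, Matrix.mul_smul, Matrix.smul_mul, RingHom.id_apply])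
  left_inv x := inv_smul_smul h x
  right_inv x := smul_inv_smul h x
  continuous_toFun := ((continuous_const.matrix_mul continuous_fst).matrix_mul
    continuous_const).prodMk ((continuous_const.matrix_mul continuous_snd).matrix_mul
    continuous_const)
  continuous_invFun := ((continuous_const.matrix_mul continuous_fst).matrix_mul
    continuous_const).prodMk ((continuous_const.matrix_mul continuous_snd).matrix_mul
    continuous_const)

/-- Invariance moves every point to one with `y = 1` and `N = E₁₂`. The equations need only cut out
the locus where `N 0 1 ≠ 0`, and be submersive at such normalised points. -/
theorem isSubmanifold_blockLocus {F : Type*} [NormedAddCommGroup F] [NormedSpace ℝ F]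
    [FiniteDimensional ℝ F] {P : Mat2 K → Mat2 K → Mat2 K → Mat2 K → Prop}
    (hP : IsBlockInvariant P) (hPN : ∀ C A B N, P C A B N → NilCond C A B N)
    {f : gl42 K → F} (hf : ContDiffOn ℝ ∞ f (G42 K))
    (hiff : ∀ z, blk₂₂ z 0 1 ≠ 0 → (P (blk₁₁ z) (blk₁₂ z) (blk₂₁ z) (blk₂₂ z) ↔ f z = 0))
    (hs : ∀ z ∈ blockLocus P, z.2 = 1 → z.1.toBlocks₂₂ = !![0, 1; 0, 0] →
      Function.Surjective (fderiv ℝ f z)) : IsSubmanifold (blockLocus P) := by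
  refine isSubmanifold_of_isCutOutAt (F := F) fun z hz => ?_
  obtain ⟨h, h1, h2⟩ := exists_smul_normalized (z := z) ⟨hz.1, hPN _ _ _ _ hz.2⟩
  refine IsCutOutAt.of_image (actEquiv h)
    (fun x => hP.isStable.smul_mem_iff h x) ?_
  have hz' : h • z ∈ blockLocus P := hP.isStable h z hz
  refine ⟨G42 K ∩ (fun x => blk₂₂ x 0 1) ⁻¹' {0}ᶜ, f, ?_, ⟨hz'.1, ?_⟩,
    hf.mono Set.inter_subset_left, hs _ hz' h1 h2, ?_⟩
  · exact (contDiffOn_entry (contDiffOn_blk₂₂ fun x hx => hx.2) 0 1).continuousOn.isOpen_inter_preimage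
      (isOpen_G42 K) isOpen_compl_singleton
  · change blk₂₂ (h • z) 0 1 ≠ 0
    rw [(blk_of_snd_eq_one h1).2.2.2, h2]
    simp
  · rintro x ⟨hx, hx'⟩
    rw [← hiff x hx']
    exact ⟨fun h => h.2, fun h => ⟨hx, h⟩⟩

theorem ne_zero_of_entry {N : Mat2 K} (h : N 0 1 ≠ 0) : N ≠ 0 := fun h0 => h (by rw [h0]; rfl)

theorem pair_eq_zero {M M' : Type*} [Zero M] [Zero M'] {a : M} {b : M'} :
    (a, b) = 0 ↔ a = 0 ∧ b = 0 := Prod.mk_eq_zero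

theorem nilCond_iff {C A B N : Mat2 K} (h : N 0 1 ≠ 0) :
    NilCond C A B N ↔ (N.trace, N.det) = 0 := by
  rw [NilCond, isNilpotent_iff, pair_eq_zero]
  exact and_iff_left (ne_zero_of_entry h)

theorem traceEqCond_iff {C A B N : Mat2 K} (h : N 0 1 ≠ 0) :
    TraceEqCond C A B N ↔ ((N.trace, N.det), (A * N).trace - (N * B).trace) = 0 := by
  rw [pair_eq_zero, ← nilCond_iff (C := C) (A := A) (B := B) h, sub_eq_zero, TraceEqCond]

theorem traceZeroCond_iff {C A B N : Mat2 K} (h : N 0 1 ≠ 0) :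
    TraceZeroCond C A B N ↔ (((N.trace, N.det), (A * N).trace), (N * B).trace) = 0 := by
  rw [pair_eq_zero, pair_eq_zero, ← nilCond_iff (C := C) (A := A) (B := B) h, TraceZeroCond,
    and_assoc]

theorem TraceZeroCond.exists_scalars {C A B N : Mat2 K} (h : TraceZeroCond C A B N) :
    ∃ p s : K, A * N = p • N ∧ N * A = (A.trace - p) • N ∧ N * B = s • N ∧
      B * N = (B.trace - s) • N := by
  obtain ⟨p, hp, hp'⟩ := exists_mul_right_eq_smul h.1.sq h.1.2 h.2.1
  obtain ⟨s, hs, hs'⟩ := exists_mul_left_eq_smul h.1.sq h.1.2 h.2.2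
  exact ⟨p, s, hp, hp', hs, hs'⟩

/-- Once the trace conditions hold, `cubic` is a multiple of `N`. Where `N 0 1 ≠ 0` its vanishing is
therefore one scalar equation, as independence of the equations requires. -/
theorem cubicCond_iff {C A B N : Mat2 K} (h : N 0 1 ≠ 0) :
    CubicCond C A B N ↔
      ((((N.trace, N.det), (A * N).trace), (N * B).trace), cubic C A B N 0 1) = 0 := by
  rw [Prod.mk_eq_zero, ← traceZeroCond_iff (C := C) h, CubicCond]
  refine and_congr_right fun h1 => ⟨fun h2 => by rw [h2]; rfl, fun h2 => ?_⟩
  obtain ⟨p, s, hp, hp', hs, hs'⟩ := h1.exists_scalars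
  rw [cubic_eq_smul h1.1.sq hp hp' hs hs'] at h2 ⊢
  rw [Matrix.smul_apply, smul_eq_zero, or_iff_left h] at h2
  rw [h2, zero_smul]

theorem commCond_iff {C A B N : Mat2 K} (h : N 0 1 ≠ 0) :
    CommCond C A B N ↔
      ((((N.trace, N.det), (A * N).trace), (N * B).trace), (A * N - N * B) 0 1) = 0 := by
  rw [Prod.mk_eq_zero, ← traceZeroCond_iff (C := C) h]
  constructor
  · intro h1
    exact ⟨h1.traceZeroCond, by rw [h1.2, sub_self]; rfl⟩
  · rintro ⟨h1, h2⟩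
    refine ⟨h1.1, ?_⟩
    obtain ⟨p, s, hp, hp', hs, hs'⟩ := h1.exists_scalars
    rw [hp, hs, ← sub_smul, Matrix.smul_apply, smul_eq_zero, or_iff_left h] at h2
    rw [hp, hs, sub_eq_zero.1 h2]

section Functions

/-! The functions of the blocks which cut out the various loci. -/

def traceFun (_ _ _ N : Mat2 K) : K := N.trace
def detFun (_ _ _ N : Mat2 K) : K := N.det
def rightFun (_ A _ N : Mat2 K) : K := (A * N).trace
def leftFun (_ _ B N : Mat2 K) : K := (N * B).trace
def diffFun (_ A B N : Mat2 K) : K := (A * N).trace - (N * B).trace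
def cubicFun (C A B N : Mat2 K) : K := cubic C A B N 0 1
def commFun (_ A B N : Mat2 K) : K := (A * N - N * B) 0 1

theorem contDiffOn_blockFun {F : Type*} [NormedAddCommGroup F] [NormedSpace ℝ F]
    {f : Mat2 K → Mat2 K → Mat2 K → Mat2 K → F}
    (hf : ContDiffOn ℝ ∞ (fun w : (Mat2 K × Mat2 K) × (Mat2 K × Mat2 K) =>
      f w.1.1 w.1.2 w.2.1 w.2.2) Set.univ) : ContDiffOn ℝ ∞ (blockFun f) (G42 K) := by
  have hy : ∀ z ∈ G42 K, IsUnit z.2 := fun z hz => hz.2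
  exact hf.comp (((contDiffOn_blk₁₁ hy).prodMk (contDiffOn_blk₁₂ hy)).prodMk
    ((contDiffOn_blk₂₁ hy).prodMk (contDiffOn_blk₂₂ hy))) fun _ _ => trivial

theorem contDiffOn_traceFun : ContDiffOn ℝ ∞ (blockFun (traceFun (K := K))) (G42 K) :=
  contDiffOn_blockFun (by simp only [traceFun]; fun_prop)

theorem contDiffOn_detFun : ContDiffOn ℝ ∞ (blockFun (detFun (K := K))) (G42 K) :=
  contDiffOn_blockFun (by simp only [detFun]; fun_prop)

theorem contDiffOn_rightFun : ContDiffOn ℝ ∞ (blockFun (rightFun (K := K))) (G42 K) :=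
  contDiffOn_blockFun (by simp only [rightFun]; fun_prop)

theorem contDiffOn_leftFun : ContDiffOn ℝ ∞ (blockFun (leftFun (K := K))) (G42 K) :=
  contDiffOn_blockFun (by simp only [leftFun]; fun_prop)

theorem contDiffOn_diffFun : ContDiffOn ℝ ∞ (blockFun (diffFun (K := K))) (G42 K) :=
  contDiffOn_blockFun (by simp only [diffFun]; fun_prop)

theorem contDiffOn_cubicFun : ContDiffOn ℝ ∞ (blockFun (cubicFun (K := K))) (G42 K) :=
  contDiffOn_entry (f := fun z => cubic (blk₁₁ z) (blk₁₂ z) (blk₂₁ z) (blk₂₂ z))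
    (contDiffOn_cubic fun _ hz => hz.2) 0 1

theorem contDiffOn_commFun : ContDiffOn ℝ ∞ (blockFun (commFun (K := K))) (G42 K) :=
  contDiffOn_blockFun (by
    refine contDiffOn_entry (f := fun w : (Mat2 K × Mat2 K) × (Mat2 K × Mat2 K) =>
      w.1.2 * w.2.2 - w.2.2 * w.2.1) ?_ 0 1
    fun_prop)

end Functions

theorem differentiableAt_of_contDiffOn_G42 {F : Type*} [NormedAddCommGroup F] [NormedSpace ℝ F]
    {f : gl42 K → F} (hf : ContDiffOn ℝ ∞ f (G42 K)) {z : gl42 K} (hz : z ∈ G42 K) :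
    DifferentiableAt ℝ f z :=
  (hf.contDiffAt ((isOpen_G42 K).mem_nhds hz)).differentiableAt (by simp)

section Surjectivity

variable {z : gl42 K}

theorem surjective_nil (hz : z ∈ G42 K) (h1 : z.2 = 1)
    (h2 : z.1.toBlocks₂₂ = !![0, 1; 0, 0]) :
    Function.Surjective (fderiv ℝ (fun z => (blockFun traceFun z, blockFun detFun z)) z) := by
  have d1 := differentiableAt_of_contDiffOn_G42 contDiffOn_traceFun hz
  have d2 := differentiableAt_of_contDiffOn_G42 contDiffOn_detFun hz
  -- At `N = E₁₂` a diagonal entry moves the trace, and the lower left entry moves the determinant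
  -- without changing the trace.
  refine surjective_fderiv_prodMk d1 d2 (fun c => ⟨variation 0 0 0 !![c, 0; 0, 0], ?_⟩)
    fun c => ⟨variation 0 0 0 !![0, 0; -c, 0], ?_, ?_⟩
  · exact fderiv_blockFun h1 d1 fun t => by simp [traceFun, h2, Matrix.trace_fin_two]
  · exact fderiv_blockFun h1 d1 fun t => by simp [traceFun, h2, Matrix.trace_fin_two]
  · exact fderiv_blockFun h1 d2 fun t => by simp [detFun, h2, Matrix.det_fin_two]

theorem surjective_traceEq (hz : z ∈ G42 K) (h1 : z.2 = 1)
    (h2 : z.1.toBlocks₂₂ = !![0, 1; 0, 0]) :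
    Function.Surjective (fderiv ℝ (fun z => ((blockFun traceFun z, blockFun detFun z),
      blockFun diffFun z)) z) := by
  have d1 := differentiableAt_of_contDiffOn_G42 contDiffOn_traceFun hz
  have d2 := differentiableAt_of_contDiffOn_G42 contDiffOn_detFun hz
  have d3 := differentiableAt_of_contDiffOn_G42 contDiffOn_diffFun hz
  refine surjective_fderiv_prodMk (d1.prodMk d2) d3 (surjective_nil hz h1 h2)
    fun c => ⟨variation 0 !![0, 0; c, 0] 0 0, fderiv_prodMk_apply d1 d2 ?_ ?_, ?_⟩
  · exact fderiv_blockFun h1 d1 fun t => by simp [traceFun]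
  · exact fderiv_blockFun h1 d2 fun t => by simp [detFun]
  · exact fderiv_blockFun h1 d3 fun t => by
      simp [diffFun, h2, Matrix.trace_fin_two, Matrix.mul_apply, Fin.sum_univ_two]
      ring

theorem surjective_traceZero (hz : z ∈ G42 K) (h1 : z.2 = 1)
    (h2 : z.1.toBlocks₂₂ = !![0, 1; 0, 0]) :
    Function.Surjective (fderiv ℝ (fun z => (((blockFun traceFun z, blockFun detFun z),
      blockFun rightFun z), blockFun leftFun z)) z) := by
  have d1 := differentiableAt_of_contDiffOn_G42 contDiffOn_traceFun hz
  have d2 := differentiableAt_of_contDiffOn_G42 contDiffOn_detFun hz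
  have d3 := differentiableAt_of_contDiffOn_G42 contDiffOn_rightFun hz
  have d4 := differentiableAt_of_contDiffOn_G42 contDiffOn_leftFun hz
  refine surjective_fderiv_prodMk ((d1.prodMk d2).prodMk d3) d4
    (surjective_fderiv_prodMk (d1.prodMk d2) d3 (surjective_nil hz h1 h2)
      fun c => ⟨variation 0 !![0, 0; c, 0] 0 0, fderiv_prodMk_apply d1 d2 ?_ ?_, ?_⟩)
    fun c => ⟨variation 0 0 !![0, 0; c, 0] 0,
      fderiv_prodMk_apply (d1.prodMk d2) d3 (fderiv_prodMk_apply d1 d2 ?_ ?_) ?_, ?_⟩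
  · exact fderiv_blockFun h1 d1 fun t => by simp [traceFun]
  · exact fderiv_blockFun h1 d2 fun t => by simp [detFun]
  · exact fderiv_blockFun h1 d3 fun t => by
      simp [rightFun, h2, Matrix.trace_fin_two, Matrix.mul_apply, Fin.sum_univ_two]
  · exact fderiv_blockFun h1 d1 fun t => by simp [traceFun]
  · exact fderiv_blockFun h1 d2 fun t => by simp [detFun]
  · exact fderiv_blockFun h1 d3 fun t => by simp [rightFun]
  · exact fderiv_blockFun h1 d4 fun t => by
      simp [leftFun, h2, Matrix.trace_fin_two, Matrix.vecMul, dotProduct, Fin.sum_univ_two]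

theorem surjective_cubic (hz : z ∈ G42 K) (h1 : z.2 = 1)
    (h2 : z.1.toBlocks₂₂ = !![0, 1; 0, 0]) :
    Function.Surjective (fderiv ℝ (fun z => ((((blockFun traceFun z, blockFun detFun z),
      blockFun rightFun z), blockFun leftFun z), blockFun cubicFun z)) z) := by
  have d1 := differentiableAt_of_contDiffOn_G42 contDiffOn_traceFun hz
  have d2 := differentiableAt_of_contDiffOn_G42 contDiffOn_detFun hz
  have d3 := differentiableAt_of_contDiffOn_G42 contDiffOn_rightFun hz
  have d4 := differentiableAt_of_contDiffOn_G42 contDiffOn_leftFun hz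
  have d5 := differentiableAt_of_contDiffOn_G42 contDiffOn_cubicFun hz
  -- For `N = E₁₂` the upper right entry of `NCN` is `C 1 0`, and the other equations do not involve
  -- `C`.
  refine surjective_fderiv_prodMk (((d1.prodMk d2).prodMk d3).prodMk d4) d5
    (surjective_traceZero hz h1 h2) fun c => ⟨variation !![0, 0; c, 0] 0 0 0,
      fderiv_prodMk_apply ((d1.prodMk d2).prodMk d3) d4
        (fderiv_prodMk_apply (d1.prodMk d2) d3 (fderiv_prodMk_apply d1 d2 ?_ ?_) ?_) ?_, ?_⟩
  · exact fderiv_blockFun h1 d1 fun t => by simp [traceFun]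
  · exact fderiv_blockFun h1 d2 fun t => by simp [detFun]
  · exact fderiv_blockFun h1 d3 fun t => by
      simp [rightFun, h2, Matrix.trace_fin_two, Matrix.mul_apply, Fin.sum_univ_two]
  · exact fderiv_blockFun h1 d4 fun t => by simp [leftFun]
  · exact fderiv_blockFun h1 d5 fun t => by
      simp [cubicFun, cubic, h2, Matrix.mul_apply, Matrix.vecMul, dotProduct, Fin.sum_univ_two]
      ring

theorem surjective_comm (hz : z ∈ G42 K) (h1 : z.2 = 1)
    (h2 : z.1.toBlocks₂₂ = !![0, 1; 0, 0]) :
    Function.Surjective (fderiv ℝ (fun z => ((((blockFun traceFun z, blockFun detFun z),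
      blockFun rightFun z), blockFun leftFun z), blockFun commFun z)) z) := by
  have d1 := differentiableAt_of_contDiffOn_G42 contDiffOn_traceFun hz
  have d2 := differentiableAt_of_contDiffOn_G42 contDiffOn_detFun hz
  have d3 := differentiableAt_of_contDiffOn_G42 contDiffOn_rightFun hz
  have d4 := differentiableAt_of_contDiffOn_G42 contDiffOn_leftFun hz
  have d5 := differentiableAt_of_contDiffOn_G42 contDiffOn_commFun hz
  -- For `N = E₁₂` the entry `A 0 0` is the upper right entry of `AN`, while `tr AN = A 1 0` does
  -- not see it.
  refine surjective_fderiv_prodMk (((d1.prodMk d2).prodMk d3).prodMk d4) d5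
    (surjective_traceZero hz h1 h2) fun c => ⟨variation 0 !![c, 0; 0, 0] 0 0,
      fderiv_prodMk_apply ((d1.prodMk d2).prodMk d3) d4
        (fderiv_prodMk_apply (d1.prodMk d2) d3 (fderiv_prodMk_apply d1 d2 ?_ ?_) ?_) ?_, ?_⟩
  · exact fderiv_blockFun h1 d1 fun t => by simp [traceFun]
  · exact fderiv_blockFun h1 d2 fun t => by simp [detFun]
  · exact fderiv_blockFun h1 d3 fun t => by
      simp [rightFun, h2, Matrix.trace_fin_two, Matrix.mul_apply, Fin.sum_univ_two]
  · exact fderiv_blockFun h1 d4 fun t => by simp [leftFun]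
  · exact fderiv_blockFun h1 d5 fun t => by
      simp [commFun, h2, Matrix.mul_apply, Fin.sum_univ_two]
      ring

end Surjectivity

variable (K) in
theorem isSubmanifold_nil : IsSubmanifold (blockLocus (NilCond (K := K))) :=
  isSubmanifold_blockLocus isBlockInvariant_nilCond (fun _ _ _ _ h => h)
    (contDiffOn_traceFun.prodMk contDiffOn_detFun) (fun _ h => nilCond_iff h)
    fun _ hz h1 h2 => surjective_nil hz.1 h1 h2

variable (K) in
theorem isSubmanifold_traceEq : IsSubmanifold (blockLocus (TraceEqCond (K := K))) :=
  isSubmanifold_blockLocus isBlockInvariant_traceEqCond (fun _ _ _ _ h => h.1)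
    ((contDiffOn_traceFun.prodMk contDiffOn_detFun).prodMk contDiffOn_diffFun) (fun _ h => traceEqCond_iff h)
    fun _ hz h1 h2 => surjective_traceEq hz.1 h1 h2

variable (K) in
theorem isSubmanifold_traceZero : IsSubmanifold (blockLocus (TraceZeroCond (K := K))) :=
  isSubmanifold_blockLocus isBlockInvariant_traceZeroCond (fun _ _ _ _ h => h.1)
    (((contDiffOn_traceFun.prodMk contDiffOn_detFun).prodMk contDiffOn_rightFun).prodMk contDiffOn_leftFun) (fun _ h => traceZeroCond_iff h)
    fun _ hz h1 h2 => surjective_traceZero hz.1 h1 h2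

variable (K) in
theorem isSubmanifold_cubic : IsSubmanifold (blockLocus (CubicCond (K := K))) :=
  isSubmanifold_blockLocus isBlockInvariant_cubicCond (fun _ _ _ _ h => h.1.1)
    ((((contDiffOn_traceFun.prodMk contDiffOn_detFun).prodMk contDiffOn_rightFun).prodMk contDiffOn_leftFun).prodMk contDiffOn_cubicFun) (fun _ h => cubicCond_iff h)
    fun _ hz h1 h2 => surjective_cubic hz.1 h1 h2

variable (K) in
theorem isSubmanifold_comm : IsSubmanifold (blockLocus (CommCond (K := K))) :=
  isSubmanifold_blockLocus isBlockInvariant_commCond (fun _ _ _ _ h => h.1)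
    ((((contDiffOn_traceFun.prodMk contDiffOn_detFun).prodMk contDiffOn_rightFun).prodMk contDiffOn_leftFun).prodMk contDiffOn_commFun) (fun _ h => commCond_iff h)
    fun _ hz h1 h2 => surjective_comm hz.1 h1 h2

end Loci

/-! ### Pairs of unipotent matrices act unipotently. -/

section Unipotent

theorem isNilpotent_mul_sub_one {R : Type*} [Ring R] {x y : R} (h : Commute x y)
    (hx : IsNilpotent (x - 1)) (hy : IsNilpotent (y - 1)) : IsNilpotent (x * y - 1) := by
  have e : x * y - 1 = (x - 1) * y + (y - 1) := by noncomm_ring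
  have c : Commute (x - 1) y := h.sub_left (Commute.one_left y)
  have c1 : Commute ((x - 1) * y) (y - 1) :=
    (c.mul_left (Commute.refl y)).sub_right (Commute.one_right _)
  rw [e]
  exact c1.isNilpotent_add (c.isNilpotent_mul_right hx) hy

theorem isNilpotent_mapQ_sub_one {R M : Type*} [Ring R] [AddCommGroup M] [Module R M]
    (p : Submodule R M) (L : M →ₗ[R] M) (hL : p ≤ p.comap L) (h : IsNilpotent (L - 1)) :
    IsNilpotent (p.mapQ p L hL - 1) := by
  obtain ⟨k, hk⟩ := h
  have key : ∀ (k : ℕ) (v : M), ((p.mapQ p L hL - 1) ^ k) (p.mkQ v) = p.mkQ (((L - 1) ^ k) v) := by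
    intro k
    induction k with
    | zero => intro v; rfl
    | succ k ih =>
      intro v
      rw [pow_succ, pow_succ, Module.End.mul_apply, Module.End.mul_apply, ← ih]
      rfl
  refine ⟨k, LinearMap.ext fun x => ?_⟩
  obtain ⟨v, rfl⟩ := p.mkQ_surjective x
  rw [key, hk]
  simp

variable {K : Type*} [RCLike K]

/-- Left and right multiplications commute, and a product of commuting unipotents is unipotent. -/
theorem isNilpotent_twoSided {n : Type*} [Fintype n] [DecidableEq n] {s t : Matrix n n K}
    (hs : IsNilpotent (s - 1)) (ht : IsNilpotent (t - 1)) :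
    IsNilpotent (LinearMap.mulLeft ℝ s * LinearMap.mulRight ℝ tᵀ - 1) := by
  refine isNilpotent_mul_sub_one (LinearMap.commute_mulLeft_right s tᵀ) ?_ ?_
  · have e : LinearMap.mulLeft ℝ s - 1 = LinearMap.mulLeft ℝ (s - 1) := by
      ext x : 1; simp [sub_mul]
    rw [e, LinearMap.isNilpotent_mulLeft_iff]
    exact hs
  · have e : LinearMap.mulRight ℝ tᵀ - 1 = LinearMap.mulRight ℝ (t - 1)ᵀ := by
      ext x : 1; simp [mul_sub]
    rw [e, LinearMap.isNilpotent_mulRight_iff]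
    obtain ⟨k, hk⟩ := ht
    exact ⟨k, by rw [← Matrix.transpose_pow, hk, Matrix.transpose_zero]⟩

/-- Pairs of unipotent matrices act unipotently on normal spaces. -/
theorem actsUnipotentlyOnNormal_of_isNilpotent {Z : Set (gl42 K)} (hZ : IsStable (H42 K) Z)
    {h : H42 K} {z : gl42 K} (hz : h • z = z)
    (h1 : IsNilpotent (((h.1 : GL (Fin 2 ⊕ Fin 2) K × GL (Fin 2) K).1 : Mat4 K) - 1))
    (h2 : IsNilpotent (((h.1 : GL (Fin 2 ⊕ Fin 2) K × GL (Fin 2) K).2 : Mat2 K) - 1))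
    (h3 : IsNilpotent (((h.2 : GL (Fin 2 ⊕ Fin 2) K × GL (Fin 2) K).1 : Mat4 K) - 1))
    (h4 : IsNilpotent (((h.2 : GL (Fin 2 ⊕ Fin 2) K × GL (Fin 2) K).2 : Mat2 K) - 1)) :
    ActsUnipotentlyOnNormal h Z z := by
  have hd : fderiv ℝ (fun x : gl42 K => h • x) z = (actEquiv h : gl42 K →L[ℝ] gl42 K) :=
    (actEquiv h).fderiv
  have hT : tangentSpace Z z ≤
      (tangentSpace Z z).comap (fderiv ℝ (fun x : gl42 K => h • x) z : gl42 K →ₗ[ℝ] gl42 K) := by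
    intro v hv
    have := map_mem_tangentSpace (Z' := Z) (actEquiv h : gl42 K →L[ℝ] gl42 K)
      (fun x hx => hZ h x hx) hv
    rw [Submodule.mem_comap, hd]
    change actEquiv h v ∈ tangentSpace Z (h • z) at this
    rwa [hz] at this
  -- The action is already unipotent on the whole ambient space, hence on the quotient.
  refine ⟨hT, isNilpotent_mapQ_sub_one _ _ _ ?_⟩
  obtain ⟨k, hk⟩ := isNilpotent_twoSided h1 h3
  obtain ⟨l, hl⟩ := isNilpotent_twoSided h2 h4
  have hp : IsNilpotent ((LinearMap.mulLeft ℝ ((h.1 : GL (Fin 2 ⊕ Fin 2) K × GL (Fin 2) K).1 : Mat4 K) *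
      LinearMap.mulRight ℝ ((h.2 : GL (Fin 2 ⊕ Fin 2) K × GL (Fin 2) K).1 : Mat4 K)ᵀ - 1,
      LinearMap.mulLeft ℝ ((h.1 : GL (Fin 2 ⊕ Fin 2) K × GL (Fin 2) K).2 : Mat2 K) *
      LinearMap.mulRight ℝ ((h.2 : GL (Fin 2 ⊕ Fin 2) K × GL (Fin 2) K).2 : Mat2 K)ᵀ - 1) :
      Module.End ℝ (Mat4 K) × Module.End ℝ (Mat2 K)) := by
    refine ⟨k + l, Prod.ext ?_ ?_⟩
    · rw [Prod.pow_fst, pow_add, hk, zero_mul]; rfl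
    · rw [Prod.pow_snd, pow_add, hl, mul_zero]; rfl
  have := hp.map (LinearMap.prodMapRingHom ℝ (Mat4 K) (Mat2 K))
  have hd' : ∀ x, fderiv ℝ (fun x : gl42 K => h • x) z x = h • x := fun x =>
    congrArg (fun T : gl42 K →L[ℝ] gl42 K => T x) hd
  refine (congrArg IsNilpotent (LinearMap.ext fun x => Prod.ext ?_ ?_)).mp this
  · refine Eq.trans ?_ (congrArg Prod.fst (congrArg (fun y => y - x) (hd' x))).symm
    simp [smul_fst, mul_assoc]
  · refine Eq.trans ?_ (congrArg Prod.snd (congrArg (fun y => y - x) (hd' x))).symm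
    simp [smul_snd, mul_assoc]

end Unipotent

/-! ### Explicit stabilizing elements and the criterion for incompatibility. -/

section Stabilizer

variable {K : Type*} [RCLike K]

/-- The element `[[a, b], [0, a]]` of `S₄,₂`. -/
def upperElt (a : GL (Fin 2) K) (b : Mat2 K) : S42 K :=
  ⟨⟨⟨Matrix.fromBlocks a b 0 a,
      Matrix.fromBlocks (a⁻¹ : GL (Fin 2) K)
        (-(((a⁻¹ : GL (Fin 2) K) : Mat2 K) * b * ((a⁻¹ : GL (Fin 2) K) : Mat2 K))) 0
        (a⁻¹ : GL (Fin 2) K),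
      by
        rw [Matrix.fromBlocks_multiply, ← Matrix.fromBlocks_one]
        congr 1
        · simp
        · rw [mul_neg, ← mul_assoc, ← mul_assoc, Units.mul_inv, one_mul, neg_add_cancel]
        · simp
        · simp,
      by
        rw [Matrix.fromBlocks_multiply, ← Matrix.fromBlocks_one]
        congr 1
        · simp
        · rw [neg_mul, mul_assoc, mul_assoc, Units.inv_mul, mul_one, add_neg_cancel]
        · simp
        · simp⟩, a⟩, b, rfl⟩

/-- The unipotent matrix `1 + N`, where `N² = 0`. -/
def onePlus (N : Mat2 K) (hN : N * N = 0) : GL (Fin 2) K where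
  val := 1 + N
  inv := 1 - N
  val_inv := by rw [mul_sub, add_mul, add_mul, hN]; simp
  inv_val := by rw [mul_add, sub_mul, sub_mul, hN]; simp

/-- The elements of `H₄,₂` that are used to fix points of `Z₄`. -/
def stabElt (u : GL (Fin 2) K) (M b e : Mat2 K) (hM : M * M = 0) : H42 K :=
  (upperElt (u * onePlus M hM * u⁻¹)
      ((u : Mat2 K) * ((1 + M) * b) * ((u⁻¹ : GL (Fin 2) K) : Mat2 K)),
    upperElt (unitTranspose (onePlus M hM)⁻¹) (e * (1 - M))ᵀ)

section Ring

variable {R : Type*} [Ring R] {u u' : R}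

theorem conj_move₁ (h : u' * u = 1) {n n' A B C N b e : R} :
    (u * n * u' * (u * C) + u * (n * b) * u' * (u * B)) * n' +
      (u * n * u' * (u * A) + u * (n * b) * u' * (u * N)) * (e * n') =
    u * (n * (C + b * B + A * e + b * N * e) * n') := by
  have h' : ∀ X, u' * (u * X) = X := fun X => by rw [← mul_assoc, h, one_mul]
  simp only [mul_add, add_mul, mul_assoc, h']
  abel

theorem conj_move₂ (h : u' * u = 1) {n n' A N b : R} :
    (u * n * u' * (u * A) + u * (n * b) * u' * (u * N)) * n' = u * (n * (A + b * N) * n') := by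
  have h' : ∀ X, u' * (u * X) = X := fun X => by rw [← mul_assoc, h, one_mul]
  simp only [mul_add, add_mul, mul_assoc, h']

theorem conj_move₃ (h : u' * u = 1) {n n' B N e : R} :
    u * n * u' * (u * B) * n' + u * n * u' * (u * N) * (e * n') =
    u * (n * (B + N * e) * n') := by
  have h' : ∀ X, u' * (u * X) = X := fun X => by rw [← mul_assoc, h, one_mul]
  simp only [mul_add, add_mul, mul_assoc, h']

end Ring

/-- On the blocks the element performs the move by `b, e` and then `X ↦ (1 + M) X (1 - M)`, where `1
- M` is the inverse of `1 + M`. The hypotheses say that the second step undoes the first; `N` is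
fixed since it commutes with `M`. -/
theorem stabElt_smul {z : gl42 K} {u : GL (Fin 2) K} (hu : (u : Mat2 K) = z.2)
    {M b e : Mat2 K} (hM : M * M = 0) (hMN : Commute M (blk₂₂ z))
    (hA : blk₁₂ z + b * blk₂₂ z = (1 - M) * blk₁₂ z * (1 + M))
    (hB : blk₂₁ z + blk₂₂ z * e = (1 - M) * blk₂₁ z * (1 + M))
    (hC : blk₁₁ z + b * blk₂₁ z + blk₁₂ z * e + b * blk₂₂ z * e =
      (1 - M) * blk₁₁ z * (1 + M)) :
    stabElt u M b e hM • z = z := by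
  have c1 : ∀ X : Mat2 K, (1 + M) * ((1 - M) * X) = X := fun X =>
    Units.mul_inv_cancel_left (onePlus M hM) X
  have c2 : (1 + M) * (1 - M) = 1 := Units.mul_inv (onePlus M hM)
  have c3 : ∀ X : Mat2 K, ((u⁻¹ : GL (Fin 2) K) : Mat2 K) * ((u : Mat2 K) * X) = X := fun X =>
    Units.inv_mul_cancel_left u X
  have c4 : ((u⁻¹ : GL (Fin 2) K) : Mat2 K) * (u : Mat2 K) = 1 := Units.inv_mul u
  have d : ∀ X Y : Mat2 K, X = (1 - M) * Y * (1 + M) →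
      (u : Mat2 K) * ((1 + M) * X * (1 - M)) = (u : Mat2 K) * Y := by
    rintro X Y rfl
    simp only [mul_assoc, c1, c2, mul_one]
  refine Prod.ext ?_ ?_
  · rw [smul_fst, fst_eq_fromBlocks (z := z) ⟨u, hu⟩]
    change Matrix.fromBlocks ((u : Mat2 K) * (1 + M) * ((u⁻¹ : GL (Fin 2) K) : Mat2 K))
      ((u : Mat2 K) * ((1 + M) * b) * ((u⁻¹ : GL (Fin 2) K) : Mat2 K)) 0
      ((u : Mat2 K) * (1 + M) * ((u⁻¹ : GL (Fin 2) K) : Mat2 K)) * _ *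
      (Matrix.fromBlocks (1 - M)ᵀ (e * (1 - M))ᵀ 0 (1 - M)ᵀ)ᵀ = _
    rw [Matrix.fromBlocks_transpose, Matrix.fromBlocks_multiply, Matrix.fromBlocks_multiply, ← hu]
    have hN : (1 + M) * blk₂₂ z * (1 - M) = blk₂₂ z := by
      have : Commute (1 + M) (blk₂₂ z) := (Commute.one_left _).add_left hMN
      rw [this.eq, mul_assoc, c2, mul_one]
    simp only [Matrix.transpose_transpose, Matrix.transpose_zero, mul_zero, zero_mul, zero_add]
    refine Matrix.fromBlocks_inj.2 ⟨(conj_move₁ c4).trans (d _ _ hC),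
      (conj_move₂ c4).trans (d _ _ hA), (conj_move₃ c4).trans (d _ _ hB), ?_⟩
    rw [mul_assoc _ _ ((u : Mat2 K) * _), c3, mul_assoc, mul_assoc, ← mul_assoc (1 + M), hN]
  · rw [smul_snd]
    change (u : Mat2 K) * (1 + M) * ((u⁻¹ : GL (Fin 2) K) : Mat2 K) * z.2 * (1 - M)ᵀᵀ = z.2
    simp only [← hu, Matrix.transpose_transpose, mul_assoc, c3, c2, mul_one]

theorem trPart_upperElt (a : GL (Fin 2) K) (b : Mat2 K) :
    trPart (upperElt a b) = (b * ((a⁻¹ : GL (Fin 2) K) : Mat2 K)).trace := rfl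

/-- The diagonal parts of the two factors have inverse determinants, so `χK` contributes nothing.
The normalisation of the off-diagonal parts makes `tr b` and `tr e` appear. -/
theorem chi42_stabElt (ψ : AddChar K Circle) (χK : Kˣ →* ℂˣ) (u : GL (Fin 2) K)
    {M b e : Mat2 K} (hM : M * M = 0) :
    chi42 ψ χK (stabElt u M b e hM) = Circle.toUnits (ψ (b.trace + e.trace)) := by
  have t1 : trPart (stabElt u M b e hM).1 = b.trace := by
    rw [stabElt, trPart_upperElt, mul_inv_rev, mul_inv_rev, inv_inv, Units.val_mul, Units.val_mul,
      mul_assoc, Units.inv_mul_cancel_left, Matrix.trace_mul_comm, mul_assoc, Units.inv_mul_cancel_left]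
    exact congrArg Matrix.trace (Units.inv_mul_cancel_left (onePlus M hM) b)
  have t2 : trPart (stabElt u M b e hM).2 = e.trace := by
    rw [stabElt, trPart_upperElt]
    change ((e * (1 - M))ᵀ * (1 + M)ᵀ).trace = _
    have c2 : (1 - M) * (1 + M) = 1 := Units.inv_mul (onePlus M hM)
    rw [← Matrix.transpose_mul, Matrix.trace_transpose, ← mul_assoc, Matrix.trace_mul_comm,
      ← mul_assoc, c2, one_mul]
  have hdet : Matrix.GeneralLinearGroup.det (unitTranspose (onePlus M hM)⁻¹) =
      (Matrix.GeneralLinearGroup.det (onePlus M hM))⁻¹ := by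
    rw [← map_inv]
    exact Units.ext (Matrix.det_transpose _)
  have hdet' : Matrix.GeneralLinearGroup.det (u * onePlus M hM * u⁻¹) =
      Matrix.GeneralLinearGroup.det (onePlus M hM) := by
    rw [map_mul, map_mul, map_inv, mul_right_comm, mul_inv_cancel, one_mul]
  change χK (Matrix.GeneralLinearGroup.det (u * onePlus M hM * u⁻¹)) *
    Circle.toUnits (ψ (trPart (stabElt u M b e hM).1)) *
    (χK (Matrix.GeneralLinearGroup.det (unitTranspose (onePlus M hM)⁻¹)) *
    Circle.toUnits (ψ (trPart (stabElt u M b e hM).2))) = _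
  rw [t1, t2, hdet, hdet', map_inv, AddChar.map_add_eq_mul, map_mul, mul_mul_mul_comm,
    mul_inv_cancel, one_mul]

theorem isNilpotent_fromBlocks {X W : Mat2 K} (h : X * X = 0) :
    IsNilpotent (Matrix.fromBlocks X W 0 X) := by
  refine ⟨4, ?_⟩
  have : Matrix.fromBlocks X W 0 X ^ 2 = Matrix.fromBlocks 0 (X * W + W * X) 0 0 := by
    rw [pow_two, Matrix.fromBlocks_multiply]
    simp [h]
  rw [show (4 : ℕ) = 2 * 2 by norm_num, pow_mul, this, pow_two, Matrix.fromBlocks_multiply]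
  simp

theorem isNilpotent_upperElt {a : GL (Fin 2) K} (b : Mat2 K)
    (h : ((a : Mat2 K) - 1) * ((a : Mat2 K) - 1) = 0) :
    IsNilpotent (((upperElt a b : GL (Fin 2 ⊕ Fin 2) K × GL (Fin 2) K).1 : Mat4 K) - 1) ∧
    IsNilpotent (((upperElt a b : GL (Fin 2 ⊕ Fin 2) K × GL (Fin 2) K).2 : Mat2 K) - 1) := by
  refine ⟨?_, 2, by rw [pow_two]; exact h⟩
  change IsNilpotent (Matrix.fromBlocks (a : Mat2 K) b 0 (a : Mat2 K) - 1)
  rw [← Matrix.fromBlocks_one, sub_eq_add_neg, Matrix.fromBlocks_neg, Matrix.fromBlocks_add]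
  convert isNilpotent_fromBlocks (W := b) h using 2 <;> simp [sub_eq_add_neg]

/-- A criterion for unipotent incompatibility, the slices being the whole submanifold. -/
theorem isUnipotentlyIncompatible_of_stabilizer (ψ : AddChar K Circle) (χK : Kˣ →* ℂˣ)
    {Z : Set (gl42 K)} (hZ : IsSubmanifold Z) (hst : IsStable (H42 K) Z)
    (hN : ∀ z ∈ Z, IsUnit z.2 ∧ blk₂₂ z * blk₂₂ z = 0)
    {β : gl42 K → K} {b e : gl42 K → Mat2 K} (hβs : ContDiffOn ℝ ∞ β Z)
    (hbs : ContDiffOn ℝ ∞ b Z) (hes : ContDiffOn ℝ ∞ e Z)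
    (hA : ∀ z ∈ Z, blk₁₂ z + b z * blk₂₂ z =
      (1 - β z • blk₂₂ z) * blk₁₂ z * (1 + β z • blk₂₂ z))
    (hB : ∀ z ∈ Z, blk₂₁ z + blk₂₂ z * e z =
      (1 - β z • blk₂₂ z) * blk₂₁ z * (1 + β z • blk₂₂ z))
    (hC : ∀ z ∈ Z, blk₁₁ z + b z * blk₂₁ z + blk₁₂ z * e z + b z * blk₂₂ z * e z =
      (1 - β z • blk₂₂ z) * blk₁₁ z * (1 + β z • blk₂₂ z))
    (hψ : ∀ z ∈ Z, ψ ((b z).trace + (e z).trace) ≠ 1) :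
    IsUnipotentlyIncompatible H42.toMatrices (chi42 ψ χK) Z := by
  classical
  have hM : ∀ z ∈ Z, (β z • blk₂₂ z) * (β z • blk₂₂ z) = 0 := fun z hz => by
    rw [Matrix.smul_mul, Matrix.mul_smul, (hN z hz).2, smul_zero, smul_zero]
  let φ : gl42 K → H42 K := fun z =>
    if hz : z ∈ Z then stabElt (hN z hz).1.unit (β z • blk₂₂ z) (b z) (e z) (hM z hz) else 1
  have hφ : ∀ z (hz : z ∈ Z), φ z =
      stabElt (hN z hz).1.unit (β z • blk₂₂ z) (b z) (e z) (hM z hz) := fun z hz => dif_pos hz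
  have hfix : ∀ z ∈ Z, φ z • z = z := fun z hz => by
    rw [hφ z hz]
    exact stabElt_smul rfl _ ((Commute.refl _).smul_left _) (hA z hz) (hB z hz) (hC z hz)
  refine ⟨hZ, hst, fun z₀ hz₀ => ⟨Z, φ, hz₀, ⟨hZ, subset_rfl, ?_⟩, ?_, ?_⟩⟩
  · intro h z hz v hv
    have hv' : h⁻¹ • v ∈ tangentSpace Z z := by
      have := map_mem_tangentSpace (Z' := Z) (actEquiv h⁻¹ : gl42 K →L[ℝ] gl42 K)
        (fun x hx => hst h⁻¹ x hx) hv
      change h⁻¹ • v ∈ tangentSpace Z (h⁻¹ • h • z) at this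
      rwa [inv_smul_smul] at this
    obtain ⟨γ, hγ, hγ'⟩ := hZ.exists_curve hz hv'
    refine ⟨fun _ => h, γ, rfl, Filter.Eventually.of_forall fun t => contDiffAt_const, hγ, ?_⟩
    have key : HasDerivAt (fun t => h • γ t) (h • h⁻¹ • v) 0 :=
      (actEquiv h : gl42 K →L[ℝ] gl42 K).hasFDerivAt.comp_hasDerivAt (0 : ℝ) hγ'
    rwa [smul_inv_smul] at key
  · have s2 := contDiffOn_blk₂₂ fun z hz => (hN z hz).1
    have sy : ContDiffOn ℝ ∞ (fun z : gl42 K => z.2) Z := contDiffOn_snd_gl42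
    have si := contDiffOn_matrix_inv sy fun z hz => (hN z hz).1
    have key : ContDiffOn ℝ ∞ (fun z : gl42 K =>
        (((Matrix.fromBlocks (z.2 * (1 + β z • blk₂₂ z) * z.2⁻¹)
            (z.2 * ((1 + β z • blk₂₂ z) * b z) * z.2⁻¹) 0
            (z.2 * (1 + β z • blk₂₂ z) * z.2⁻¹), z.2 * (1 + β z • blk₂₂ z) * z.2⁻¹),
          (Matrix.fromBlocks (1 - β z • blk₂₂ z)ᵀ (e z * (1 - β z • blk₂₂ z))ᵀ 0
            (1 - β z • blk₂₂ z)ᵀ, (1 - β z • blk₂₂ z)ᵀ)) : gl42 K × gl42 K)) Z := by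
      fun_prop
    refine key.congr fun z hz => ?_
    have hi : (((hN z hz).1.unit⁻¹ : GL (Fin 2) K) : Mat2 K) = z.2⁻¹ := by
      rw [Matrix.coe_units_inv]; rfl
    rw [hφ z hz, ← hi]
    rfl
  · intro z hz
    refine ⟨hfix z hz, ?_, ?_⟩
    · have hM' := hM z hz
      have n1 : ∀ b', _ := fun b' => isNilpotent_upperElt
        (a := (hN z hz).1.unit * onePlus _ hM' * (hN z hz).1.unit⁻¹) b' (by
          set u : GL (Fin 2) K := (hN z hz).1.unit
          have e1 : ((u * onePlus _ hM' * u⁻¹ : GL (Fin 2) K) : Mat2 K) - 1 =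
              u * (β z • blk₂₂ z) * ((u⁻¹ : GL (Fin 2) K) : Mat2 K) := by
            change (u : Mat2 K) * (1 + β z • blk₂₂ z) * ((u⁻¹ : GL (Fin 2) K) : Mat2 K) - 1 = _
            rw [mul_add, add_mul, mul_one, Units.mul_inv, add_sub_cancel_left]
          rw [e1, mul_assoc, mul_assoc, mul_assoc, Units.inv_mul_cancel_left,
            ← mul_assoc (β z • blk₂₂ z), hM', zero_mul, mul_zero])
      have n2 : ∀ b', _ := fun b' => isNilpotent_upperElt
        (a := unitTranspose (onePlus _ hM')⁻¹) b' (by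
          have e1 : ((unitTranspose (onePlus _ hM')⁻¹ : GL (Fin 2) K) : Mat2 K) - 1 =
              (-(β z • blk₂₂ z))ᵀ := by
            change (1 - β z • blk₂₂ z)ᵀ - 1 = _
            rw [Matrix.transpose_sub, Matrix.transpose_one, sub_sub_cancel_left,
              Matrix.transpose_neg]
          rw [e1, ← Matrix.transpose_mul, neg_mul_neg, hM', Matrix.transpose_zero])
      have hf := hfix z hz
      rw [hφ z hz] at hf ⊢
      exact actsUnipotentlyOnNormal_of_isNilpotent hst hf (n1 _).1 (n1 _).2 (n2 _).1 (n2 _).2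
    · rw [hφ z hz, chi42_stabElt]
      intro h1
      refine hψ z hz (Subtype.ext ?_)
      exact congrArg Units.val h1

end Stabilizer

/-! ### Derivatives of the blocks in all directions, including those that vary `y`. -/

section MatrixDerivatives

variable {K : Type*} [RCLike K] {l m n : Type*} [Fintype l] [Fintype n] {t : ℝ}

theorem hasDerivAt_matrix [Finite m] {f : ℝ → Matrix m n K} {f' : Matrix m n K} :
    HasDerivAt f f' t ↔ ∀ i j, HasDerivAt (fun x => f x i j) (f' i j) t := by
  refine Iff.trans (hasDerivAt_pi (φ := f) (φ' := f')) ?_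
  exact forall_congr' fun i => hasDerivAt_pi (φ := fun x => f x i) (φ' := f' i)

theorem hasDerivAt_matrix_mul [Fintype m] {f : ℝ → Matrix l m K} {g : ℝ → Matrix m n K} {f' : Matrix l m K}
    {g' : Matrix m n K} (hf : HasDerivAt f f' t) (hg : HasDerivAt g g' t) :
    HasDerivAt (fun x => f x * g x) (f' * g t + f t * g') t := by
  refine hasDerivAt_matrix.2 fun i j => ?_
  simp only [Matrix.mul_apply, Matrix.add_apply, ← Finset.sum_add_distrib]
  exact HasDerivAt.fun_sum fun k _ => (hasDerivAt_matrix.1 hf i k).mul (hasDerivAt_matrix.1 hg k j)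

theorem hasDerivAt_matrix_trace {f : ℝ → Matrix n n K} {f' : Matrix n n K}
    (hf : HasDerivAt f f' t) : HasDerivAt (fun x => (f x).trace) f'.trace t := by
  simp only [Matrix.trace, Matrix.diag_apply]
  exact HasDerivAt.fun_sum fun k _ => hasDerivAt_matrix.1 hf k k

theorem hasDerivAt_inv_line (w : Mat2 K) :
    HasDerivAt (fun t : ℝ => (1 + t • w)⁻¹) (-w) 0 := by
  have hl : HasDerivAt (fun t : ℝ => 1 + t • w) w 0 := by
    have := ((hasDerivAt_id (0 : ℝ)).smul_const w).const_add (1 : Mat2 K)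
    rw [one_smul] at this
    exact this
  have hopen : IsOpen {y : Mat2 K | IsUnit y} := by
    have : IsOpen {y : Mat2 K | y.det ≠ 0} := isOpen_ne.preimage continuous_id.matrix_det
    convert! this using 1
    ext y
    simp [Matrix.isUnit_iff_isUnit_det]
  have hd : DifferentiableAt ℝ (fun y : Mat2 K => y⁻¹) 1 :=
    ((contDiffOn_matrix_inv contDiffOn_id fun y hy => hy).contDiffAt
      (hopen.mem_nhds isUnit_one)).differentiableAt (by simp)
  have h0 : (1 : Mat2 K) + (0 : ℝ) • w = 1 := by simp
  rw [← h0] at hd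
  obtain ⟨D, h1⟩ : ∃ D, HasDerivAt (fun t : ℝ => (1 + t • w)⁻¹) D 0 :=
    ⟨_, hd.hasFDerivAt.comp_hasDerivAt 0 hl⟩
  -- Knowing that the inverse is differentiable, its derivative is found by differentiating `(1 +
  -- tw)⁻¹(1 + tw) = 1`.
  have h2 := hasDerivAt_matrix_mul h1 hl
  have h3 : HasDerivAt (fun t : ℝ => (1 + t • w)⁻¹ * (1 + t • w)) 0 0 := by
    refine (hasDerivAt_const (0 : ℝ) (1 : Mat2 K)).congr_of_eventuallyEq ?_
    have : ∀ᶠ t in 𝓝 (0 : ℝ), IsUnit (1 + t • w) := by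
      refine hl.continuousAt.preimage_mem_nhds (hopen.mem_nhds ?_)
      rw [h0]
      exact isUnit_one
    filter_upwards [this] with t ht
    exact Matrix.nonsing_inv_mul _ ((Matrix.isUnit_iff_isUnit_det _).1 ht)
  have h4 := h2.unique h3
  simp only [h0, inv_one, mul_one, one_mul] at h4
  rw [eq_neg_of_add_eq_zero_left h4] at h1
  exact h1

theorem hasDerivAt_blk_aux (w X x : Mat2 K) :
    HasDerivAt (fun t : ℝ => (1 + t • w)⁻¹ * (X + t • x)) (x - w * X) 0 := by
  have hl : HasDerivAt (fun t : ℝ => X + t • x) x 0 := by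
    have := ((hasDerivAt_id (0 : ℝ)).smul_const x).const_add X
    rw [one_smul] at this
    exact this
  have := hasDerivAt_matrix_mul (hasDerivAt_inv_line w) hl
  convert this using 1
  simp [sub_eq_add_neg, add_comm]

variable {z : gl42 K}

theorem hasDerivAt_blk₁₁ (hz : z.2 = 1) (w : gl42 K) :
    HasDerivAt (fun t : ℝ => blk₁₁ (z + t • w))
      (w.1.toBlocks₁₁ - w.2 * z.1.toBlocks₁₁) 0 := by
  have := hasDerivAt_blk_aux w.2 z.1.toBlocks₁₁ w.1.toBlocks₁₁
  rw [← hz] at this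
  exact this

theorem hasDerivAt_blk₁₂ (hz : z.2 = 1) (w : gl42 K) :
    HasDerivAt (fun t : ℝ => blk₁₂ (z + t • w))
      (w.1.toBlocks₁₂ - w.2 * z.1.toBlocks₁₂) 0 := by
  have := hasDerivAt_blk_aux w.2 z.1.toBlocks₁₂ w.1.toBlocks₁₂
  rw [← hz] at this
  exact this

theorem hasDerivAt_blk₂₁ (hz : z.2 = 1) (w : gl42 K) :
    HasDerivAt (fun t : ℝ => blk₂₁ (z + t • w))
      (w.1.toBlocks₂₁ - w.2 * z.1.toBlocks₂₁) 0 := by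
  have := hasDerivAt_blk_aux w.2 z.1.toBlocks₂₁ w.1.toBlocks₂₁
  rw [← hz] at this
  exact this

theorem hasDerivAt_blk₂₂ (hz : z.2 = 1) (w : gl42 K) :
    HasDerivAt (fun t : ℝ => blk₂₂ (z + t • w))
      (w.1.toBlocks₂₂ - w.2 * z.1.toBlocks₂₂) 0 := by
  have := hasDerivAt_blk_aux w.2 z.1.toBlocks₂₂ w.1.toBlocks₂₂
  rw [← hz] at this
  exact this

theorem fderiv_apply_eq_of_hasDerivAt {E F : Type*} [NormedAddCommGroup E] [NormedSpace ℝ E]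
    [NormedAddCommGroup F] [NormedSpace ℝ F] {f : E → F} {z w : E} {c : F}
    (hf : DifferentiableAt ℝ f z) (h : HasDerivAt (fun t : ℝ => f (z + t • w)) c 0) :
    fderiv ℝ f z w = c := by
  rw [← hf.lineDeriv_eq_fderiv]
  exact h.deriv

end MatrixDerivatives

/-! ### The trace metric, nonisotropic normals, and metric properness. -/

section Metric

variable {K : Type*} [RCLike K]

theorem traceMetric_apply (z X Y : gl42 K) : traceMetric K z X Y =
    RCLike.re ((z.1⁻¹ * X.1 * (z.1⁻¹ * Y.1)).trace + (z.2⁻¹ * X.2 * (z.2⁻¹ * Y.2)).trace) := rfl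

theorem traceMetric_comm (z X Y : gl42 K) : traceMetric K z X Y = traceMetric K z Y X := by
  rw [traceMetric_apply, traceMetric_apply, Matrix.trace_mul_comm,
    Matrix.trace_mul_comm (z.2⁻¹ * X.2)]

theorem eq_zero_of_re_trace {n : Type*} [Fintype n] {M : Matrix n n K}
    (h : RCLike.re (M * Mᴴ).trace = 0) : M = 0 := by
  open scoped ComplexOrder in
  refine Matrix.trace_mul_conjTranspose_self_eq_zero_iff.1 ?_
  have h1 := (Matrix.posSemidef_self_mul_conjTranspose M).trace_nonneg
  rw [RCLike.le_iff_re_im] at h1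
  exact RCLike.ext (by simpa using h) (by simpa using h1.2.symm)

/-- Pairing `X` with `x (x⁻¹X)ᴴ` gives the squared Hilbert–Schmidt norm of `x⁻¹X`. -/
theorem traceMetric_nondegenerate {z : gl42 K} (hz : z ∈ G42 K) :
    (traceMetric K z).Nondegenerate := by
  have h1 : z.1 * z.1⁻¹ = 1 := Matrix.mul_nonsing_inv _ ((Matrix.isUnit_iff_isUnit_det _).1 hz.1)
  have h2 : z.2 * z.2⁻¹ = 1 := Matrix.mul_nonsing_inv _ ((Matrix.isUnit_iff_isUnit_det _).1 hz.2)
  have h1' : z.1⁻¹ * z.1 = 1 := Matrix.nonsing_inv_mul _ ((Matrix.isUnit_iff_isUnit_det _).1 hz.1)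
  have h2' : z.2⁻¹ * z.2 = 1 := Matrix.nonsing_inv_mul _ ((Matrix.isUnit_iff_isUnit_det _).1 hz.2)
  have key : ∀ X : gl42 K, (∀ Y, traceMetric K z X Y = 0) → X = 0 := by
    intro X hX
    have e1 := hX (z.1 * (z.1⁻¹ * X.1)ᴴ, 0)
    have e2 := hX (0, z.2 * (z.2⁻¹ * X.2)ᴴ)
    rw [traceMetric_apply] at e1 e2
    simp only [mul_zero, Matrix.trace_zero, add_zero, zero_add, ← mul_assoc z.1⁻¹ z.1, h1',
      ← mul_assoc z.2⁻¹ z.2, h2', one_mul] at e1 e2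
    have f1 := eq_zero_of_re_trace e1
    have f2 := eq_zero_of_re_trace e2
    refine Prod.ext ?_ ?_
    · rw [← one_mul X.1, ← h1, mul_assoc, f1, mul_zero]; rfl
    · rw [← one_mul X.2, ← h2, mul_assoc, f2, mul_zero]; rfl
  exact ⟨key, fun Y hY => key Y fun X => by rw [traceMetric_comm]; exact hY X⟩

theorem traceMetric_smul (h : H42 K) (z X Y : gl42 K) :
    traceMetric K (h • z) (h • X) (h • Y) = traceMetric K z X Y := by
  have key : ∀ {n : Type} [Fintype n] [DecidableEq n] (s t : GL n K) (x X Y : Matrix n n K),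
      (((s : Matrix n n K) * x * (t : Matrix n n K)ᵀ)⁻¹ * ((s : Matrix n n K) * X * (t : Matrix n n K)ᵀ) *
        (((s : Matrix n n K) * x * (t : Matrix n n K)ᵀ)⁻¹ *
          ((s : Matrix n n K) * Y * (t : Matrix n n K)ᵀ))).trace = (x⁻¹ * X * (x⁻¹ * Y)).trace := by
    intro n _ _ s t x X Y
    have hs : (s : Matrix n n K)⁻¹ * s = 1 := by rw [← Matrix.coe_units_inv, Units.inv_mul]
    have ht : (t : Matrix n n K)ᵀ * ((t : Matrix n n K)ᵀ)⁻¹ = 1 := by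
      change (unitTranspose t : Matrix n n K) * ((unitTranspose t : GL n K) : Matrix n n K)⁻¹ = 1
      rw [← Matrix.coe_units_inv, Units.mul_inv]
    have hs' : ∀ X, (s : Matrix n n K)⁻¹ * (s * X) = X := fun X => by rw [← mul_assoc, hs, one_mul]
    have ht' : ∀ X, (t : Matrix n n K)ᵀ * (((t : Matrix n n K)ᵀ)⁻¹ * X) = X := fun X => by
      rw [← mul_assoc, ht, one_mul]
    simp only [Matrix.mul_inv_rev, mul_assoc, hs', ht']
    rw [Matrix.trace_mul_comm]
    simp only [mul_assoc, ht, mul_one]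
  rw [traceMetric_apply, traceMetric_apply]
  simp only [smul_fst, smul_snd, key]

/-- Some vector normal to `Z` at `z` is not isotropic. -/
def HasNonisotropicNormal (Z : Set (gl42 K)) (z : gl42 K) : Prop :=
  ∃ v, traceMetric K z v v ≠ 0 ∧ ∀ w ∈ tangentSpace Z z, traceMetric K z v w = 0

theorem HasNonisotropicNormal.mono {Z Z' : Set (gl42 K)} {z : gl42 K} (h : Z ⊆ Z')
    (hz : HasNonisotropicNormal Z' z) : HasNonisotropicNormal Z z := by
  obtain ⟨v, h1, h2⟩ := hz
  exact ⟨v, h1, fun w hw => h2 w (tangentSpace_mono h z hw)⟩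

theorem HasNonisotropicNormal.of_smul {Z : Set (gl42 K)} (hZ : IsStable (H42 K) Z) (h : H42 K)
    {z : gl42 K} (hz : HasNonisotropicNormal Z (h • z)) : HasNonisotropicNormal Z z := by
  obtain ⟨v, h1, h2⟩ := hz
  refine ⟨h⁻¹ • v, ?_, fun w hw => ?_⟩
  · rwa [← traceMetric_smul h, smul_inv_smul]
  · rw [← traceMetric_smul h, smul_inv_smul]
    exact h2 _ (map_mem_tangentSpace (Z' := Z) (actEquiv h : gl42 K →L[ℝ] gl42 K)
      (fun x hx => hZ h x hx) hw)

/-- The subspace is the orthogonal complement of a nonisotropic normal `v`: nondegenerate because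
the ambient form is, and proper because it misses `v`. -/
theorem isMetricallyProper_of {Z : Set (gl42 K)} (hZ : IsSubmanifold Z) (hG : Z ⊆ G42 K)
    (h : ∀ z ∈ Z, HasNonisotropicNormal Z z) : IsMetricallyProper (traceMetric K) Z := by
  refine ⟨hZ, fun z hz => ?_⟩
  obtain ⟨v, h1, h2⟩ := h z hz
  have hsymm : (traceMetric K z).IsRefl := fun X Y hXY => by rw [traceMetric_comm]; exact hXY
  refine ⟨(traceMetric K z).orthogonal (Submodule.span ℝ {v}), fun w hw => ?_, fun htop => ?_,
    LinearMap.BilinForm.restrict_nondegenerate_orthogonal_spanSingleton _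
      (traceMetric_nondegenerate (hG hz)) hsymm h1⟩
  · rw [LinearMap.BilinForm.mem_orthogonal_iff]
    intro u hu
    obtain ⟨c, rfl⟩ := Submodule.mem_span_singleton.1 hu
    change traceMetric K z (c • v) w = 0
    rw [map_smul, LinearMap.smul_apply, h2 w hw, smul_zero]
  · have : v ∈ (traceMetric K z).orthogonal (Submodule.span ℝ {v}) := htop ▸ Submodule.mem_top
    exact h1 (LinearMap.BilinForm.mem_orthogonal_iff.1 this v (Submodule.mem_span_singleton_self v))

/-- The metric sees only real parts. A `K`-valued square norm `Q ≠ 0` may be purely imaginary, so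
the normal vector has to be rescaled by some `c`. -/
theorem exists_re_sq_mul_ne_zero {Q : K} (hQ : Q ≠ 0) : ∃ c : K, RCLike.re (c * c * Q) ≠ 0 := by
  by_contra! h
  -- Polarisation: if `Re(c²Q)` vanished for all `c`, then so would `2 Re(star Q * Q) = 2 ‖Q‖²`.
  have h1 := h (star Q + 1)
  have e : (star Q + 1) * (star Q + 1) * Q =
      star Q * star Q * Q + 1 * 1 * Q + (star Q * Q + star Q * Q) := by ring
  rw [e, map_add, map_add, h, h, map_add] at h1
  have h2 : star Q * Q = ((‖Q‖ ^ 2 : ℝ) : K) := by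
    rw [RCLike.star_def, RCLike.conj_mul]; norm_cast
  rw [h2, RCLike.ofReal_re] at h1
  have : 0 < ‖Q‖ := norm_pos_iff.2 hQ
  nlinarith [pow_pos this 2]

/-- If the differential at `z` of a function vanishing on `Z` is represented by `(Ψ₁, Ψ₂)` through
the trace pairing, then it provides a normal vector. -/
theorem hasNonisotropicNormal_of_gradient {Z : Set (gl42 K)} {z : gl42 K} (hz : z ∈ G42 K)
    {f : gl42 K → K} (hf : DifferentiableAt ℝ f z) (h0 : ∀ x ∈ Z, f x = 0)
    {Ψ₁ : Mat4 K} {Ψ₂ : Mat2 K}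
    (hΨ : ∀ w, fderiv ℝ f z w = (Ψ₁ * w.1).trace + (Ψ₂ * w.2).trace)
    (hQ : (Ψ₁ * z.1 * (Ψ₁ * z.1)).trace + (Ψ₂ * z.2 * (Ψ₂ * z.2)).trace ≠ 0) :
    HasNonisotropicNormal Z z := by
  have h1 : z.1 * z.1⁻¹ = 1 := Matrix.mul_nonsing_inv _ ((Matrix.isUnit_iff_isUnit_det _).1 hz.1)
  have h2 : z.2 * z.2⁻¹ = 1 := Matrix.mul_nonsing_inv _ ((Matrix.isUnit_iff_isUnit_det _).1 hz.2)
  have h1' : z.1⁻¹ * z.1 = 1 := Matrix.nonsing_inv_mul _ ((Matrix.isUnit_iff_isUnit_det _).1 hz.1)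
  have h2' : z.2⁻¹ * z.2 = 1 := Matrix.nonsing_inv_mul _ ((Matrix.isUnit_iff_isUnit_det _).1 hz.2)
  obtain ⟨c, hc⟩ := exists_re_sq_mul_ne_zero hQ
  have key : ∀ w : gl42 K, traceMetric K z (c • (z.1 * (Ψ₁ * z.1)), c • (z.2 * (Ψ₂ * z.2))) w =
      RCLike.re (c * ((Ψ₁ * w.1).trace + (Ψ₂ * w.2).trace)) := by
    intro w
    rw [traceMetric_apply]
    have e1 : z.1⁻¹ * (c • (z.1 * (Ψ₁ * z.1))) * (z.1⁻¹ * w.1) = c • (Ψ₁ * w.1) := by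
      rw [Matrix.mul_smul, Matrix.smul_mul, ← mul_assoc z.1⁻¹ z.1, h1', one_mul, mul_assoc,
        ← mul_assoc z.1, h1, one_mul]
    have e2 : z.2⁻¹ * (c • (z.2 * (Ψ₂ * z.2))) * (z.2⁻¹ * w.2) = c • (Ψ₂ * w.2) := by
      rw [Matrix.mul_smul, Matrix.smul_mul, ← mul_assoc z.2⁻¹ z.2, h2', one_mul, mul_assoc,
        ← mul_assoc z.2, h2, one_mul]
    simp only [e1, e2, Matrix.trace_smul, smul_eq_mul, mul_add]
  -- The metric at `x` pairs `xΨx` with `w` as `Re tr(Ψw)`, so this is the gradient, scaled by `c`.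
  refine ⟨(c • (z.1 * (Ψ₁ * z.1)), c • (z.2 * (Ψ₂ * z.2))), ?_, fun w hw => ?_⟩
  · rw [key]
    convert hc using 2
    simp only [Matrix.mul_smul, Matrix.trace_smul, smul_eq_mul, mul_assoc]
    ring
  · rw [key, ← hΨ]
    have e : fderiv ℝ f z w = 0 := fderiv_eq_zero_of_mem_tangentSpace hf h0 hw
    refine (congrArg (fun x => RCLike.re (c * x)) e).trans ?_
    simp only [mul_zero, map_zero]

theorem trace_fromBlocks (P Q R S : Mat2 K) :
    (Matrix.fromBlocks P Q R S).trace = P.trace + S.trace := by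
  simp [Matrix.trace, Fintype.sum_sum_type]

theorem trace_fromBlocks_mul (P Q R S : Mat2 K) (w : Mat4 K) :
    (Matrix.fromBlocks P Q R S * w).trace = (P * w.toBlocks₁₁).trace + (Q * w.toBlocks₂₁).trace +
      (R * w.toBlocks₁₂).trace + (S * w.toBlocks₂₂).trace := by
  conv_lhs => rw [← Matrix.fromBlocks_toBlocks w, Matrix.fromBlocks_multiply,
    trace_fromBlocks, Matrix.trace_add, Matrix.trace_add]
  ring

/-- If `AN = 0`, then `x · diag(0, N)` has blocks built from `AN` and `N²` only, hence vanishes,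
contradicting invertibility of `x`. -/
theorem mul_blk₂₂_ne_zero {z : gl42 K} (hz : z ∈ G42 K)
    (h : NilCond (blk₁₁ z) (blk₁₂ z) (blk₂₁ z) (blk₂₂ z)) : blk₁₂ z * blk₂₂ z ≠ 0 := by
  intro h0
  have e : z.1 * Matrix.fromBlocks 0 0 0 (blk₂₂ z) = 0 := by
    rw [fst_eq_fromBlocks hz.2, Matrix.fromBlocks_multiply]
    simp [mul_assoc, h0, h.sq]
  rw [hz.1.mul_right_eq_zero] at e
  have e' := congrArg Matrix.toBlocks₂₂ e
  rw [Matrix.toBlocks_fromBlocks₂₂] at e'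
  exact h.2 e'

theorem blk₂₂_mul_ne_zero {z : gl42 K} (hz : z ∈ G42 K)
    (h : NilCond (blk₁₁ z) (blk₁₂ z) (blk₂₁ z) (blk₂₂ z)) : blk₂₂ z * blk₂₁ z ≠ 0 := by
  intro h0
  have hi : z.2⁻¹ * z.2 = 1 := Matrix.nonsing_inv_mul _ ((Matrix.isUnit_iff_isUnit_det _).1 hz.2)
  have hi' : ∀ X, z.2⁻¹ * (z.2 * X) = X := fun X => by rw [← mul_assoc, hi, one_mul]
  have e : Matrix.fromBlocks 0 0 0 (blk₂₂ z * z.2⁻¹) * z.1 = 0 := by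
    rw [fst_eq_fromBlocks hz.2, Matrix.fromBlocks_multiply]
    simp [mul_assoc, hi', h0, h.sq]
  rw [hz.1.mul_left_eq_zero] at e
  have e' := congrArg Matrix.toBlocks₂₂ e
  rw [Matrix.toBlocks_fromBlocks₂₂] at e'
  replace e' : blk₂₂ z * z.2⁻¹ = 0 := e'
  exact h.2 (by rw [← mul_one (blk₂₂ z), ← hi, ← mul_assoc, e', zero_mul])

section Gradients

variable {z : gl42 K}

theorem hasNonisotropicNormal_traceEq (hz : z ∈ blockLocus TraceEqCond) (h1 : z.2 = 1)
    (h2 : z.1.toBlocks₂₂ = !![0, 1; 0, 0])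
    (hq : (blk₁₂ z * blk₂₂ z).trace ≠ 0) :
    HasNonisotropicNormal (blockLocus TraceEqCond) z := by
  have hd := differentiableAt_of_contDiffOn_G42 contDiffOn_diffFun hz.1
  obtain ⟨b1, b2, b3, b4⟩ := blk_of_snd_eq_one h1
  have hqr := hz.2.2
  rw [b2, b3, b4] at hqr
  rw [b2, b4] at hq
  have hx := Matrix.fromBlocks_toBlocks z.1
  set C := z.1.toBlocks₁₁
  set A := z.1.toBlocks₁₂
  set B := z.1.toBlocks₂₁
  set N := z.1.toBlocks₂₂
  have n00 : N 0 0 = 0 := by rw [h2]; rfl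
  have n01 : N 0 1 = 1 := by rw [h2]; rfl
  have n10 : N 1 0 = 0 := by rw [h2]; rfl
  have n11 : N 1 1 = 0 := by rw [h2]; rfl
  simp only [Matrix.trace_fin_two, Matrix.mul_apply, Fin.sum_univ_two, n00, n01, n10, n11, mul_zero,
    mul_one, zero_mul, one_mul, zero_add, add_zero] at hq hqr
  -- The matrices `Ψ` are read off from the differential by rotating factors cyclically under the
  -- trace; `Ψ₂` comes from the factor `y⁻¹` in the blocks.
  refine hasNonisotropicNormal_of_gradient hz.1 hd (fun x hx => sub_eq_zero.2 hx.2.2)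
    (Ψ₁ := Matrix.fromBlocks 0 (-N) N (A - B))
    (Ψ₂ := N * B + B * N - A * N - N * A) ?_ ?_
  · intro w
    refine fderiv_apply_eq_of_hasDerivAt hd ?_
    have d1 := hasDerivAt_blk₁₁ h1 w
    have d2 := hasDerivAt_blk₁₂ h1 w
    have d3 := hasDerivAt_blk₂₁ h1 w
    have d4 := hasDerivAt_blk₂₂ h1 w
    refine ((hasDerivAt_matrix_trace (hasDerivAt_matrix_mul d2 d4)).sub
      (hasDerivAt_matrix_trace (hasDerivAt_matrix_mul d4 d3))).congr_deriv ?_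
    simp only [zero_smul, add_zero, b2, b3, b4, trace_fromBlocks_mul]
    change ((w.1.toBlocks₁₂ - w.2 * A) * N + A * (w.1.toBlocks₂₂ - w.2 * N)).trace -
      ((w.1.toBlocks₂₂ - w.2 * N) * B + N * (w.1.toBlocks₂₁ - w.2 * B)).trace = _
    generalize w.1.toBlocks₁₁ = c
    generalize w.1.toBlocks₁₂ = a
    generalize w.1.toBlocks₂₁ = b
    generalize w.1.toBlocks₂₂ = n
    generalize w.2 = y
    simp only [Matrix.trace_fin_two, Matrix.mul_apply, Fin.sum_univ_two, Matrix.add_apply,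
      Matrix.sub_apply, Matrix.neg_apply, Matrix.zero_apply, n00, n01, n10, n11]
    ring
  · rw [← hx, h1, Matrix.fromBlocks_multiply, Matrix.fromBlocks_multiply, trace_fromBlocks]
    simp only [Matrix.trace_fin_two, Matrix.mul_apply, Fin.sum_univ_two, Matrix.add_apply,
      Matrix.sub_apply, Matrix.neg_apply, Matrix.zero_apply, Matrix.one_apply_eq, Matrix.one_apply_ne, ne_eq, zero_ne_one, one_ne_zero,
      not_false_eq_true, n00, n01, n10, n11]
    intro h0
    -- Given `A 1 0 = B 1 0`, the square norm equals `2 (A 1 0)²`, and `A 1 0 = tr AN`.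
    exact hq (mul_self_eq_zero.1 (by linear_combination (1 / 2) * h0 + (2 * B 1 0 - A 1 0) * hqr))

theorem hasNonisotropicNormal_cubic (hz : z ∈ blockLocus CubicCond) (h1 : z.2 = 1)
    (h2 : z.1.toBlocks₂₂ = !![0, 1; 0, 0]) :
    HasNonisotropicNormal (blockLocus CubicCond) z := by
  have hd := differentiableAt_of_contDiffOn_G42 contDiffOn_cubicFun hz.1
  obtain ⟨b1, b2, b3, b4⟩ := blk_of_snd_eq_one h1
  obtain ⟨-, hA0, hB0⟩ := hz.2.1
  have hAN := mul_blk₂₂_ne_zero hz.1 hz.2.1.1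
  have hNB := blk₂₂_mul_ne_zero hz.1 hz.2.1.1
  rw [b2, b4] at hA0 hAN
  rw [b3, b4] at hB0 hNB
  have hG := congrArg (fun M : Mat2 K => M 0 1) hz.2.2
  rw [b1, b2, b3, b4] at hG
  have hx := Matrix.fromBlocks_toBlocks z.1
  set C := z.1.toBlocks₁₁
  set A := z.1.toBlocks₁₂
  set B := z.1.toBlocks₂₁
  set N := z.1.toBlocks₂₂
  have n00 : N 0 0 = 0 := by rw [h2]; rfl
  have n01 : N 0 1 = 1 := by rw [h2]; rfl
  have n10 : N 1 0 = 0 := by rw [h2]; rfl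
  have n11 : N 1 1 = 0 := by rw [h2]; rfl
  -- `T = E₂₁` turns an entry into a trace, `tr(TM) = M 0 1`, so the differential of an entry can be
  -- put in trace form.
  obtain ⟨T, t00, t01, t10, t11⟩ : ∃ T : Mat2 K, T 0 0 = 0 ∧ T 0 1 = 0 ∧ T 1 0 = 1 ∧ T 1 1 = 0 :=
    ⟨!![0, 0; 1, 0], rfl, rfl, rfl, rfl⟩
  simp only [Matrix.trace_fin_two, Matrix.mul_apply, Fin.sum_univ_two, n00, n01, n10, n11, mul_zero,
    mul_one, zero_mul, one_mul, zero_add, add_zero] at hA0 hB0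
  have hA : A 0 0 ≠ 0 := fun h => hAN (by
    ext i j
    fin_cases i <;> fin_cases j <;>
      simp [Matrix.mul_apply, Fin.sum_univ_two, n00, n01, n10, n11, hA0, h])
  have hB : B 1 1 ≠ 0 := fun h => hNB (by
    ext i j
    fin_cases i <;> fin_cases j <;>
      simp [Matrix.mul_apply, Fin.sum_univ_two, n00, n01, n10, n11, hB0, h])
  simp only [cubic, Matrix.mul_apply, Fin.sum_univ_two, Matrix.add_apply, Matrix.sub_apply,
    Matrix.zero_apply, n00, n01, n10, n11, mul_zero, mul_one, zero_mul, one_mul, zero_add,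
    add_zero] at hG
  -- The equation `cubic = 0` eliminates `C 1 0`; the square norm then becomes `4 (A 0 0 * B 1 1)²`,
  -- where `A 0 0 = p` and `B 1 1 = s`.
  have hC : C 1 0 = B 0 0 * A 1 1 - A 0 0 * B 1 1 := by linear_combination hG
  refine hasNonisotropicNormal_of_gradient hz.1 hd (fun x hx => by
      change cubic _ _ _ _ 0 1 = 0
      rw [hx.2.2]; rfl)
    (Ψ₁ := Matrix.fromBlocks (N * T * N) (T * A * N - N * A * T) (N * B * T - T * B * N)
      (C * N * T + T * N * C + B * T * A - A * T * B))
    (Ψ₂ := B * N * A * T + N * A * T * B + A * T * B * N - N * C * N * T - C * N * T * N - N * T * N * C -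
      A * N * B * T - N * B * T * A - B * T * A * N) ?_ ?_
  · intro w
    refine fderiv_apply_eq_of_hasDerivAt hd ?_
    have d1 := hasDerivAt_blk₁₁ h1 w
    have d2 := hasDerivAt_blk₁₂ h1 w
    have d3 := hasDerivAt_blk₂₁ h1 w
    have d4 := hasDerivAt_blk₂₂ h1 w
    refine (hasDerivAt_matrix.1 (((hasDerivAt_matrix_mul (hasDerivAt_matrix_mul d4 d1) d4).add
      (hasDerivAt_matrix_mul (hasDerivAt_matrix_mul d2 d4) d3)).sub (hasDerivAt_matrix_mul (hasDerivAt_matrix_mul d3 d4) d2)) 0 1).congr_deriv ?_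
    simp only [zero_smul, add_zero, b1, b2, b3, b4, trace_fromBlocks_mul]
    change ((((w.1.toBlocks₂₂ - w.2 * N) * C + N * (w.1.toBlocks₁₁ - w.2 * C)) * N +
        N * C * (w.1.toBlocks₂₂ - w.2 * N)) +
      (((w.1.toBlocks₁₂ - w.2 * A) * N + A * (w.1.toBlocks₂₂ - w.2 * N)) * B +
        A * N * (w.1.toBlocks₂₁ - w.2 * B)) -
      (((w.1.toBlocks₂₁ - w.2 * B) * N + B * (w.1.toBlocks₂₂ - w.2 * N)) * A +
        B * N * (w.1.toBlocks₁₂ - w.2 * A))) 0 1 = _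
    generalize w.1.toBlocks₁₁ = c
    generalize w.1.toBlocks₁₂ = a
    generalize w.1.toBlocks₂₁ = b
    generalize w.1.toBlocks₂₂ = n
    generalize w.2 = y
    simp only [Matrix.trace_fin_two, Matrix.mul_apply, Fin.sum_univ_two, Matrix.add_apply,
      Matrix.sub_apply, n00, n01, n10, n11, t00, t01, t10, t11]
    ring
  · rw [← hx, h1, Matrix.fromBlocks_multiply, Matrix.fromBlocks_multiply, trace_fromBlocks]
    simp only [Matrix.trace_fin_two, Matrix.mul_apply, Fin.sum_univ_two, Matrix.add_apply,
      Matrix.sub_apply, Matrix.one_apply_eq, Matrix.one_apply_ne, ne_eq, zero_ne_one, one_ne_zero,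
      not_false_eq_true, n00, n01, n10, n11, t00, t01, t10, t11, hA0, hB0, hC]
    intro h0
    exact mul_ne_zero hA hB (mul_self_eq_zero.1 (by linear_combination (1 / 4) * h0))

theorem hasNonisotropicNormal_comm (hz : z ∈ blockLocus CommCond) (h1 : z.2 = 1)
    (h2 : z.1.toBlocks₂₂ = !![0, 1; 0, 0]) :
    HasNonisotropicNormal (blockLocus CommCond) z := by
  have hd := differentiableAt_of_contDiffOn_G42 contDiffOn_commFun hz.1
  obtain ⟨b1, b2, b3, b4⟩ := blk_of_snd_eq_one h1
  obtain ⟨-, hA0, hB0⟩ := hz.2.traceZeroCond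
  have hAN := mul_blk₂₂_ne_zero hz.1 hz.2.1
  have hNB := blk₂₂_mul_ne_zero hz.1 hz.2.1
  rw [b2, b4] at hA0 hAN
  rw [b3, b4] at hB0 hNB
  have hG := congrArg (fun M : Mat2 K => M 0 1) hz.2.2
  rw [b2, b3, b4] at hG
  have hx := Matrix.fromBlocks_toBlocks z.1
  set C := z.1.toBlocks₁₁
  set A := z.1.toBlocks₁₂
  set B := z.1.toBlocks₂₁
  set N := z.1.toBlocks₂₂
  have n00 : N 0 0 = 0 := by rw [h2]; rfl
  have n01 : N 0 1 = 1 := by rw [h2]; rfl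
  have n10 : N 1 0 = 0 := by rw [h2]; rfl
  have n11 : N 1 1 = 0 := by rw [h2]; rfl
  obtain ⟨T, t00, t01, t10, t11⟩ : ∃ T : Mat2 K, T 0 0 = 0 ∧ T 0 1 = 0 ∧ T 1 0 = 1 ∧ T 1 1 = 0 :=
    ⟨!![0, 0; 1, 0], rfl, rfl, rfl, rfl⟩
  simp only [Matrix.trace_fin_two, Matrix.mul_apply, Fin.sum_univ_two, n00, n01, n10, n11, mul_zero,
    mul_one, zero_mul, one_mul, zero_add, add_zero] at hA0 hB0
  have hA : A 0 0 ≠ 0 := fun h => hAN (by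
    ext i j
    fin_cases i <;> fin_cases j <;>
      simp [Matrix.mul_apply, Fin.sum_univ_two, n00, n01, n10, n11, hA0, h])
  simp only [Matrix.mul_apply, Fin.sum_univ_two, n00, n01, n11, mul_zero, mul_one, zero_mul,
    one_mul, add_zero] at hG
  refine hasNonisotropicNormal_of_gradient hz.1 hd (fun x hx => by
      change (_ - _ : Mat2 K) 0 1 = 0
      rw [hx.2.2, sub_self]; rfl)
    (Ψ₁ := Matrix.fromBlocks 0 (-(T * N)) (N * T) (T * A - B * T))
    (Ψ₂ := N * B * T + B * T * N - A * N * T - N * T * A) ?_ ?_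
  · intro w
    refine fderiv_apply_eq_of_hasDerivAt hd ?_
    have d1 := hasDerivAt_blk₁₁ h1 w
    have d2 := hasDerivAt_blk₁₂ h1 w
    have d3 := hasDerivAt_blk₂₁ h1 w
    have d4 := hasDerivAt_blk₂₂ h1 w
    refine (hasDerivAt_matrix.1 ((hasDerivAt_matrix_mul d2 d4).sub (hasDerivAt_matrix_mul d4 d3)) 0 1).congr_deriv ?_
    simp only [zero_smul, add_zero, b2, b3, b4, trace_fromBlocks_mul]
    change (((w.1.toBlocks₁₂ - w.2 * A) * N + A * (w.1.toBlocks₂₂ - w.2 * N)) -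
      ((w.1.toBlocks₂₂ - w.2 * N) * B + N * (w.1.toBlocks₂₁ - w.2 * B))) 0 1 = _
    generalize w.1.toBlocks₁₁ = c
    generalize w.1.toBlocks₁₂ = a
    generalize w.1.toBlocks₂₁ = b
    generalize w.1.toBlocks₂₂ = n
    generalize w.2 = y
    simp only [Matrix.trace_fin_two, Matrix.mul_apply, Fin.sum_univ_two, Matrix.add_apply,
      Matrix.sub_apply, Matrix.neg_apply, Matrix.zero_apply, n00, n01, n10, n11, t00, t01, t10, t11]
    ring
  · rw [← hx, h1, Matrix.fromBlocks_multiply, Matrix.fromBlocks_multiply, trace_fromBlocks]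
    simp only [Matrix.trace_fin_two, Matrix.mul_apply, Fin.sum_univ_two, Matrix.add_apply,
      Matrix.sub_apply, Matrix.neg_apply, Matrix.zero_apply, Matrix.one_apply_eq, Matrix.one_apply_ne, ne_eq, zero_ne_one, one_ne_zero,
      not_false_eq_true, n00, n01, n10, n11, t00, t01, t10, t11, hA0, hB0]
    intro h0
    -- The relation `A 0 0 = B 1 1` reduces the square norm to `4 (A 0 0)²`.
    exact hA (mul_self_eq_zero.1 (by linear_combination (1 / 4) * h0 + (B 1 1 - A 0 0 / 2) * hG))

end Gradients

end Metric

/-! ### Solving the stabilizer equations on the third stratum. -/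

section Correction

variable {K : Type*} [RCLike K]

/-- The part of `(1 - β N) C (1 + β N) - C` which is not accounted for by the scalar parts of `b`
and `e` in `stabilizer_identities`. -/
def correction (β τ σ : K) (C A B N : Mat2 K) : Mat2 K :=
  β • (C * N - N * C) - β ^ 2 • (N * C * N) - (β * τ) • B - (β * σ) • A - (β ^ 2 * τ * σ) • N

/-- The matrices `b`, `e` for which `(1 + β N, b, e)` stabilizes the blocks `C`, `A`, `B`, `N`. -/
theorem stabilizer_identities {C A B N : Mat2 K} (h : N * N = 0) (hN : N ≠ 0) {p s : K}
    (hp : A * N = p • N) (hp' : N * A = (A.trace - p) • N) (hs : N * B = s • N)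
    (hs' : B * N = (B.trace - s) • N) (hp0 : p ≠ 0) (hs0 : s ≠ 0) (β : K) {ν τ σ : K} {b e : Mat2 K}
    (hν : ν = (N * Nᴴ).trace) (hτ : τ = 2 * p - A.trace) (hσ : σ = B.trace - 2 * s)
    (hb : b = (β * τ) • 1 + (s⁻¹ * ν⁻¹) • (correction β τ σ C A B N * (Nᴴ * N)))
    (he : e = (β * σ) • 1 + (p⁻¹ * ν⁻¹) • (correction β τ σ C A B N * (N * Nᴴ))) :
    A + b * N = (1 - β • N) * A * (1 + β • N) ∧
    B + N * e = (1 - β • N) * B * (1 + β • N) ∧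
    C + b * B + A * e + b * N * e = (1 - β • N) * C * (1 + β • N) ∧
    b.trace + e.trace = β * ((p - s) *
      ((N * C).trace + p * s - (A.trace - p) * (B.trace - s)) * (p⁻¹ * s⁻¹)) := by
  -- The first two identities amount to `bN = βτN` and `Ne = βσN`. Writing `b = βτ + b'` and `e = βσ
  -- + e'` with `b'N = 0 = Ne'`, the third becomes `b'B + Ae' = R`. The given `b'`, `e'` solve it:
  -- `NB = sN` and `AN = pN` turn the two terms into `ν⁻¹R NᴴN` and `ν⁻¹R NNᴴ`, which add up to `R`.
  have hν0 : ν ≠ 0 := hν ▸ trace_mul_conjTranspose_ne_zero hN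
  have hsum : Nᴴ * N = ν • 1 - N * Nᴴ := by
    rw [eq_sub_iff_add_eq, add_comm, hν, mul_conjTranspose_add h]
  have hNCN : N * C * N = (N * C).trace • N := by
    rw [mul_assoc, mul_mul_self_of_sq h, Matrix.trace_mul_comm]
  set R := correction β τ σ C A B N with hR
  set l := -(β * ((N * C).trace + τ * (B.trace - s) + σ * p)) with hl
  -- This is what makes `e'` a multiple of `NNᴴ`, so that `Ne' = 0` and `AN = pN` applies to `Ae'`.
  have hRN : R * N = l • N := by
    rw [hR, correction, hNCN]
    simp only [sub_mul, Matrix.smul_mul, mul_assoc, h, hp, hs', hNCN, mul_zero,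
      smul_zero]
    rw [hl]
    module
  have hRNN : R * (N * Nᴴ) = l • (N * Nᴴ) := by rw [← mul_assoc, hRN, Matrix.smul_mul]
  have hbN : b * N = (β * τ) • N := by
    rw [hb, add_mul, Matrix.smul_mul, Matrix.smul_mul, one_mul, mul_assoc, mul_assoc, h]
    simp
  have hNe : N * e = (β * σ) • N := by
    rw [he, hRNN, mul_add, Matrix.mul_smul, Matrix.mul_smul, Matrix.mul_smul, mul_one,
      ← mul_assoc, h]
    simp
  have hbB : b * B = (β * τ) • B + (ν⁻¹ • R * (Nᴴ * N)) := by
    rw [hb, add_mul, Matrix.smul_mul, Matrix.smul_mul, one_mul, mul_assoc, mul_assoc, hs,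
      Matrix.mul_smul, Matrix.mul_smul, smul_smul, Matrix.smul_mul]
    congr 2
    field_simp
  have hAe : A * e = (β * σ) • A + (ν⁻¹ • R * (N * Nᴴ)) := by
    rw [he, Matrix.smul_mul, hRNN, mul_add, Matrix.mul_smul, Matrix.mul_smul, Matrix.mul_smul,
      mul_one, ← mul_assoc, hp, Matrix.smul_mul, smul_smul, smul_smul, smul_smul]
    congr 2
    field_simp
  have hRR : ν⁻¹ • R * (Nᴴ * N) + ν⁻¹ • R * (N * Nᴴ) = R := by
    rw [hsum, ← mul_add, sub_add_cancel, Matrix.mul_smul, mul_one, smul_smul,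
      mul_inv_cancel₀ hν0, one_smul]
  refine ⟨?_, ?_, ?_, ?_⟩
  · rw [hbN]
    simp only [sub_mul, mul_add, mul_one, one_mul, Matrix.smul_mul, Matrix.mul_smul, hp, hp',
      h, smul_zero]
    rw [hτ]
    module
  · rw [hNe]
    simp only [sub_mul, mul_add, mul_one, one_mul, Matrix.smul_mul, Matrix.mul_smul, hs, hs',
      h, smul_zero]
    rw [hσ]
    module
  · rw [hbN, hbB, hAe, Matrix.smul_mul _ N, hNe]
    have : C + ((β * τ) • B + ν⁻¹ • R * (Nᴴ * N)) + ((β * σ) • A + ν⁻¹ • R * (N * Nᴴ)) +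
        (β * τ) • (β * σ) • N = C + (β * τ) • B + (β * σ) • A + (β ^ 2 * τ * σ) • N +
        (ν⁻¹ • R * (Nᴴ * N) + ν⁻¹ • R * (N * Nᴴ)) := by module
    rw [this, hRR, hR, correction]
    simp only [sub_mul, mul_add, mul_one, one_mul, Matrix.smul_mul, Matrix.mul_smul]
    module
  · have htR : R.trace = -(β * (τ * B.trace + σ * A.trace)) := by
      rw [hR, correction, hNCN]
      simp only [Matrix.trace_sub, Matrix.trace_smul, Matrix.trace_mul_comm C N,
        trace_eq_zero_of_sq h, smul_eq_mul]
      ring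
    rw [hb, he, hsum, mul_sub, hRNN, Matrix.mul_smul, mul_one]
    simp only [Matrix.trace_add, Matrix.trace_sub, Matrix.trace_smul, htR, ← hν, smul_eq_mul,
      Matrix.trace_one, Fintype.card_fin, Nat.cast_ofNat]
    rw [hl, hτ, hσ]
    field_simp
    ring

/-- Expresses the eigenvalue-like scalars `p`, `s` by formulas that are visibly smooth in the point.
-/
theorem TraceZeroCond.exists_scalars' {C A B N : Mat2 K} (h : TraceZeroCond C A B N)
    {p s : K} (hp : p = (A * (N * Nᴴ)).trace * (N * Nᴴ).trace⁻¹)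
    (hs : s = (Nᴴ * N * B).trace * (N * Nᴴ).trace⁻¹) :
    A * N = p • N ∧ N * A = (A.trace - p) • N ∧ N * B = s • N ∧ B * N = (B.trace - s) • N := by
  obtain ⟨p', s', h1, h2, h3, h4⟩ := h.exists_scalars
  have hν := trace_mul_conjTranspose_ne_zero h.1.2
  have hpp : p = p' := by
    rw [hp, ← mul_assoc, h1, Matrix.smul_mul, Matrix.trace_smul, smul_eq_mul, mul_assoc,
      mul_inv_cancel₀ hν, mul_one]
  have hss : s = s' := by
    rw [hs, mul_assoc, h3, Matrix.mul_smul, Matrix.trace_smul, smul_eq_mul,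
      Matrix.trace_mul_comm Nᴴ, mul_assoc, mul_inv_cancel₀ hν, mul_one]
  rw [hpp, hss]
  exact ⟨h1, h2, h3, h4⟩

end Correction

/-! ### Closedness, the five strata, and the conclusion. -/

section Filtration

variable {K : Type*} [RCLike K]

theorem exists_isClosed_iff {F : Type*} [TopologicalSpace F] [Zero F] [T1Space F]
    {f : gl42 K → F} (hf : ContinuousOn f (G42 K)) :
    ∃ C : Set (gl42 K), IsClosed C ∧ ∀ z ∈ G42 K, f z = 0 ↔ z ∈ C := by
  obtain ⟨C, hC, h⟩ := continuousOn_iff_isClosed.1 hf {0} isClosed_singleton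
  refine ⟨C, hC, fun z hz => ?_⟩
  have := Set.ext_iff.1 h z
  simpa [hz] using this

theorem isLocallyClosed_Z4 : IsLocallyClosed (Z4 K) := by
  have h2 := contDiffOn_blk₂₂ (K := K) (s := G42 K) fun z hz => hz.2
  obtain ⟨C, hC, h⟩ := exists_isClosed_iff (contDiffOn_matrix_mul h2 h2).continuousOn
  obtain ⟨D, hD, h'⟩ := exists_isClosed_iff h2.continuousOn
  refine ⟨G42 K ∩ Dᶜ, C, (isOpen_G42 K).inter hD.isOpen_compl, hC, Set.ext fun z => ?_⟩
  constructor
  · intro hz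
    exact ⟨⟨hz.1, fun hzD => hz.2.2 ((h' z hz.1).2 hzD)⟩, (h z hz.1).1 (NilCond.sq (C := 0) (A := 0)
      (B := 0) hz.2)⟩
  · rintro ⟨⟨hz, hzD⟩, hzC⟩
    exact ⟨hz, ⟨2, by rw [pow_two]; exact (h z hz).2 hzC⟩, fun h0 => hzD ((h' z hz).1 h0)⟩

theorem exists_blockLocus_eq_inter {F : Type*} [TopologicalSpace F] [Zero F] [T1Space F]
    {P : Mat2 K → Mat2 K → Mat2 K → Mat2 K → Prop} {f : gl42 K → F}
    (hf : ContinuousOn f (G42 K)) (h : ∀ z, P (blk₁₁ z) (blk₁₂ z) (blk₂₁ z) (blk₂₂ z) ↔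
      NilCond (blk₁₁ z) (blk₁₂ z) (blk₂₁ z) (blk₂₂ z) ∧ f z = 0) :
    ∃ C : Set (gl42 K), IsClosed C ∧ blockLocus P = Z4 K ∩ C := by
  obtain ⟨C, hC, hfC⟩ := exists_isClosed_iff hf
  refine ⟨C, hC, Set.ext fun z => ?_⟩
  rw [Z4_eq]
  constructor
  · rintro ⟨hz, hP⟩
    exact ⟨⟨hz, ((h z).1 hP).1⟩, (hfC z hz).1 ((h z).1 hP).2⟩
  · rintro ⟨⟨hz, hn⟩, hzC⟩
    exact ⟨hz, (h z).2 ⟨hn, (hfC z hz).2 hzC⟩⟩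

variable (K) in
theorem exists_traceEq_eq_inter :
    ∃ C : Set (gl42 K), IsClosed C ∧ blockLocus TraceEqCond = Z4 K ∩ C :=
  exists_blockLocus_eq_inter (contDiffOn_diffFun (K := K)).continuousOn
    fun _ => and_congr_right fun _ => sub_eq_zero.symm

variable (K) in
theorem exists_traceZero_eq_inter :
    ∃ C : Set (gl42 K), IsClosed C ∧ blockLocus TraceZeroCond = Z4 K ∩ C :=
  exists_blockLocus_eq_inter
    ((contDiffOn_rightFun (K := K)).prodMk contDiffOn_leftFun).continuousOn
    fun _ => and_congr_right fun _ => pair_eq_zero.symm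

variable (K) in
theorem exists_comm_eq_inter :
    ∃ C : Set (gl42 K), IsClosed C ∧ blockLocus CommCond = Z4 K ∩ C := by
  have h1 := contDiffOn_blk₁₂ (K := K) (s := G42 K) fun z hz => hz.2
  have h2 := contDiffOn_blk₂₁ (K := K) (s := G42 K) fun z hz => hz.2
  have h3 := contDiffOn_blk₂₂ (K := K) (s := G42 K) fun z hz => hz.2
  exact exists_blockLocus_eq_inter
    ((contDiffOn_matrix_mul h1 h3).sub (contDiffOn_matrix_mul h3 h2)).continuousOn
    fun _ => and_congr_right fun _ => sub_eq_zero.symm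

variable (K) in
theorem exists_cubic_eq_inter :
    ∃ C : Set (gl42 K), IsClosed C ∧ blockLocus CubicCond = Z4 K ∩ C := by
  refine exists_blockLocus_eq_inter
    (((contDiffOn_rightFun (K := K)).prodMk contDiffOn_leftFun).prodMk
      (contDiffOn_cubic fun z hz => hz.2)).continuousOn fun z => ?_
  rw [pair_eq_zero, ← and_assoc]
  exact and_congr_left fun _ => and_congr_right fun _ => pair_eq_zero.symm

theorem IsSubmanifold.diff_isClosed {Z C : Set (gl42 K)} (hZ : IsSubmanifold Z) (hC : IsClosed C) :
    IsSubmanifold (Z \ C) :=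
  hZ.of_relatively_open fun _ hz => ⟨Cᶜ, hC.isOpen_compl, hz.2, fun _ hx =>
    ⟨fun h => h.1, fun h => ⟨h, hx⟩⟩⟩

/-- Shows the strata to be a submanifold minus a closed set, hence again submanifolds. -/
theorem diff_eq_diff_of_eq_inter {α : Type*} {Z Y X C : Set α} (hZ : Z ⊆ Y) (h : X = Y ∩ C) :
    Z \ X = Z \ C := by
  ext x
  rw [h]
  exact ⟨fun hx => ⟨hx.1, fun hc => hx.2 ⟨hZ hx.1, hc⟩⟩, fun hx => ⟨hx.1, fun hc => hx.2 hc.2⟩⟩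

theorem IsStable.diff {Z Z' : Set (gl42 K)} (h : IsStable (H42 K) Z) (h' : IsStable (H42 K) Z') :
    IsStable (H42 K) (Z \ Z') :=
  fun g z hz => ⟨h g z hz.1, fun hz' => hz.2 ((h'.smul_mem_iff g z).1 hz')⟩

theorem IsStable.union {Z Z' : Set (gl42 K)} (h : IsStable (H42 K) Z) (h' : IsStable (H42 K) Z') :
    IsStable (H42 K) (Z ∪ Z') :=
  fun g z hz => hz.imp (h g z) (h' g z)

theorem blockLocus_mono {P Q : Mat2 K → Mat2 K → Mat2 K → Mat2 K → Prop}
    (h : ∀ C A B N, P C A B N → Q C A B N) : blockLocus P ⊆ blockLocus Q :=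
  fun _ hz => ⟨hz.1, h _ _ _ _ hz.2⟩

theorem traceEq_subset : blockLocus (TraceEqCond (K := K)) ⊆ Z4 K :=
  fun _ hz => ⟨hz.1, hz.2.1⟩

theorem traceZero_subset : blockLocus (TraceZeroCond (K := K)) ⊆ blockLocus TraceEqCond :=
  blockLocus_mono fun _ _ _ _ h => ⟨h.1, h.2.1.trans h.2.2.symm⟩

theorem cubic_subset : blockLocus (CubicCond (K := K)) ⊆ blockLocus TraceZeroCond :=
  blockLocus_mono fun _ _ _ _ h => h.1

theorem comm_subset : blockLocus (CommCond (K := K)) ⊆ blockLocus TraceZeroCond :=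
  blockLocus_mono fun _ _ _ _ h => h.traceZeroCond

section Incompatible

variable (ψ : AddChar K Circle) (χK : Kˣ →* ℂˣ)

theorem isUnipotentlyIncompatible_trace_ne (hψ : ψ ≠ 1) :
    IsUnipotentlyIncompatible H42.toMatrices (chi42 ψ χK) (Z4 K \ blockLocus TraceEqCond) := by
  obtain ⟨x, hx⟩ := AddChar.ne_one_iff.1 hψ
  obtain ⟨C, hC, hEq⟩ := exists_traceEq_eq_inter K
  have hsub : IsSubmanifold (Z4 K \ blockLocus TraceEqCond) := by
    rw [diff_eq_diff_of_eq_inter subset_rfl hEq]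
    exact (isSubmanifold_nil K).diff_isClosed hC
  have hsq : ∀ z ∈ Z4 K \ blockLocus TraceEqCond, blk₂₂ z * blk₂₂ z = 0 := fun z hz =>
    NilCond.sq (C := 0) (A := 0) (B := 0) hz.1.2
  have hne : ∀ z ∈ Z4 K \ blockLocus TraceEqCond,
      (blk₁₂ z * blk₂₂ z).trace - (blk₂₂ z * blk₂₁ z).trace ≠ 0 := fun z hz h0 =>
    hz.2 ⟨hz.1.1, hz.1.2, sub_eq_zero.1 h0⟩
  have s1 := contDiffOn_blk₁₂ (s := Z4 K \ blockLocus TraceEqCond) fun z hz => hz.1.1.2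
  have s2 := contDiffOn_blk₂₁ (s := Z4 K \ blockLocus TraceEqCond) fun z hz => hz.1.1.2
  have s3 := contDiffOn_blk₂₂ (s := Z4 K \ blockLocus TraceEqCond) fun z hz => hz.1.1.2
  have st := (ContDiffOn.sub (contDiffOn_matrix_trace (contDiffOn_matrix_mul s1 s3))
    (contDiffOn_matrix_trace (contDiffOn_matrix_mul s3 s2))).inv hne
  refine isUnipotentlyIncompatible_of_stabilizer ψ χK hsub
    (isBlockInvariant_nilCond.isStable.diff isBlockInvariant_traceEqCond.isStable)
    -- Pure moves suffice: `b` and `e` are opposite multiples of `AN` and `NB`, so `bN = 0 = Ne` and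
    -- `bB + Ae = 0`. The multiple is scaled so that `tr b + tr e = x`.
    (fun z hz => ⟨hz.1.1.2, hsq z hz⟩) (β := fun _ => 0)
    (b := fun z => (x * ((blk₁₂ z * blk₂₂ z).trace - (blk₂₂ z * blk₂₁ z).trace)⁻¹) •
      (blk₁₂ z * blk₂₂ z))
    (e := fun z => -((x * ((blk₁₂ z * blk₂₂ z).trace - (blk₂₂ z * blk₂₁ z).trace)⁻¹) •
      (blk₂₂ z * blk₂₁ z))) contDiffOn_const
    (contDiffOn_matrix_smul (contDiffOn_const.mul st) (contDiffOn_matrix_mul s1 s3))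
    (contDiffOn_matrix_smul (contDiffOn_const.mul st) (contDiffOn_matrix_mul s3 s2)).neg
    ?_ ?_ ?_ ?_
  · intro z hz
    simp only [Matrix.smul_mul, mul_assoc, hsq z hz]
    simp
  · intro z hz
    simp only [mul_neg, Matrix.mul_smul, ← mul_assoc, hsq z hz]
    simp
  · intro z hz
    simp only [mul_neg, Matrix.mul_smul, Matrix.smul_mul, mul_assoc, hsq z hz]
    simp
  · intro z hz
    rw [Matrix.trace_neg, Matrix.trace_smul, Matrix.trace_smul, smul_eq_mul, smul_eq_mul,
      ← sub_eq_add_neg, ← mul_sub, mul_assoc, inv_mul_cancel₀ (hne z hz), mul_one]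
    exact hx

theorem isUnipotentlyIncompatible_traceZero (hψ : ψ ≠ 1) :
    IsUnipotentlyIncompatible H42.toMatrices (chi42 ψ χK)
      (blockLocus (TraceZeroCond (K := K)) \ (blockLocus CubicCond ∪ blockLocus CommCond)) := by
  obtain ⟨x, hx⟩ := AddChar.ne_one_iff.1 hψ
  obtain ⟨C, hC, hCubic⟩ := exists_cubic_eq_inter K
  obtain ⟨D, hD, hComm⟩ := exists_comm_eq_inter K
  have hsub : IsSubmanifold (blockLocus TraceZeroCond \
      (blockLocus (CubicCond (K := K)) ∪ blockLocus CommCond)) := by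
    rw [diff_eq_diff_of_eq_inter (traceZero_subset.trans traceEq_subset)
      (show _ = Z4 K ∩ (C ∪ D) by rw [hCubic, hComm, Set.inter_union_distrib_left])]
    exact (isSubmanifold_traceZero K).diff_isClosed (hC.union hD)
  set Z := blockLocus TraceZeroCond \ (blockLocus (CubicCond (K := K)) ∪ blockLocus CommCond) with hZ
  let ν : gl42 K → K := fun z => (blk₂₂ z * (blk₂₂ z)ᴴ).trace
  let p : gl42 K → K := fun z => (blk₁₂ z * (blk₂₂ z * (blk₂₂ z)ᴴ)).trace * (ν z)⁻¹
  let s : gl42 K → K := fun z => ((blk₂₂ z)ᴴ * blk₂₂ z * blk₂₁ z).trace * (ν z)⁻¹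
  let τ : gl42 K → K := fun z => 2 * p z - (blk₁₂ z).trace
  let σ : gl42 K → K := fun z => (blk₂₁ z).trace - 2 * s z
  let d : gl42 K → K := fun z => (p z - s z) * ((blk₂₂ z * blk₁₁ z).trace + p z * s z -
    ((blk₁₂ z).trace - p z) * ((blk₂₁ z).trace - s z)) * ((p z)⁻¹ * (s z)⁻¹)
  -- Here `d` is the coefficient of `β` in `tr b + tr e`, so this choice makes the argument of `ψ`
  -- equal to `x`.
  let β : gl42 K → K := fun z => x * (d z)⁻¹
  let b : gl42 K → Mat2 K := fun z => (β z * τ z) • 1 + ((s z)⁻¹ * (ν z)⁻¹) •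
    (correction (β z) (τ z) (σ z) (blk₁₁ z) (blk₁₂ z) (blk₂₁ z) (blk₂₂ z) *
      ((blk₂₂ z)ᴴ * blk₂₂ z))
  let e : gl42 K → Mat2 K := fun z => (β z * σ z) • 1 + ((p z)⁻¹ * (ν z)⁻¹) •
    (correction (β z) (τ z) (σ z) (blk₁₁ z) (blk₁₂ z) (blk₂₁ z) (blk₂₂ z) *
      (blk₂₂ z * (blk₂₂ z)ᴴ))
  have hsc : ∀ z ∈ Z, _ := fun z hz =>
    TraceZeroCond.exists_scalars' hz.1.2 (p := p z) (s := s z) rfl rfl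
  have hν0 : ∀ z ∈ Z, ν z ≠ 0 := fun z hz => trace_mul_conjTranspose_ne_zero hz.1.2.1.2
  have hp0 : ∀ z ∈ Z, p z ≠ 0 := fun z hz h0 => mul_blk₂₂_ne_zero hz.1.1 hz.1.2.1 (by
    rw [(hsc z hz).1, h0, zero_smul])
  have hs0 : ∀ z ∈ Z, s z ≠ 0 := fun z hz h0 => blk₂₂_mul_ne_zero hz.1.1 hz.1.2.1 (by
    rw [(hsc z hz).2.2.1, h0, zero_smul])
  have hd0 : ∀ z ∈ Z, d z ≠ 0 := by
    intro z hz
    refine mul_ne_zero (mul_ne_zero ?_ ?_) (mul_ne_zero (inv_ne_zero (hp0 z hz))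
      (inv_ne_zero (hs0 z hz)))
    -- A vanishing first factor means `p = s`, that is `AN = NB`; a vanishing second one means
    -- `cubic = 0`. Both loci are excluded.
    · intro h0
      refine hz.2 (Or.inr ⟨hz.1.1, hz.1.2.1, ?_⟩)
      rw [(hsc z hz).1, (hsc z hz).2.2.1, sub_eq_zero.1 h0]
    · intro h0
      refine hz.2 (Or.inl ⟨hz.1.1, hz.1.2, ?_⟩)
      rw [cubic_eq_smul hz.1.2.1.sq (hsc z hz).1 (hsc z hz).2.1 (hsc z hz).2.2.1
        (hsc z hz).2.2.2, h0, zero_smul]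
  have hid : ∀ z ∈ Z, _ := fun z hz => stabilizer_identities (C := blk₁₁ z) hz.1.2.1.sq hz.1.2.1.2
    (hsc z hz).1 (hsc z hz).2.1 (hsc z hz).2.2.1 (hsc z hz).2.2.2 (hp0 z hz) (hs0 z hz) (β z)
    (b := b z) (e := e z) rfl rfl rfl rfl rfl
  have c1 := contDiffOn_blk₁₁ (s := Z) fun z hz => hz.1.1.2
  have c2 := contDiffOn_blk₁₂ (s := Z) fun z hz => hz.1.1.2
  have c3 := contDiffOn_blk₂₁ (s := Z) fun z hz => hz.1.1.2
  have c4 := contDiffOn_blk₂₂ (s := Z) fun z hz => hz.1.1.2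
  have sν : ContDiffOn ℝ ∞ ν Z := by fun_prop
  have sνi : ContDiffOn ℝ ∞ (fun z => (ν z)⁻¹) Z := sν.inv hν0
  have sp : ContDiffOn ℝ ∞ p Z := by fun_prop
  have ss : ContDiffOn ℝ ∞ s Z := by fun_prop
  have spi : ContDiffOn ℝ ∞ (fun z => (p z)⁻¹) Z := sp.inv hp0
  have ssi : ContDiffOn ℝ ∞ (fun z => (s z)⁻¹) Z := ss.inv hs0
  have sτ : ContDiffOn ℝ ∞ τ Z := by fun_prop
  have sσ : ContDiffOn ℝ ∞ σ Z := by fun_prop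
  have sd : ContDiffOn ℝ ∞ d Z := by fun_prop
  have sβ : ContDiffOn ℝ ∞ β Z := contDiffOn_const.mul (sd.inv hd0)
  have sR : ContDiffOn ℝ ∞ (fun z => correction (β z) (τ z) (σ z) (blk₁₁ z) (blk₁₂ z) (blk₂₁ z)
      (blk₂₂ z)) Z := by
    unfold correction
    fun_prop
  have sb : ContDiffOn ℝ ∞ b Z := by fun_prop
  have se : ContDiffOn ℝ ∞ e Z := by fun_prop
  refine isUnipotentlyIncompatible_of_stabilizer ψ χK hsub
    (isBlockInvariant_traceZeroCond.isStable.diff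
      (isBlockInvariant_cubicCond.isStable.union isBlockInvariant_commCond.isStable))
    (fun z hz => ⟨hz.1.1.2, hz.1.2.1.sq⟩) sβ sb se (fun z hz => (hid z hz).1)
    (fun z hz => (hid z hz).2.1) (fun z hz => (hid z hz).2.2.1) fun z hz => ?_
  rw [(hid z hz).2.2.2]
  change ψ (x * (d z)⁻¹ * d z) ≠ 1
  rwa [mul_assoc, inv_mul_cancel₀ (hd0 z hz), mul_one]

end Incompatible

section Proper

variable (K)

theorem isMetricallyProper_traceEq : IsMetricallyProper (traceMetric K)
    (blockLocus TraceEqCond \ blockLocus TraceZeroCond) := by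
  obtain ⟨C, hC, h⟩ := exists_traceZero_eq_inter K
  refine isMetricallyProper_of ?_ (fun z hz => hz.1.1) fun z hz => ?_
  · rw [diff_eq_diff_of_eq_inter traceEq_subset h]
    exact (isSubmanifold_traceEq K).diff_isClosed hC
  · obtain ⟨g, h1, h2⟩ := exists_smul_normalized (traceEq_subset hz.1)
    have hst := isBlockInvariant_traceEqCond.isStable (K := K)
    have hgz := hst g z hz.1
    refine HasNonisotropicNormal.mono Set.sdiff_subset (.of_smul hst g
      (hasNonisotropicNormal_traceEq hgz h1 h2 fun h0 => hz.2 ?_))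
    rw [← isBlockInvariant_traceZeroCond.isStable.smul_mem_iff g]
    exact ⟨hgz.1, hgz.2.1, h0, hgz.2.2.symm.trans h0⟩

theorem isMetricallyProper_cubic : IsMetricallyProper (traceMetric K)
    ((blockLocus CubicCond ∪ blockLocus CommCond) \ blockLocus CommCond) := by
  obtain ⟨C, hC, h⟩ := exists_comm_eq_inter K
  have hsub := (cubic_subset (K := K)).trans (traceZero_subset.trans traceEq_subset)
  -- Only the cubic locus minus the commuting locus is left, so the union need not be shown to be a
  -- submanifold.
  rw [Set.union_sdiff_right]
  refine isMetricallyProper_of ?_ (fun z hz => hz.1.1) fun z hz => ?_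
  · rw [diff_eq_diff_of_eq_inter hsub h]
    exact (isSubmanifold_cubic K).diff_isClosed hC
  · obtain ⟨g, h1, h2⟩ := exists_smul_normalized (hsub hz.1)
    have hst := isBlockInvariant_cubicCond.isStable (K := K)
    exact .mono Set.sdiff_subset (.of_smul hst g
      (hasNonisotropicNormal_cubic (hst g z hz.1) h1 h2))

theorem isMetricallyProper_comm : IsMetricallyProper (traceMetric K) (blockLocus CommCond) := by
  refine isMetricallyProper_of (isSubmanifold_comm K) (fun z hz => hz.1) fun z hz => ?_
  obtain ⟨g, h1, h2⟩ := exists_smul_normalized (z := z) ⟨hz.1, hz.2.1⟩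
  have hst := isBlockInvariant_commCond.isStable (K := K)
  exact .of_smul hst g (hasNonisotropicNormal_comm (hst g z hz) h1 h2)

variable {K}

end Proper

variable (K) in
/-- The filtration of `Z₄`. -/
def filtration : ℕ → Set (gl42 K)
  | 0 => Z4 K
  | 1 => blockLocus TraceEqCond
  | 2 => blockLocus TraceZeroCond
  | 3 => blockLocus CubicCond ∪ blockLocus CommCond
  | 4 => blockLocus CommCond
  | _ => ∅

theorem hasUChiMProperty_Z4 (ψ : AddChar K Circle) (χK : Kˣ →* ℂˣ) (hψ : ψ ≠ 1) :
    HasUChiMProperty H42.toMatrices (chi42 ψ χK) (traceMetric K) (Z4 K) := by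
  obtain ⟨C₁, hC₁, h₁⟩ := exists_traceEq_eq_inter K
  obtain ⟨C₂, hC₂, h₂⟩ := exists_traceZero_eq_inter K
  obtain ⟨C₃, hC₃, h₃⟩ := exists_cubic_eq_inter K
  obtain ⟨C₄, hC₄, h₄⟩ := exists_comm_eq_inter K
  have s₀ := isBlockInvariant_nilCond.isStable (K := K)
  have s₃ := isBlockInvariant_cubicCond.isStable (K := K)
  have s₄ := isBlockInvariant_commCond.isStable (K := K)
  refine ⟨s₀, isLocallyClosed_Z4, 4, filtration K, rfl, rfl, fun i hi => ?_, fun i hi => ?_,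
    fun i hi => ?_⟩ <;> interval_cases i
  · exact traceEq_subset
  · exact traceZero_subset
  · exact Set.union_subset cubic_subset comm_subset
  · exact Set.subset_union_right
  · exact Set.empty_subset _
  · exact ⟨s₀, Set.univ, isClosed_univ, (Set.inter_univ _).symm⟩
  · exact ⟨isBlockInvariant_traceEqCond.isStable, C₁, hC₁, h₁⟩
  · exact ⟨isBlockInvariant_traceZeroCond.isStable, C₂, hC₂, h₂⟩
  · refine ⟨s₃.union s₄, C₃ ∪ C₄, hC₃.union hC₄, ?_⟩
    change _ ∪ _ = _
    rw [h₃, h₄, Set.inter_union_distrib_left]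
  · exact ⟨s₄, C₄, hC₄, h₄⟩
  · exact Or.inl (isUnipotentlyIncompatible_trace_ne ψ χK hψ)
  · exact Or.inr (isMetricallyProper_traceEq K)
  · exact Or.inl (isUnipotentlyIncompatible_traceZero ψ χK hψ)
  · exact Or.inr (isMetricallyProper_cubic K)
  · refine Or.inr ?_
    change IsMetricallyProper _ (blockLocus CommCond \ ∅)
    rw [Set.sdiff_empty]
    exact isMetricallyProper_comm K

end Filtration

end UChiM

theorem mainTheorem8 (K : Type*) [RCLike K]
    (ψ : AddChar K Circle) (hψ : Continuous ψ) (hψ_nontrivial : ψ ≠ 1)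
    (χK : Kˣ →* ℂˣ) (hχK : Continuous χK) :
    UChiM.IsSubmanifold (UChiM.Z4 K) ∧
      UChiM.HasUChiMProperty UChiM.H42.toMatrices (UChiM.chi42 ψ χK) (UChiM.traceMetric K)
        (UChiM.Z4 K) :=
  ⟨UChiM.isSubmanifold_nil K, UChiM.hasUChiMProperty_Z4 ψ χK hψ_nontrivial⟩
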